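/- **Setting.** Let $\mathbb A$ be an infinite set of names. A *nominal set* is a set with an action of the group of finite permutations of $\mathbb A$ in which every element has a finite support; a name $a$ is *fresh* for $x$ ($a\,\#\,x$) if some finite support of $x$ does not contain $a$. A *01-substitution set* is a nominal set $X$ with an equivariant operation $x(a:=i)$ ($a\in\mathbb A$, $i\in\{0,1\}$) such that $a\,\#\,x(a:=i)$; $x(a:=i)=x$ if $a\,\#\,x$; and $x(a:=i)(a':=i')=x(a':=i')(a:=i)$ if $a\ne a'$. With the equivariant maps preserving substitution these form the category $\mathsf{01Sub}$. Let $o\in\{0,1\}$ and $f:X\to Y$. For a finite $A\subseteq\mathbb A$ and $a\in A$, an *$o$-open $(A,a)$-box over $f$* is a pair $(u,y)$ with $y\in Y$ and $u:(A\times\{0,1\})\setminus\{(a,o)\}\to X$ such that $b\,\#\,u(b,i)$, $f(u(b,i))=y(b:=i)$, and $u(b,i)(b':=i')=u(b',i')(b:=i)$ whenever $b\neq b'$. A *filler* is an $x\in X$ with $f(x)=y$ and $x(b:=i)=u(b,i)$ for all $(b,i)$ in the domain of $u$. The map $f$ is a *Kan fibration* if for $o=1$ and $o=0$ there is a choice of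 fillers of all $o$-open boxes that commutes with finite permutations and with the substitutions $(c:=i)$ for $c\notin A$. **The comonad $\mathsf L$.** For $f:X\to Y$ put $K_nf = X\amalg K_n^{\uparrow}f\amalg K_n^{+}f\amalg K_n^{\downarrow}f\amalg K_n^{-}f$, where $K_n^{\uparrow}f$ (resp. $K_n^{\downarrow}f$) is the set of $1$-open (resp. $0$-open) boxes over the map $\operatorname{colim}_{m<n}K_mf\to Y$, and $K_n^{+}f$ (resp. $K_n^-f$) is the set of name abstractions ($\alpha$-equivalence classes) $\langle a\rangle(u,y)$ with $(u,y)$ a $1$-open (resp. $0$-open) $(A,a)$-box of this kind. The substitutions extend the one of $X$: for an $o$-open $(A,a)$-box $(u,y)$, the element $(u,y)(c:=i)$ is $u(c,i)$ if $(c,i)$ is in the domain of $u$, $\langle a\rangle(u,y)$ if $(c,i)=(a,o)$, and $(u(c:=i),y(c:=i))$ if $c\notin A$; and, for $c\ne a$, $(\langle a\rangle(u,y))(c:=i)$ is $u(c,i)(a:=o)$ if $c\in A$ and $\langle a\rangle(u(c:=i),y(c:=i))$ otherwise. Let $Kf=\operatorname{colim}_nK_nf$, with $\lambda_f:X\to Kf$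 the inclusion and $\rho_f:Kf\to Y$ given by $f$ on $X$, $(u,y)\mapsto y$ and $\langle a\rangle(u,y)\mapsto y(a:=o)$. Then $K$ is functorial on commutative squares by $K(h,k)(x)=h(x)$, $K(h,k)(u,y)=(K(h,k)\circ u,k(y))$, and $\mathsf L f=\lambda_f$ is a comonad on the arrow category of $\mathsf{01Sub}$ with counit $(1,\rho_f)$ and comultiplication $(1,\sigma_f)$, $\sigma_f:Kf\to K\lambda_f$, $\sigma_f(x)=x$, $\sigma_f(u,y)=(\sigma_f\circ u,(u,y))$. Let $\bar{\mathcal L}$ be the class of retracts of maps that admit an $\mathsf L$-coalgebra structure. A *path object* on $f$ is a factorisation of the diagonal $\Delta:X\to X\times_YX$ as a map in $\bar{\mathcal L}$ followed by a Kan fibration. **The labelled path object.** Let $f:X\to Y$ and $a\in\mathbb A$. The *pre-normal forms in direction $a$* form the smallest subset of $K\Delta$ containing the $x\in X$ with $a\,\#\,x$, and containing $(u,(x_1,x_2))$ whenever $u$ is a $1$-open $(A,a)$-box over $(x_1,x_2)$ such that $a\,\#\,x_1$, $u(a,0)=x_1$, and $u(b,i)$ is a pre-normal form in direction $a$ for all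 $b\in A\setminus\{a\}$, $i\in\{0,1\}$. The object $P_YX\subseteq K\Delta$ consists of the elements $z(a:=1)$ with $a\in\mathbb A$ and $z$ a pre-normal form in direction $a$. Let $r:X\to P_YX$ be the inclusion, $\rho:P_YX\to X\times_YX$ the restriction of $\rho_\Delta$, and $p_f:P_YX\to Y$ its composite with $X\times_YX\to Y$. **Theorem.** Let $f:X\to Y$ be a Kan fibration in $\mathsf{01Sub}$. Then: 1. $r$ has a coalgebra structure for $\mathsf L$ regarded as a copointed endofunctor, i.e. there is $c:P_YX\to Kr$ with $c\circ r=\lambda_r$ and $\rho_r\circ c=1$; 2. $r\in\bar{\mathcal L}$; 3. $P_YX$ is a path object on $f$: $\rho\circ r=\Delta$, $r\in\bar{\mathcal L}$, and $\rho$ is a Kan fibration; 4. $P$ is stable under pullback: for every commutative square $f\circ h=k\circ g$ with $g:U\to V$, $h:U\to X$, $k:V\to Y$, the map $K\Delta_g\to K\Delta_f$ induced by $h$ and $k$ restricts to a map $\varphi:P_VU\to P_YX$ with $p_f\circ\varphi=k\circ p_g$, and if the given square is a pullback, then so is the square $p_f\circ\varphi=k\circ p_g$. -/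

import Mathlib

set_option linter.unusedSectionVars false

open CategoryTheory

universe u

namespace ZeroOneSub

noncomputable section Constructions

open scoped Classical Pointwise

/-- The group `Perm(𝔸)` of finite permutations of the set of names `𝔸`. -/
def FinPerm (𝔸 : Type u) : Subgroup (Equiv.Perm 𝔸) where
  carrier := {π | {a | π a ≠ a}.Finite}
  one_mem' := by simp
  mul_mem' {π σ} hπ hσ := by
    refine (hπ.union hσ).subset fun a ha => ?_
    by_contra h
    simp only [Set.mem_union, Set.mem_ofPred_eq, not_or, not_not] at h
    exact ha (by simp [h.1, h.2])
  inv_mem' {π} hπ := hπ.subset fun a ha h => ha (Equiv.Perm.inv_eq_iff_eq.2 (Eq.symm h))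

variable {𝔸 : Type u}

/-- The transposition `(a b)` as a finite permutation. -/
def swp (a b : 𝔸) : FinPerm 𝔸 :=
  ⟨Equiv.swap a b, (Set.toFinite {a, b}).subset fun c hc => by
    by_contra h
    simp only [Set.mem_insert_iff, Set.mem_singleton_iff, not_or] at h
    exact hc (Equiv.swap_apply_of_ne_of_ne h.1 h.2)⟩

theorem swp_left (a b : 𝔸) : swp a b • a = b := Equiv.swap_apply_left a b
theorem swp_right (a b : 𝔸) : swp a b • b = a := Equiv.swap_apply_right a b
theorem swp_of_ne {a b c : 𝔸} (h1 : c ≠ a) (h2 : c ≠ b) : swp a b • c = c :=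
  Equiv.swap_apply_of_ne_of_ne h1 h2
theorem swp_self (a : 𝔸) : swp a a = 1 := Subtype.ext (Equiv.swap_self a)
theorem swp_comm (a b : 𝔸) : swp a b = swp b a := Subtype.ext (Equiv.swap_comm a b)
theorem swp_mul_self (a b : 𝔸) : swp a b * swp a b = 1 := Subtype.ext (Equiv.swap_mul_self a b)
theorem swp_inv (a b : 𝔸) : (swp a b)⁻¹ = swp a b := Subtype.ext (Equiv.swap_inv a b)
theorem mul_swp (π : FinPerm 𝔸) (a b : 𝔸) : π * swp a b = swp (π • a) (π • b) * π :=
  Subtype.ext (Equiv.mul_swap_eq_swap_mul π.1 a b)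

/-- A nominal set: a `Perm(𝔸)`-set all of whose elements have a finite support. -/
class Nominal (𝔸 : Type u) (X : Type u) extends MulAction (FinPerm 𝔸) X where
  exists_supp : ∀ x : X, ∃ A : Finset 𝔸, MulAction.Supports (FinPerm 𝔸) (A : Set 𝔸) x

/-- The name `a` is fresh for `x`: some finite support of `x` does not contain `a`. -/
def Fresh {X : Type u} [MulAction (FinPerm 𝔸) X] (a : 𝔸) (x : X) : Prop :=
  ∃ A : Finset 𝔸, MulAction.Supports (FinPerm 𝔸) (A : Set 𝔸) x ∧ a ∉ A

theorem supports_map {X Y : Type u} [MulAction (FinPerm 𝔸) X] [MulAction (FinPerm 𝔸) Y]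
    {F : X → Y} (hF : ∀ (π : FinPerm 𝔸) x, F (π • x) = π • F x) {A : Set 𝔸} {x : X}
    (h : MulAction.Supports (FinPerm 𝔸) A x) : MulAction.Supports (FinPerm 𝔸) A (F x) :=
  fun π hπ => by rw [← hF, h π hπ]

theorem Fresh.map {X Y : Type u} [MulAction (FinPerm 𝔸) X] [MulAction (FinPerm 𝔸) Y]
    {F : X → Y} (hF : ∀ (π : FinPerm 𝔸) x, F (π • x) = π • F x) {a : 𝔸} {x : X}
    (h : Fresh a x) : Fresh a (F x) :=
  h.imp fun _ hA => ⟨supports_map hF hA.1, hA.2⟩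

theorem Fresh.of_map {X Y : Type u} [MulAction (FinPerm 𝔸) X] [MulAction (FinPerm 𝔸) Y]
    {F : X → Y} (hF : ∀ (π : FinPerm 𝔸) x, F (π • x) = π • F x) (hi : Function.Injective F)
    {a : 𝔸} {x : X} (h : Fresh a (F x)) : Fresh a x :=
  h.imp fun _ hA => ⟨fun π hπ => hi (by rw [hF, hA.1 π hπ]), hA.2⟩

theorem supports_smul {X : Type u} [MulAction (FinPerm 𝔸) X] {A : Finset 𝔸} {x : X}
    (h : MulAction.Supports (FinPerm 𝔸) (A : Set 𝔸) x) (π : FinPerm 𝔸) :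
    MulAction.Supports (FinPerm 𝔸) ((π • A : Finset 𝔸) : Set 𝔸) (π • x) := by
  intro σ hσ
  have := h (π⁻¹ * σ * π) (fun a ha => by
    have := hσ (a := π • a) (by simpa using ha)
    rw [mul_smul, mul_smul, this, inv_smul_smul])
  rw [mul_smul, mul_smul, inv_smul_eq_iff] at this
  exact this

theorem Fresh.smul {X : Type u} [MulAction (FinPerm 𝔸) X] {a : 𝔸} {x : X}
    (h : Fresh a x) (π : FinPerm 𝔸) : Fresh (π • a) (π • x) := by
  obtain ⟨A, hA, ha⟩ := h
  exact ⟨π • A, supports_smul hA π, by simpa using ha⟩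

theorem exists_fresh [Infinite 𝔸] {X : Type u} [Nominal 𝔸 X] (S : Finset 𝔸) (x : X) :
    ∃ a : 𝔸, a ∉ S ∧ Fresh a x := by
  obtain ⟨A, hA⟩ := Nominal.exists_supp (𝔸 := 𝔸) x
  obtain ⟨a, ha⟩ := Infinite.exists_notMem_finset (S ∪ A)
  simp only [Finset.mem_union, not_or] at ha
  exact ⟨a, ha.1, A, hA, ha.2⟩

theorem exists_fresh₂ [Infinite 𝔸] {X Y : Type u} [Nominal 𝔸 X] [Nominal 𝔸 Y]
    (S : Finset 𝔸) (x : X) (y : Y) : ∃ a : 𝔸, a ∉ S ∧ Fresh a x ∧ Fresh a y := by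
  obtain ⟨A, hA⟩ := Nominal.exists_supp (𝔸 := 𝔸) x
  obtain ⟨a, ha, hay⟩ := exists_fresh (S ∪ A) y
  simp only [Finset.mem_union, not_or] at ha
  exact ⟨a, ha.1, ⟨A, hA, ha.2⟩, hay⟩

theorem swp_smul_of_fresh [Infinite 𝔸] {X : Type u} [MulAction (FinPerm 𝔸) X] {a b : 𝔸} {x : X}
    (ha : Fresh a x) (hb : Fresh b x) : swp a b • x = x := by
  obtain ⟨A, hA, ha⟩ := ha
  obtain ⟨B, hB, hb⟩ := hb
  rcases eq_or_ne a b with rfl | hab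
  · rw [swp_self, one_smul]
  obtain ⟨c, hc⟩ := Infinite.exists_notMem_finset (A ∪ B ∪ {a, b})
  simp only [Finset.mem_union, Finset.mem_insert, Finset.mem_singleton, not_or] at hc
  obtain ⟨⟨hcA, hcB⟩, hca, hcb⟩ := hc
  have h1 : swp a c • x = x := hA _ fun d hd =>
    swp_of_ne (fun h => ha (h ▸ hd)) (fun h => hcA (h ▸ hd))
  have h2 : swp b c • x = x := hB _ fun d hd =>
    swp_of_ne (fun h => hb (h ▸ hd)) (fun h => hcB (h ▸ hd))
  have h3 : swp a b = swp a c * swp b c * swp a c := by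
    rw [mul_swp (swp a c) b c, swp_of_ne hab.symm (Ne.symm hcb), swp_right, mul_assoc,
      swp_mul_self, mul_one, swp_comm]
  rw [h3, mul_smul, mul_smul, h1, h2, h1]

/-- A `01`-substitution set: a nominal set with an equivariant operation
`sub x a i = x(a := i)` (here `false` stands for `0` and `true` for `1`). -/
class Sub01Set (𝔸 : Type u) (X : Type u) extends Nominal 𝔸 X where
  sub : X → 𝔸 → Bool → X
  perm_sub : ∀ (π : FinPerm 𝔸) (x : X) (a : 𝔸) (i : Bool), π • sub x a i = sub (π • x) (π • a) i
  fresh_sub : ∀ (x : X) (a : 𝔸) (i : Bool), Fresh a (sub x a i)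
  sub_of_fresh : ∀ (x : X) (a : 𝔸) (i : Bool), Fresh a x → sub x a i = x
  sub_comm : ∀ (x : X) (a a' : 𝔸) (i i' : Bool), a ≠ a' →
    sub (sub x a i) a' i' = sub (sub x a' i') a i


open Sub01Set (sub perm_sub fresh_sub sub_of_fresh sub_comm)

theorem fresh_sub_of_fresh {X : Type u} [Sub01Set 𝔸 X] {c a : 𝔸} {x : X} (h : Fresh c x)
    (hca : c ≠ a) (i : Bool) : Fresh c (sub x a i) := by
  rw [← sub_of_fresh x c false h, sub_comm _ _ _ _ _ hca]
  exact fresh_sub _ _ _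

/-- `01`-substitution sets over the set of names `𝔸`. -/
structure Sub01 (𝔸 : Type u) : Type (u + 1) where
  carrier : Type u
  [str : Sub01Set 𝔸 carrier]

namespace Sub01

instance : CoeSort (Sub01 𝔸) (Type u) := ⟨carrier⟩

instance (X : Sub01 𝔸) : Sub01Set 𝔸 X := X.str

/-- Morphisms: equivariant maps preserving the substitution operation. -/
@[ext]
structure Hom (X Y : Sub01 𝔸) where
  toFun : X → Y
  map_smul' : ∀ (π : FinPerm 𝔸) (x : X), toFun (π • x) = π • toFun x
  map_sub' : ∀ (x : X) (a : 𝔸) (i : Bool), toFun (sub x a i) = sub (toFun x) a i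

/-- The category `01Sub`. -/
instance : Category (Sub01 𝔸) where
  Hom := Hom
  id X := ⟨id, fun _ _ => rfl, fun _ _ _ => rfl⟩
  comp f g := ⟨g.toFun ∘ f.toFun,
    fun π x => by simp [f.map_smul', g.map_smul'], fun x a i => by simp [f.map_sub', g.map_sub']⟩

instance (X Y : Sub01 𝔸) : FunLike (X ⟶ Y) X Y where
  coe := Hom.toFun
  coe_injective _ _ h := Hom.ext h

variable {X Y Z : Sub01 𝔸}

theorem hom_ext {f g : X ⟶ Y} (h : ∀ x, f x = g x) : f = g := Hom.ext (funext h)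

@[simp] theorem id_apply (x : X) : (𝟙 X : X ⟶ X) x = x := rfl
@[simp] theorem comp_apply (f : X ⟶ Y) (g : Y ⟶ Z) (x : X) : (f ≫ g) x = g (f x) := rfl
theorem hom_smul (f : X ⟶ Y) (π : FinPerm 𝔸) (x : X) : f (π • x) = π • f x := f.map_smul' π x
theorem hom_sub (f : X ⟶ Y) (x : X) (a : 𝔸) (i : Bool) : f (sub x a i) = sub (f x) a i :=
  f.map_sub' x a i
theorem congr_hom {f g : X ⟶ Y} (h : f = g) (x : X) : f x = g x := by rw [h]

end Sub01

open Sub01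

variable {X Y Z W P Q : Sub01 𝔸}

/-- `(b, i)` belongs to `(A × 2) ∖ {(a, o)}`. -/
def IsFace (A : Finset 𝔸) (a : 𝔸) (o : Bool) (b : 𝔸) (i : Bool) : Prop :=
  b ∈ A ∧ ¬ (b = a ∧ i = o)

/-- `o`-open `(A, a)`-boxes over `f`, for varying `A` and `a ∈ A`. -/
structure Box (o : Bool) (f : X ⟶ Y) where
  A : Finset 𝔸
  a : 𝔸
  mem : a ∈ A
  u : ∀ b i, IsFace A a o b i → X
  y : Y
  fresh : ∀ b i h, Fresh b (u b i h)
  adj : ∀ b i h b' i' h', b ≠ b' → sub (u b i h) b' i' = sub (u b' i' h') b i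
  lies : ∀ b i h, f (u b i h) = sub y b i

namespace Box

variable {o : Bool} {f : X ⟶ Y} {g : Z ⟶ W}

theorem ext' {B C : Box o f} (hA : B.A = C.A) (ha : B.a = C.a)
    (hu : ∀ b i h h', B.u b i h = C.u b i h') (hy : B.y = C.y) : B = C := by
  obtain ⟨A, a, m, u, y, _, _, _⟩ := B
  obtain ⟨A', a', m', u', y', _, _, _⟩ := C
  subst hA ha hy
  have : u = u' := by funext b i h; exact hu b i h h
  subst this
  rfl

theorem u_congr {B C : Box o f} (h : B = C) (b i hB hC) : B.u b i hB = C.u b i hC := by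
  subst h; rfl

theorem u_congr' (B : Box o f) {b b' : 𝔸} (h : b = b') (i hB hC) :
    B.u b i hB = B.u b' i hC := by
  subst h; rfl

theorem isFace_smul {A : Finset 𝔸} {a b : 𝔸} {i : Bool} (π : FinPerm 𝔸) :
    IsFace (π • A) (π • a) o b i ↔ IsFace A a o (π⁻¹ • b) i := by
  simp only [IsFace, Finset.inv_smul_mem_iff, inv_smul_eq_iff]

/-- The action of permutations: `(π · u)(b, i) = π · u(π⁻¹ b, i)`. -/
def smulBox (π : FinPerm 𝔸) (B : Box o f) : Box o f where
  A := π • B.A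
  a := π • B.a
  mem := by simpa using B.mem
  u b i h := π • B.u (π⁻¹ • b) i ((isFace_smul π).1 h)
  y := π • B.y
  fresh b i h := by
    have := (B.fresh (π⁻¹ • b) i ((isFace_smul π).1 h)).smul π
    rwa [smul_inv_smul] at this
  adj b i h b' i' h' hb := by
    have := congrArg (π • ·) (B.adj _ i ((isFace_smul π).1 h) _ i' ((isFace_smul π).1 h')
      (by simpa using hb))
    simpa only [perm_sub, smul_inv_smul] using this
  lies b i h := by
    rw [hom_smul, B.lies, perm_sub, smul_inv_smul]

instance : MulAction (FinPerm 𝔸) (Box o f) where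
  smul := smulBox
  one_smul B := ext' (one_smul _ B.A) (one_smul _ B.a)
    (fun b i h h' => by
      change (1 : FinPerm 𝔸) • B.u ((1 : FinPerm 𝔸)⁻¹ • b) i _ = _
      rw [one_smul]; exact B.u_congr' (by simp) _ _ _) (one_smul _ B.y)
  mul_smul π σ B := ext' (mul_smul π σ B.A) (mul_smul π σ B.a)
    (fun b i h h' => by
      change (π * σ) • B.u ((π * σ)⁻¹ • b) i _ = π • σ • B.u (σ⁻¹ • π⁻¹ • b) i _
      rw [mul_smul]; congr 2) (mul_smul π σ B.y)

@[simp] theorem smul_A (π : FinPerm 𝔸) (B : Box o f) : (π • B).A = π • B.A := rfl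
@[simp] theorem smul_a (π : FinPerm 𝔸) (B : Box o f) : (π • B).a = π • B.a := rfl
@[simp] theorem smul_y (π : FinPerm 𝔸) (B : Box o f) : (π • B).y = π • B.y := rfl
theorem smul_u (π : FinPerm 𝔸) (B : Box o f) (b i h) :
    (π • B).u b i h = π • B.u (π⁻¹ • b) i ((isFace_smul π).1 h) := rfl
theorem smul_u' (π : FinPerm 𝔸) (B : Box o f) (b i h h') :
    (π • B).u (π • b) i h' = π • B.u b i h := by
  rw [smul_u]; congr 1; exact B.u_congr' (by simp) _ _ _

theorem supports_of {B : Box o f} {S : Finset 𝔸} (hA : B.A ⊆ S)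
    (hu : ∀ b i h, MulAction.Supports (FinPerm 𝔸) (S : Set 𝔸) (B.u b i h))
    (hy : MulAction.Supports (FinPerm 𝔸) (S : Set 𝔸) B.y) :
    MulAction.Supports (FinPerm 𝔸) (S : Set 𝔸) B := by
  intro π hπ
  have hπA : ∀ b ∈ B.A, π • b = b := fun b hb => hπ (by exact_mod_cast hA hb)
  have hAA : π • B.A = B.A := by
    ext b
    constructor
    · intro hb
      obtain ⟨c, hc, rfl⟩ := Finset.mem_smul_finset.1 hb
      rwa [hπA c hc]
    · intro hb
      exact Finset.mem_smul_finset.2 ⟨b, hb, hπA b hb⟩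
  refine ext' hAA (hπA _ B.mem) (fun b i h h' => ?_) (hy π hπ)
  have e : π⁻¹ • b = b := by rw [inv_smul_eq_iff, hπA b h'.1]
  rw [smul_u, B.u_congr' e i _ h', hu b i h' π hπ]

theorem exists_supp_avoiding {B : Box o f} {T : Set 𝔸} (hA : ∀ c ∈ T, c ∉ B.A)
    (hu : ∀ b i h, ∃ S : Finset 𝔸, MulAction.Supports (FinPerm 𝔸) (S : Set 𝔸) (B.u b i h) ∧
      ∀ c ∈ T, c ∉ S)
    (hy : ∃ S : Finset 𝔸, MulAction.Supports (FinPerm 𝔸) (S : Set 𝔸) B.y ∧ ∀ c ∈ T, c ∉ S) :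
    ∃ S : Finset 𝔸, MulAction.Supports (FinPerm 𝔸) (S : Set 𝔸) B ∧ ∀ c ∈ T, c ∉ S := by
  choose S hS hT using hu
  obtain ⟨Sy, hSy, hTy⟩ := hy
  let S' : 𝔸 → Bool → Finset 𝔸 := fun b i => if h : IsFace B.A B.a o b i then S b i h else ∅
  have hS' : ∀ b i h, S' b i = S b i h := fun b i h => dif_pos h
  refine ⟨B.A ∪ Sy ∪ B.A.biUnion fun b => S' b false ∪ S' b true, supports_of ?_ ?_ ?_, ?_⟩
  · intro b hb; simp [hb]
  · intro b i h
    refine (hS b i h).mono fun c hc => ?_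
    rw [← hS'] at hc
    have hc : c ∈ S' b i := hc
    simp only [Finset.coe_union, Set.mem_union, Finset.mem_coe, Finset.mem_biUnion,
      Finset.mem_union]
    refine Or.inr ⟨b, h.1, ?_⟩
    cases i
    · exact Or.inl hc
    · exact Or.inr hc
  · refine hSy.mono fun c hc => ?_
    simp only [Finset.coe_union, Set.mem_union]
    exact Or.inl (Or.inr hc)
  · have hc' : ∀ c ∈ T, ∀ b i, c ∉ S' b i := fun c hc b i => by
      by_cases h : IsFace B.A B.a o b i
      · rw [hS' b i h]; exact hT b i h c hc
      · simp [S', h]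
    intro c hc
    simp only [Finset.mem_union, Finset.mem_biUnion, not_or, not_exists, not_and]
    exact ⟨⟨hA c hc, hTy c hc⟩, fun b _ => ⟨hc' c hc b _, hc' c hc b _⟩⟩

instance : Nominal 𝔸 (Box o f) where
  exists_supp B := by
    obtain ⟨S, hS, -⟩ := exists_supp_avoiding (B := B) (T := ∅) (by simp)
      (fun b i h => by
        obtain ⟨S, hS⟩ := Nominal.exists_supp (𝔸 := 𝔸) (B.u b i h); exact ⟨S, hS, by simp⟩)
      (by obtain ⟨S, hS⟩ := Nominal.exists_supp (𝔸 := 𝔸) B.y; exact ⟨S, hS, by simp⟩)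
    exact ⟨S, hS⟩

theorem fresh_of {B : Box o f} {c : 𝔸} (hA : c ∉ B.A) (hu : ∀ b i h, Fresh c (B.u b i h))
    (hy : Fresh c B.y) : Fresh c B := by
  obtain ⟨S, hS, hc⟩ := exists_supp_avoiding (B := B) (T := {c}) (by simpa using hA)
    (fun b i h => by simpa [Fresh] using hu b i h) (by simpa [Fresh] using hy)
  exact ⟨S, hS, hc c rfl⟩

theorem notMem_of_fresh [Infinite 𝔸] {B : Box o f} {c : 𝔸} (h : Fresh c B) : c ∉ B.A := by
  intro hc
  obtain ⟨d, hd, hdB⟩ := exists_fresh B.A B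
  have h1 : swp c d • B.A = B.A := congrArg Box.A (swp_smul_of_fresh h hdB)
  apply hd
  rw [← h1]
  exact Finset.mem_smul_finset.2 ⟨c, hc, swp_left c d⟩

theorem fresh_y {B : Box o f} {c : 𝔸} (h : Fresh c B) : Fresh c B.y :=
  h.map (F := fun B : Box o f => B.y) fun _ _ => rfl

theorem fresh_u [Infinite 𝔸] {B : Box o f} {c : 𝔸} (h : Fresh c B) (b i hf) :
    Fresh c (B.u b i hf) := by
  have hc := notMem_of_fresh h
  obtain ⟨S, hS, hcS⟩ := h
  refine ⟨S ∪ B.A, fun π hπ => ?_, by simp [hcS, hc]⟩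
  have h1 : π • B = B := hS π fun a ha => hπ (by simp only [Finset.coe_union]; exact Or.inl ha)
  have h2 : π • b = b := hπ (by simp only [Finset.coe_union]; exact Or.inr hf.1)
  have hf' : IsFace (π • B).A (π • B).a o (π • b) i := by rw [h1, h2]; exact hf
  rw [← smul_u' π B b i hf hf', (π • B).u_congr' h2 i _ (by rw [h1]; exact hf)]
  exact u_congr h1 _ _ _ _

/-- The substitution `(u, y)(c := j)` for `c ∉ A`. -/
def subst (B : Box o f) (c : 𝔸) (j : Bool) (hc : c ∉ B.A) : Box o f where
  A := B.A
  a := B.a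
  mem := B.mem
  u b i h := sub (B.u b i h) c j
  y := sub B.y c j
  fresh b i h := by
    have hb : b ≠ c := fun e => hc (e ▸ h.1)
    have e : sub (B.u b i h) c j = sub (sub (B.u b i h) c j) b i := by
      rw [sub_comm _ _ _ _ _ hb.symm, sub_of_fresh _ _ _ (B.fresh b i h)]
    rw [e]
    exact fresh_sub _ _ _
  adj b i h b' i' h' hb := by
    have h1 : c ≠ b := fun e => hc (e ▸ h.1)
    have h2 : c ≠ b' := fun e => hc (e ▸ h'.1)
    rw [sub_comm _ _ _ _ _ h2, B.adj b i h b' i' h' hb, sub_comm _ _ _ _ _ h1]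
  lies b i h := by
    have h1 : c ≠ b := fun e => hc (e ▸ h.1)
    rw [hom_sub, B.lies, sub_comm _ _ _ _ _ h1]

theorem subst_smul (B : Box o f) (c j hc) (π : FinPerm 𝔸) (hc') :
    (π • B).subst (π • c) j hc' = π • B.subst c j hc :=
  ext' rfl rfl (fun b i h h' => by
    change sub (π • B.u (π⁻¹ • b) i _) (π • c) j = π • sub (B.u (π⁻¹ • b) i _) c j
    rw [perm_sub]) (by
    change sub (π • B.y) (π • c) j = π • sub B.y c j
    rw [perm_sub])

theorem fresh_subst (B : Box o f) (c j hc) : Fresh c (B.subst c j hc) :=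
  fresh_of hc (fun _ _ _ => fresh_sub _ _ _) (fresh_sub _ _ _)

theorem subst_of_fresh [Infinite 𝔸] (B : Box o f) (c j hc) (h : Fresh c B) :
    B.subst c j hc = B :=
  ext' rfl rfl (fun _ _ _ _ => sub_of_fresh _ _ _ (fresh_u h _ _ _)) (sub_of_fresh _ _ _ (fresh_y h))

theorem subst_comm (B : Box o f) (c j hc d k hd) (hcd : c ≠ d) :
    (B.subst c j hc).subst d k hd = (B.subst d k hd).subst c j hc :=
  ext' rfl rfl (fun _ _ _ _ => sub_comm _ _ _ _ _ hcd) (sub_comm _ _ _ _ _ hcd)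

/-- The image of a box along a commutative square `(φ, k)` from `f` to `g`. -/
def map (φ : X ⟶ Z) (k : Y ⟶ W) (w : f ≫ k = φ ≫ g) (B : Box o f) : Box o g where
  A := B.A
  a := B.a
  mem := B.mem
  u b i h := φ (B.u b i h)
  y := k B.y
  fresh b i h := (B.fresh b i h).map (hom_smul φ)
  adj b i h b' i' h' hb := by rw [← hom_sub, ← hom_sub, B.adj b i h b' i' h' hb]
  lies b i h := by rw [← comp_apply, ← w, comp_apply, B.lies, hom_sub]

theorem map_smul' (φ : X ⟶ Z) (k : Y ⟶ W) (w : f ≫ k = φ ≫ g) (B : Box o f) (π : FinPerm 𝔸) :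
    (π • B).map φ k w = π • B.map φ k w :=
  ext' rfl rfl (fun _ _ _ _ => hom_smul φ _ _) (hom_smul k _ _)

theorem map_subst (φ : X ⟶ Z) (k : Y ⟶ W) (w : f ≫ k = φ ≫ g) (B : Box o f) (c j hc) :
    (B.subst c j hc).map φ k w = (B.map φ k w).subst c j hc :=
  ext' rfl rfl (fun _ _ _ _ => hom_sub φ _ _ _) (hom_sub k _ _ _)

theorem map_injective (φ : X ⟶ Z) (k : Y ⟶ W) (w : f ≫ k = φ ≫ g) (hφ : Function.Injective φ)
    (hk : Function.Injective k) : Function.Injective (map (o := o) φ k w) := fun B C h => by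
  have hA : B.A = C.A := congrArg (fun D : Box o g => D.A) h
  have ha : B.a = C.a := congrArg (fun D : Box o g => D.a) h
  refine ext' hA ha (fun b i hb hc => ?_) (hk (congrArg (fun D : Box o g => D.y) h))
  exact hφ (u_congr h b i hb hc)

end Box

section Colimit

variable (G : ℕ ⥤ Sub01 𝔸)

/-- The transition maps of a sequence. -/
abbrev Seq.tr : ∀ ⦃n m : ℕ⦄, n ≤ m → (G.obj n ⟶ G.obj m) := fun _ _ h => G.map (homOfLE h)

instance Seq.directed : DirectedSystem (fun n => G.obj n) (fun _ _ h => Seq.tr G h) where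
  map_self n x := by
    change (G.map (homOfLE le_rfl)) x = x
    rw [show homOfLE (le_refl n) = 𝟙 n from rfl, G.map_id]; rfl
  map_map k j i hij hjk x := by
    change (G.map (homOfLE hjk)) ((G.map (homOfLE hij)) x) = G.map (homOfLE (hij.trans hjk)) x
    rw [← comp_apply, ← G.map_comp]; rfl

/-- The underlying set of the colimit of a sequence. -/
def Seq.Colim : Type u := DirectLimit (fun n => G.obj n) (Seq.tr G)

namespace Seq

variable {G}

/-- The class of `x` in the colimit. -/
def ι (n : ℕ) (x : G.obj n) : Colim G := Quotient.mk _ ⟨n, x⟩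

theorem ι_ind {p : Colim G → Prop} (h : ∀ n x, p (ι n x)) (z : Colim G) : p z :=
  DirectLimit.induction _ h z

theorem ι_tr {n m : ℕ} (h : n ≤ m) (x : G.obj n) : ι m (G.map (homOfLE h) x) = ι n x :=
  DirectLimit.mk_apply (F := fun n => G.obj n) (f := tr G) n m x h

/-- Functions out of the colimit. -/
def desc {T : Type u} (F : ∀ n, G.obj n → T)
    (hF : ∀ n m (h : n ≤ m) x, F n x = F m (G.map (homOfLE h) x)) : Colim G → T :=
  DirectLimit.lift _ F hF

theorem desc_ι {T : Type u} (F : ∀ n, G.obj n → T) (hF n x) : desc F hF (ι n x) = F n x := rfl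

instance : MulAction (FinPerm 𝔸) (Colim G) where
  smul π := desc (fun n x => ι n (π • x)) fun n m h x => by rw [← hom_smul, ι_tr h]
  one_smul := ι_ind fun n x => congrArg (ι n) (one_smul _ x)
  mul_smul π σ := ι_ind fun n x => by
    change ι n ((π * σ) • x) = ι n (π • σ • x)
    rw [mul_smul]

theorem smul_ι (π : FinPerm 𝔸) (n) (x : G.obj n) : π • ι n x = ι n (π • x) := rfl

theorem ι_injective (hG : ∀ n m (h : n ≤ m), Function.Injective (G.map (homOfLE h))) (n : ℕ) :
    Function.Injective (ι (G := G) n) :=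
  DirectLimit.mk_injective (tr G) (fun i j h => hG i j h) n

/-- The colimit of a sequence of injective maps in `01Sub`. -/
def colim (G : ℕ ⥤ Sub01 𝔸) (hG : ∀ n m (h : n ≤ m), Function.Injective (G.map (homOfLE h))) :
    Sub01 𝔸 where
  carrier := Colim G
  str :=
    { exists_supp := ι_ind fun n x =>
        (Nominal.exists_supp (𝔸 := 𝔸) x).imp fun _ h =>
          supports_map (fun π => (smul_ι π n · |>.symm)) h
      sub := fun z c i => desc (fun n x => ι n (sub x c i))
        (fun n m h x => by rw [← hom_sub, ι_tr h]) z
      perm_sub := fun π z c i => by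
        induction z using ι_ind with
        | h n x => exact congrArg (ι n) (perm_sub π x c i)
      fresh_sub := fun z c i => by
        induction z using ι_ind with
        | h n x => exact (fresh_sub x c i).map (fun π => (smul_ι π n · |>.symm))
      sub_of_fresh := fun z c i h => by
        induction z using ι_ind with
        | h n x =>
          exact congrArg (ι n) (sub_of_fresh _ _ _
            (h.of_map (fun π => (smul_ι π n · |>.symm)) (ι_injective hG n)))
      sub_comm := fun z a b i j h => by
        induction z using ι_ind with
        | h n x => exact congrArg (ι n) (sub_comm _ _ _ _ _ h) }

variable (hG : ∀ n m (h : n ≤ m), Function.Injective (G.map (homOfLE h)))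

/-- The maps into the colimit. -/
def ιHom (n : ℕ) : G.obj n ⟶ colim G hG :=
  ⟨ι n, fun π x => (smul_ι π n x).symm, fun _ _ _ => rfl⟩

/-- Morphisms out of the colimit. -/
def descHom (F : ∀ n, G.obj n ⟶ Z) (hF : ∀ n m (h : n ≤ m), F n = G.map (homOfLE h) ≫ F m) :
    colim G hG ⟶ Z where
  toFun := desc (fun n => F n) fun n m h x => congr_hom (hF n m h) x
  map_smul' π := ι_ind fun n x => hom_smul (F n) π x
  map_sub' z c i := by
    induction z using ι_ind with
    | h n x => exact hom_sub (F n) x c i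

end Seq

end Colimit

variable [Infinite 𝔸]

/-- `α`-equivalence on `𝔸 × X`; the class of `(a, x)` is `⟨a⟩x`. -/
def alphaRel {X : Type u} [Nominal 𝔸 X] (p q : 𝔸 × X) : Prop :=
  ∃ c : 𝔸, c ≠ p.1 ∧ c ≠ q.1 ∧ Fresh c p.2 ∧ Fresh c q.2 ∧ swp c p.1 • p.2 = swp c q.1 • q.2

theorem swp_swp_smul {X : Type u} [Nominal 𝔸 X] {a c d : 𝔸} {x : X} (hc : c ≠ a) (hd : d ≠ a)
    (hcx : Fresh c x) (hdx : Fresh d x) : swp d c • swp c a • x = swp d a • x := by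
  rw [← mul_smul, mul_swp, swp_right, swp_of_ne hd.symm hc.symm, mul_smul,
    swp_smul_of_fresh hdx hcx]

theorem alphaRel.swp_eq {X : Type u} [Nominal 𝔸 X] {p q : 𝔸 × X} (h : alphaRel p q) {d : 𝔸}
    (hdp : d ≠ p.1) (hdq : d ≠ q.1) (hp : Fresh d p.2) (hq : Fresh d q.2) :
    swp d p.1 • p.2 = swp d q.1 • q.2 := by
  obtain ⟨c, h1, h2, h3, h4, h5⟩ := h
  rw [← swp_swp_smul h1 hdp h3 hp, h5, swp_swp_smul h2 hdq h4 hq]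

/-- `α`-equivalence as a setoid. -/
def alphaSetoid (X : Type u) [Nominal 𝔸 X] : Setoid (𝔸 × X) where
  r := alphaRel
  iseqv :=
    { refl := fun p => by
        obtain ⟨c, h1, h2⟩ := exists_fresh {p.1} p.2
        simp only [Finset.mem_singleton] at h1
        exact ⟨c, h1, h1, h2, h2, rfl⟩
      symm := fun ⟨c, h1, h2, h3, h4, h5⟩ => ⟨c, h2, h1, h4, h3, h5.symm⟩
      trans := fun {p q r} h h' => by
        obtain ⟨A, hA⟩ := Nominal.exists_supp (𝔸 := 𝔸) q.2
        obtain ⟨d, hd, hp, hr⟩ := exists_fresh₂ ({p.1, q.1, r.1} ∪ A) p.2 r.2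
        simp only [Finset.mem_union, Finset.mem_insert, Finset.mem_singleton, not_or] at hd
        obtain ⟨⟨d1, d2, d3⟩, d4⟩ := hd
        have hq : Fresh d q.2 := ⟨A, hA, d4⟩
        exact ⟨d, d1, d3, hp, hr, (h.swp_eq d1 d2 hp hq).trans (h'.swp_eq d2 d3 hq hr)⟩ }

/-- The abstractions `⟨a⟩(u, y)` where `(u, y)` is an `o`-open `(A, a)`-box over `f`, i.e. the
image in the name abstraction of the set of pairs `(a, (u, y))` of this kind. -/
def Comp (o : Bool) (f : X ⟶ Y) : Type u :=
  Quotient ((alphaSetoid (Box o f)).comap fun B => (B.a, B))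

namespace Comp

variable {o : Bool} {f : X ⟶ Y} {g : Z ⟶ W}

/-- The class `⟨a⟩(u, y)`. -/
def mk (B : Box o f) : Comp o f := Quotient.mk _ B

theorem ind {p : Comp o f → Prop} (h : ∀ B, p (mk B)) (q : Comp o f) : p q := Quotient.ind h q

theorem mk_eq_iff {B C : Box o f} : mk B = mk C ↔ alphaRel (B.a, B) (C.a, C) :=
  ⟨fun h => Quotient.exact h, fun h => Quotient.sound h⟩

theorem alphaRel_smul {B C : Box o f} (h : alphaRel (B.a, B) (C.a, C)) (π : FinPerm 𝔸) :
    alphaRel ((π • B).a, π • B) ((π • C).a, π • C) := by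
  obtain ⟨c, h1, h2, h3, h4, h5⟩ := h
  refine ⟨π • c, by simpa using h1, by simpa using h2, h3.smul π, h4.smul π, ?_⟩
  simp only [Box.smul_a] at h5 ⊢
  rw [← mul_smul, ← mul_smul, ← mul_swp, ← mul_swp, mul_smul, h5, mul_smul]

instance : MulAction (FinPerm 𝔸) (Comp o f) where
  smul π := Quotient.map (π • ·) fun _ _ h => alphaRel_smul h π
  one_smul := ind fun B => congrArg mk (one_smul _ B)
  mul_smul π σ := ind fun B => congrArg mk (mul_smul π σ B)

theorem smul_mk (π : FinPerm 𝔸) (B : Box o f) : π • mk B = mk (π • B) := rfl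

instance : Nominal 𝔸 (Comp o f) where
  exists_supp := ind fun B => by
    obtain ⟨A, hA⟩ := Nominal.exists_supp (𝔸 := 𝔸) B
    exact ⟨A, supports_map (F := mk) (fun _ _ => rfl) hA⟩

theorem fresh_mk {B : Box o f} {c : 𝔸} (h : Fresh c B) : Fresh c (mk B) :=
  h.map (F := mk) fun _ _ => rfl

theorem mk_swp {B : Box o f} {d : 𝔸} (hd : d ≠ B.a) (h : Fresh d B) :
    mk (swp d B.a • B) = mk B := by
  rw [mk_eq_iff]
  obtain ⟨c, hc, hcB, hcB'⟩ := exists_fresh₂ {B.a, d} B (swp d B.a • B)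
  simp only [Finset.mem_insert, Finset.mem_singleton, not_or] at hc
  have e : (swp d B.a • B).a = d := swp_right _ _
  refine ⟨c, by simpa [e] using hc.2, hc.1, hcB', hcB, ?_⟩
  simp only [e]
  exact swp_swp_smul hd hc.1 h hcB

theorem fresh_a (B : Box o f) : Fresh B.a (mk B) := by
  obtain ⟨d, hd, hdB⟩ := exists_fresh {B.a} B
  simp only [Finset.mem_singleton] at hd
  have := (fresh_mk hdB).smul (swp d B.a)
  rwa [swp_left, smul_mk, mk_swp hd hdB] at this

theorem exists_rep (S : Finset 𝔸) (q : Comp o f) : ∃ B, mk B = q ∧ B.a ∉ S := by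
  induction q using ind with
  | h B =>
    obtain ⟨d, hd, hdB⟩ := exists_fresh (insert B.a S) B
    simp only [Finset.mem_insert, not_or] at hd
    refine ⟨_, mk_swp hd.1 hdB, ?_⟩
    rw [Box.smul_a, swp_right]
    exact hd.2

theorem eq_of_mk_eq {B C : Box o f} (h : mk B = mk C) (ha : B.a = C.a) : B = C := by
  rw [mk_eq_iff] at h
  obtain ⟨c, -, -, -, -, h⟩ := h
  simp only [ha] at h
  exact (MulAction.injective _) h

theorem fresh_of_fresh_mk {B : Box o f} {c : 𝔸} (h : Fresh c (mk B)) (hc : c ≠ B.a) :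
    Fresh c B := by
  obtain ⟨d, hd, hdB⟩ := exists_fresh {B.a, c} B
  simp only [Finset.mem_insert, Finset.mem_singleton, not_or] at hd
  have h1 : mk (swp d c • B) = mk B := by
    rw [← smul_mk, swp_smul_of_fresh (fresh_mk hdB) h]
  have h2 : swp d c • B = B := eq_of_mk_eq h1 (swp_of_ne (Ne.symm hd.1) hc.symm)
  have h3 := hdB.smul (swp d c)
  rwa [swp_left, h2] at h3

/-- Functions on boxes that are equivariant relative to `S` and whose values do not depend on
the direction `a` respect `α`-equivalence. -/
theorem wd {T : Type u} [Nominal 𝔸 T] (S : Finset 𝔸) (F : Box o f → T)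
    (hF : ∀ π : FinPerm 𝔸, (∀ a ∈ S, π • a = a) → ∀ B : Box o f, B.a ∉ S →
      F (π • B) = π • F B)
    (hf : ∀ B : Box o f, B.a ∉ S → Fresh B.a (F B)) {B C : Box o f} (h : mk B = mk C)
    (hB : B.a ∉ S) (hC : C.a ∉ S) : F B = F C := by
  rw [mk_eq_iff] at h
  obtain ⟨A, hA⟩ := Nominal.exists_supp (𝔸 := 𝔸) (F B)
  obtain ⟨A', hA'⟩ := Nominal.exists_supp (𝔸 := 𝔸) (F C)
  obtain ⟨d, hd, dB, dC⟩ := exists_fresh₂ (S ∪ {B.a, C.a} ∪ A ∪ A') B C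
  simp only [Finset.mem_union, Finset.mem_insert, Finset.mem_singleton, not_or] at hd
  obtain ⟨⟨⟨d1, d2, d3⟩, d4⟩, d5⟩ := hd
  have key : ∀ D : Box o f, D.a ∉ S → d ≠ D.a → Fresh d (F D) → F (swp d D.a • D) = F D := by
    intro D hD hdD hdF
    rw [hF _ (fun a ha => swp_of_ne (ne_of_mem_of_not_mem ha d1) (ne_of_mem_of_not_mem ha hD)) D hD,
      swp_smul_of_fresh hdF (hf D hD)]
  rw [← key B hB d2 ⟨A, hA, d4⟩, ← key C hC d3 ⟨A', hA', d5⟩]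
  exact congrArg F (h.swp_eq d2 d3 dB dC)

/-- Extension of an equivariant function on boxes whose values do not depend on the direction. -/
def lift {T : Type u} [Nominal 𝔸 T] (F : Box o f → T)
    (hF : ∀ (π : FinPerm 𝔸) (B : Box o f), F (π • B) = π • F B)
    (hf : ∀ B : Box o f, Fresh B.a (F B)) : Comp o f → T :=
  Quotient.lift F fun B C h =>
    wd ∅ F (fun π _ B _ => hF π B) (fun B _ => hf B) (mk_eq_iff.2 h) (by simp) (by simp)

theorem lift_mk {T : Type u} [Nominal 𝔸 T] (F : Box o f → T) (hF hf) (B : Box o f) :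
    lift F hF hf (mk B) = F B := rfl

/-- Functoriality of `Comp`. -/
def map (φ : X ⟶ Z) (k : Y ⟶ W) (w : f ≫ k = φ ≫ g) : Comp o f → Comp o g :=
  lift (fun B => mk (B.map φ k w)) (fun π B => by rw [Box.map_smul', smul_mk])
    fun B => fresh_a (B.map φ k w)

theorem map_mk (φ : X ⟶ Z) (k : Y ⟶ W) (w : f ≫ k = φ ≫ g) (B : Box o f) :
    map φ k w (mk B) = mk (B.map φ k w) := rfl

theorem map_injective (φ : X ⟶ Z) (k : Y ⟶ W) (w : f ≫ k = φ ≫ g) (hφ : Function.Injective φ)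
    (hk : Function.Injective k) : Function.Injective (map (o := o) φ k w) := by
  intro p q
  induction p using ind with | h B => ?_
  induction q using ind with | h C => ?_
  intro h
  rw [map_mk, map_mk, mk_eq_iff] at h
  obtain ⟨c, h1, h2, h3, h4, h5⟩ := h
  have hi := Box.map_injective (o := o) φ k w hφ hk
  have hs := fun (π : FinPerm 𝔸) B => Box.map_smul' φ k w (o := o) B π
  rw [mk_eq_iff]
  refine ⟨c, h1, h2, Fresh.of_map hs hi h3, Fresh.of_map hs hi h4, hi ?_⟩
  rw [hs, hs]
  exact h5

end Comp

/-- The disjoint union of `X`, of the open boxes over `ρ : P ⟶ Y`, and of the abstractions of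
open boxes over `ρ`; here `o = true` gives the parts `↑` and `+`, and `o = false` the parts
`↓` and `-`. -/
inductive Layer (f : X ⟶ Y) (ρ : P ⟶ Y) : Type u
  | inl (x : X) : Layer f ρ
  | fill (o : Bool) (B : Box o ρ) : Layer f ρ
  | comp (o : Bool) (q : Comp o ρ) : Layer f ρ

namespace Layer

variable {f : X ⟶ Y} {ρ : P ⟶ Y} {ρ' : Q ⟶ Y}

/-- The componentwise action of permutations. -/
def smulLayer (π : FinPerm 𝔸) : Layer f ρ → Layer f ρ
  | inl x => inl (π • x)
  | fill o B => fill o (π • B)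
  | comp o q => comp o (π • q)

instance : MulAction (FinPerm 𝔸) (Layer f ρ) where
  smul := smulLayer
  one_smul t := by cases t <;> exact congrArg _ (one_smul _ _)
  mul_smul π σ t := by cases t <;> exact congrArg _ (mul_smul _ _ _)

theorem smul_inl (π : FinPerm 𝔸) (x : X) : π • (inl x : Layer f ρ) = inl (π • x) := rfl
theorem smul_fill (π : FinPerm 𝔸) (o) (B : Box o ρ) :
    π • (fill o B : Layer f ρ) = fill o (π • B) := rfl
theorem smul_comp (π : FinPerm 𝔸) (o) (q : Comp o ρ) :
    π • (comp o q : Layer f ρ) = comp o (π • q) := rfl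

instance : Nominal 𝔸 (Layer f ρ) where
  exists_supp t := by
    cases t with
    | inl x => exact (Nominal.exists_supp (𝔸 := 𝔸) x).imp fun _ h => supports_map smul_inl h
    | fill o B => exact (Nominal.exists_supp (𝔸 := 𝔸) B).imp fun _ h =>
        supports_map (fun π => smul_fill π o) h
    | comp o q => exact (Nominal.exists_supp (𝔸 := 𝔸) q).imp fun _ h =>
        supports_map (fun π => smul_comp π o) h

/-- The substitution on `⟨a⟩(u, y)`, computed on a representative with `a ≠ c`. -/
def compSub (lam : P → Layer f ρ) (o : Bool) (c : 𝔸) (i : Bool) (B : Box o ρ) : Layer f ρ :=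
  if h : IsFace B.A B.a o c i then lam (sub (B.u c i h) B.a o)
  else if hc : c ∉ B.A then comp o (Comp.mk (B.subst c i hc)) else comp o (Comp.mk B)

/-- The substitution `t(c := i)`. The last case of `compSub` does not occur. -/
def subst (lam : P → Layer f ρ) (c : 𝔸) (i : Bool) : Layer f ρ → Layer f ρ
  | inl x => inl (sub x c i)
  | fill o B =>
      if h : IsFace B.A B.a o c i then lam (B.u c i h)
      else if hc : c ∉ B.A then fill o (B.subst c i hc)
      else comp o (Comp.mk B)
  | comp o q => compSub lam o c i (Comp.exists_rep {c} q).choose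

/-- The projection to `Y`. -/
def proj : Layer f ρ → Y
  | inl x => f x
  | fill _ B => B.y
  | comp o q => Comp.lift (fun B : Box o ρ => sub B.y B.a o)
      (fun π B => (perm_sub π B.y B.a o).symm)
      (fun _ => fresh_sub _ _ _) q

theorem proj_smul (π : FinPerm 𝔸) (t : Layer f ρ) : proj (π • t) = π • proj t := by
  cases t with
  | inl x => exact hom_smul f π x
  | fill o B => rfl
  | comp o q =>
    induction q using Comp.ind with
    | h B => exact (perm_sub π B.y B.a o).symm

/-- Functoriality in `ρ`. -/
def map (φ : P ⟶ Q) (w : ρ ≫ 𝟙 Y = φ ≫ ρ') : Layer f ρ → Layer f ρ'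
  | inl x => inl x
  | fill o B => fill o (B.map φ (𝟙 Y) w)
  | comp o q => comp o (Comp.map φ (𝟙 Y) w q)

theorem map_smul_layer (φ : P ⟶ Q) (w : ρ ≫ 𝟙 Y = φ ≫ ρ') (π : FinPerm 𝔸) (t : Layer f ρ) :
    map φ w (π • t) = π • map φ w t := by
  cases t with
  | inl x => rfl
  | fill o B => exact congrArg _ (Box.map_smul' φ (𝟙 Y) w B π)
  | comp o q =>
    induction q using Comp.ind with
    | h B => exact congrArg (fun C => comp o (Comp.mk C)) (Box.map_smul' φ (𝟙 Y) w B π)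

theorem map_injective (φ : P ⟶ Q) (w : ρ ≫ 𝟙 Y = φ ≫ ρ') (h : Function.Injective φ) :
    Function.Injective (map (f := f) φ w) := by
  intro s t hst
  cases s with
  | inl x => cases t with
    | inl x' => simp only [map, inl.injEq] at hst; rw [hst]
    | fill o B => cases hst
    | comp o q => cases hst
  | fill o B => cases t with
    | inl x' => cases hst
    | fill o' B' =>
      simp only [map, fill.injEq] at hst
      obtain ⟨rfl, h2⟩ := hst
      rw [Box.map_injective φ (𝟙 Y) w h Function.injective_id (eq_of_heq h2)]
    | comp o q => cases hst
  | comp o q => cases t with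
    | inl x' => cases hst
    | fill o B => cases hst
    | comp o' q' =>
      simp only [map, comp.injEq] at hst
      obtain ⟨rfl, h2⟩ := hst
      rw [Comp.map_injective φ (𝟙 Y) w h Function.injective_id (eq_of_heq h2)]

end Layer

/-- An object `P` over `Y` with an equivariant map `lam` to the disjoint union. -/
structure PreStage (f : X ⟶ Y) where
  P : Sub01 𝔸
  ρ : P ⟶ Y
  lam : P → Layer f ρ
  lam_smul : ∀ (π : FinPerm 𝔸) p, lam (π • p) = π • lam p

/-- The data available at a stage of the construction: the previous object `P` over `Y`, and the
inclusion `lam` of `P` into the next object. -/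
structure Stage (f : X ⟶ Y) extends PreStage f where
  lam_inj : Function.Injective lam
  lam_proj : ∀ p, (lam p).proj = ρ p
  lam_sub : ∀ p c i, lam (sub p c i) = Layer.subst lam c i (lam p)

namespace PreStage

variable {f : X ⟶ Y} (S : PreStage f)

theorem fresh_lam {c : 𝔸} {p : S.P} (h : Fresh c p) : Fresh c (S.lam p) := h.map S.lam_smul

theorem fresh_inl {c : 𝔸} {x : X} : Fresh c (Layer.inl x : Layer f S.ρ) ↔ Fresh c x :=
  ⟨fun h => h.of_map Layer.smul_inl (fun _ _ h => by cases h; rfl), fun h => h.map Layer.smul_inl⟩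

theorem fresh_fill {c : 𝔸} {o} {B : Box o S.ρ} :
    Fresh c (Layer.fill o B : Layer f S.ρ) ↔ Fresh c B :=
  ⟨fun h => h.of_map (fun π => Layer.smul_fill π o) (fun _ _ h => by cases h; rfl),
    fun h => h.map fun π => Layer.smul_fill π o⟩

theorem fresh_comp {c : 𝔸} {o} {q : Comp o S.ρ} :
    Fresh c (Layer.comp o q : Layer f S.ρ) ↔ Fresh c q :=
  ⟨fun h => h.of_map (fun π => Layer.smul_comp π o) (fun _ _ h => by cases h; rfl),
    fun h => h.map fun π => Layer.smul_comp π o⟩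

theorem compSub_smul (o c i) (B : Box o S.ρ) (π : FinPerm 𝔸) :
    Layer.compSub S.lam o (π • c) i (π • B) = π • Layer.compSub S.lam o c i B := by
  unfold Layer.compSub
  have e : IsFace (π • B).A (π • B).a o (π • c) i ↔ IsFace B.A B.a o c i := by
    rw [Box.smul_A, Box.smul_a, Box.isFace_smul, inv_smul_smul]
  by_cases h : IsFace B.A B.a o c i
  · rw [dif_pos h, dif_pos (e.2 h), ← S.lam_smul, perm_sub, Box.smul_u' π B c i h]; rfl
  · rw [dif_neg h, dif_neg (mt e.1 h)]
    by_cases hc : c ∉ B.A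
    · rw [dif_pos hc, dif_pos (by simpa using hc), Box.subst_smul B c i hc]; rfl
    · rw [dif_neg hc, dif_neg (by simpa using hc)]; rfl

theorem fresh_compSub (o c i) (B : Box o S.ρ) (_h : B.a ≠ c) :
    Fresh B.a (Layer.compSub S.lam o c i B) := by
  unfold Layer.compSub
  split_ifs with h1 h2
  · exact S.fresh_lam (fresh_sub _ _ _)
  · exact S.fresh_comp.2 (Comp.fresh_a B)
  · exact S.fresh_comp.2 (Comp.fresh_a (B.subst c i h2))

theorem subst_comp (o) (c : 𝔸) (i) (B : Box o S.ρ) (h : B.a ≠ c) :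
    Layer.subst S.lam c i (Layer.comp o (Comp.mk B)) = Layer.compSub S.lam o c i B := by
  have hs := (Comp.exists_rep {c} (Comp.mk B)).choose_spec
  refine Comp.wd {c} (fun B => Layer.compSub S.lam o c i B) ?_ ?_ hs.1 hs.2 (by simpa using h)
  · intro π hπ B _
    have := S.compSub_smul o c i B π
    rwa [hπ c (by simp)] at this
  · intro B hB
    exact S.fresh_compSub o c i B (by simpa using hB)

theorem subst_fill_face {o} (B : Box o S.ρ) {c i} (h : IsFace B.A B.a o c i) :
    Layer.subst S.lam c i (Layer.fill o B) = S.lam (B.u c i h) := dif_pos h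

theorem subst_fill_out {o} (B : Box o S.ρ) {c i} (h : c ∉ B.A) :
    Layer.subst S.lam c i (Layer.fill o B) = Layer.fill o (B.subst c i h) := by
  rw [Layer.subst, dif_neg (fun h' => h h'.1), dif_pos h]

theorem subst_fill_dir {o} (B : Box o S.ρ) :
    Layer.subst S.lam B.a o (Layer.fill o B) = Layer.comp o (Comp.mk B) := by
  rw [Layer.subst, dif_neg (fun h' => h'.2 ⟨rfl, rfl⟩), dif_neg (not_not.2 B.mem)]

theorem subst_comp_face {o} (B : Box o S.ρ) {c i} (hc : c ≠ B.a) (h : IsFace B.A B.a o c i) :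
    Layer.subst S.lam c i (Layer.comp o (Comp.mk B)) = S.lam (sub (B.u c i h) B.a o) := by
  rw [S.subst_comp o c i B hc.symm, Layer.compSub, dif_pos h]

theorem subst_comp_out {o} (B : Box o S.ρ) {c i} (h : c ∉ B.A) :
    Layer.subst S.lam c i (Layer.comp o (Comp.mk B)) = Layer.comp o (Comp.mk (B.subst c i h)) := by
  rw [S.subst_comp o c i B (fun e => h (e ▸ B.mem)), Layer.compSub, dif_neg (fun h' => h h'.1),
    dif_pos h]

theorem _root_.ZeroOneSub.Box.face_cases {o} {ρ : P ⟶ Y} (B : Box o ρ) (c : 𝔸) (i : Bool) :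
    IsFace B.A B.a o c i ∨ c ∉ B.A ∨ (c = B.a ∧ i = o) := by
  unfold IsFace; tauto

theorem subst_smul (π : FinPerm 𝔸) (t : Layer f S.ρ) (c i) :
    π • Layer.subst S.lam c i t = Layer.subst S.lam (π • c) i (π • t) := by
  cases t with
  | inl x => exact congrArg Layer.inl (perm_sub π x c i)
  | fill o B =>
    rcases B.face_cases c i with h | h | ⟨rfl, rfl⟩
    · have h' : IsFace (π • B).A (π • B).a o (π • c) i := by
        rw [Box.smul_A, Box.smul_a, Box.isFace_smul, inv_smul_smul]; exact h
      rw [S.subst_fill_face B h, Layer.smul_fill, S.subst_fill_face _ h', ← S.lam_smul,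
        Box.smul_u']
    · rw [S.subst_fill_out B h, Layer.smul_fill, Layer.smul_fill,
        S.subst_fill_out _ (by simpa using h), Box.subst_smul B c i h]
    · rw [S.subst_fill_dir B, Layer.smul_fill, ← Box.smul_a, S.subst_fill_dir]; rfl
  | comp o q =>
    obtain ⟨B, rfl, hB⟩ := Comp.exists_rep {c} q
    simp only [Finset.mem_singleton] at hB
    rw [S.subst_comp o c i B hB, ← S.compSub_smul, Layer.smul_comp, Comp.smul_mk,
      S.subst_comp o _ i _ (by simpa using hB)]

theorem fresh_subst (t : Layer f S.ρ) (c i) : Fresh c (Layer.subst S.lam c i t) := by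
  cases t with
  | inl x => exact S.fresh_inl.2 (fresh_sub _ _ _)
  | fill o B =>
    rcases B.face_cases c i with h | h | ⟨rfl, rfl⟩
    · rw [S.subst_fill_face B h]; exact S.fresh_lam (B.fresh _ _ _)
    · rw [S.subst_fill_out B h]; exact S.fresh_fill.2 (B.fresh_subst _ _ _)
    · rw [S.subst_fill_dir B]; exact S.fresh_comp.2 (Comp.fresh_a B)
  | comp o q =>
    obtain ⟨B, rfl, hB⟩ := Comp.exists_rep {c} q
    simp only [Finset.mem_singleton] at hB
    rcases B.face_cases c i with h | h | ⟨rfl, rfl⟩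
    · rw [S.subst_comp_face B (Ne.symm hB) h]
      exact S.fresh_lam (fresh_sub_of_fresh (B.fresh _ _ _) (Ne.symm hB) _)
    · rw [S.subst_comp_out B h]; exact S.fresh_comp.2 (Comp.fresh_mk (B.fresh_subst _ _ _))
    · exact absurd rfl hB

theorem subst_of_fresh (t : Layer f S.ρ) (c i) (hc : Fresh c t) : Layer.subst S.lam c i t = t := by
  cases t with
  | inl x => exact congrArg Layer.inl (sub_of_fresh _ _ _ (S.fresh_inl.1 hc))
  | fill o B =>
    have h := S.fresh_fill.1 hc
    rw [S.subst_fill_out B (Box.notMem_of_fresh h), Box.subst_of_fresh _ _ _ _ h]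
  | comp o q =>
    obtain ⟨B, rfl, hB⟩ := Comp.exists_rep {c} q
    simp only [Finset.mem_singleton] at hB
    have h := Comp.fresh_of_fresh_mk (S.fresh_comp.1 hc) (Ne.symm hB)
    rw [S.subst_comp_out B (Box.notMem_of_fresh h), Box.subst_of_fresh _ _ _ _ h]


end PreStage

namespace Stage

variable {f : X ⟶ Y} (S : Stage f)

theorem subst_comm_aux {o} (B : Box o S.ρ) (c i d j) (hcd : c ≠ d)
    (h : IsFace B.A B.a o c i) : Layer.subst S.lam d j (S.lam (B.u c i h)) =
      Layer.subst S.lam c i (Layer.subst S.lam d j (Layer.fill o B)) := by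
  rw [← S.lam_sub]
  rcases B.face_cases d j with h' | h' | ⟨rfl, rfl⟩
  · rw [S.subst_fill_face B h', ← S.lam_sub, B.adj c i h d j h' hcd]
  · rw [S.subst_fill_out B h', S.subst_fill_face (B.subst d j h') h]; rfl
  · rw [S.subst_fill_dir B, S.subst_comp_face B hcd h]

theorem subst_comm_aux' {o} (B : Box o S.ρ) (c i d j) (hcd : c ≠ d) (hc : c ≠ B.a) (hd : d ≠ B.a)
    (h : IsFace B.A B.a o c i) : Layer.subst S.lam d j (S.lam (sub (B.u c i h) B.a o)) =
      Layer.subst S.lam c i (Layer.subst S.lam d j (Layer.comp o (Comp.mk B))) := by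
  rw [← S.lam_sub]
  rcases B.face_cases d j with h' | h' | ⟨rfl, rfl⟩
  · rw [S.subst_comp_face B hd h', ← S.lam_sub, sub_comm _ _ _ _ _ hd.symm,
      B.adj c i h d j h' hcd, sub_comm _ _ _ _ _ hc]
  · rw [S.subst_comp_out B h', S.subst_comp_face (B.subst d j h') hc h,
      sub_comm _ _ _ _ _ hd.symm]; rfl
  · exact absurd rfl hd

theorem subst_comm (t : Layer f S.ρ) (c d i j) (hcd : c ≠ d) :
    Layer.subst S.lam d j (Layer.subst S.lam c i t) =
      Layer.subst S.lam c i (Layer.subst S.lam d j t) := by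
  cases t with
  | inl x => exact congrArg Layer.inl (sub_comm _ _ _ _ _ hcd)
  | fill o B =>
    rcases B.face_cases c i with h | h | ⟨rfl, rfl⟩
    · rw [← S.subst_comm_aux B c i d j hcd h, S.subst_fill_face B h]
    · rcases B.face_cases d j with h' | h' | ⟨rfl, rfl⟩
      · rw [← S.subst_comm_aux B d j c i hcd.symm h', S.subst_fill_face B h']
      · rw [S.subst_fill_out B h, S.subst_fill_out B h', S.subst_fill_out (B.subst c i h) h',
          S.subst_fill_out (B.subst d j h') h]
        exact congrArg (Layer.fill o) (B.subst_comm c i h d j h' hcd)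
      · rw [S.subst_fill_out B h, S.subst_fill_dir B, S.subst_comp_out B h]
        exact S.subst_fill_dir (B.subst c i h)
    · rcases B.face_cases d j with h' | h' | ⟨rfl, rfl⟩
      · rw [← S.subst_comm_aux B d j _ _ hcd.symm h', S.subst_fill_face B h']
      · rw [S.subst_fill_out B h', S.subst_fill_dir B, S.subst_comp_out B h']
        exact (S.subst_fill_dir (B.subst d j h')).symm
      · exact absurd rfl hcd
  | comp o q =>
    obtain ⟨B, rfl, hB⟩ := Comp.exists_rep {c, d} q
    simp only [Finset.mem_insert, Finset.mem_singleton, not_or] at hB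
    have hc := Ne.symm hB.1
    have hd := Ne.symm hB.2
    rcases B.face_cases c i with h | h | ⟨rfl, rfl⟩
    · rw [← S.subst_comm_aux' B c i d j hcd hc hd h, S.subst_comp_face B hc h]
    · rcases B.face_cases d j with h' | h' | ⟨rfl, rfl⟩
      · rw [← S.subst_comm_aux' B d j c i hcd.symm hd hc h', S.subst_comp_face B hd h']
      · rw [S.subst_comp_out B h, S.subst_comp_out B h', S.subst_comp_out (B.subst c i h) h',
          S.subst_comp_out (B.subst d j h') h]
        exact congrArg (fun C => Layer.comp o (Comp.mk C)) (B.subst_comm c i h d j h' hcd)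
      · exact absurd rfl hd
    · exact absurd rfl hc

/-- The next object: the disjoint union with the substitution operation defined by cases. -/
def obj : Sub01 𝔸 where
  carrier := Layer f S.ρ
  str :=
    { sub := fun t c i => Layer.subst S.lam c i t
      perm_sub := S.subst_smul
      fresh_sub := S.fresh_subst
      sub_of_fresh := S.subst_of_fresh
      sub_comm := fun t c d i j h => S.subst_comm t c d i j h }

/-- The inclusion of `P` into the next object. -/
def lamHom : S.P ⟶ S.obj := ⟨S.lam, S.lam_smul, S.lam_sub⟩

theorem proj_subst (t : Layer f S.ρ) (c i) :
    (Layer.subst S.lam c i t).proj = sub t.proj c i := by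
  cases t with
  | inl x => exact hom_sub f x c i
  | fill o B =>
    rcases B.face_cases c i with h | h | ⟨rfl, rfl⟩
    · rw [S.subst_fill_face B h, S.lam_proj, B.lies]; rfl
    · rw [S.subst_fill_out B h]; rfl
    · rw [S.subst_fill_dir B]; rfl
  | comp o q =>
    obtain ⟨B, rfl, hB⟩ := Comp.exists_rep {c} q
    simp only [Finset.mem_singleton] at hB
    have e : ∀ B : Box o S.ρ, (Layer.comp o (Comp.mk B) : Layer f S.ρ).proj = sub B.y B.a o :=
      fun _ => rfl
    rcases B.face_cases c i with h | h | ⟨rfl, rfl⟩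
    · rw [S.subst_comp_face B (Ne.symm hB) h, S.lam_proj, hom_sub, B.lies, e,
        sub_comm _ _ _ _ _ hB]
    · rw [S.subst_comp_out B h, e, e, sub_comm _ _ _ _ _ hB]; rfl
    · exact absurd rfl hB

/-- The projection of the next object to `Y`. -/
def projHom : S.obj ⟶ Y := ⟨Layer.proj, Layer.proj_smul, S.proj_subst⟩

theorem lam_w : S.ρ ≫ 𝟙 Y = S.lamHom ≫ S.projHom := hom_ext fun p => (S.lam_proj p).symm

theorem map_proj (t : Layer f S.ρ) :
    (Layer.map (f := f) S.lamHom S.lam_w t).proj = t.proj := by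
  cases t with
  | inl x => rfl
  | fill o B => rfl
  | comp o q =>
    induction q using Comp.ind with
    | h B => rfl

/-- The inclusion of the next object into the disjoint union formed from it. -/
def nextPre : PreStage f where
  P := S.obj
  ρ := S.projHom
  lam := Layer.map S.lamHom S.lam_w
  lam_smul := Layer.map_smul_layer S.lamHom S.lam_w

theorem map_subst (t : Layer f S.ρ) (c i) :
    S.nextPre.lam (Layer.subst S.lam c i t) = Layer.subst S.nextPre.lam c i (S.nextPre.lam t) := by
  have hl : ∀ p, S.nextPre.lam (S.lam p) = Layer.map S.lamHom S.lam_w (S.lam p) := fun _ => rfl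
  have e1 : ∀ o (B : Box o S.ρ), S.nextPre.lam (Layer.fill o B) =
    Layer.fill o (B.map S.lamHom (𝟙 Y) S.lam_w) := fun _ _ => rfl
  have e2 : ∀ o (B : Box o S.ρ), S.nextPre.lam (Layer.comp o (Comp.mk B)) =
    Layer.comp o (Comp.mk (B.map S.lamHom (𝟙 Y) S.lam_w)) := fun _ _ => rfl
  cases t with
  | inl x => rfl
  | fill o B =>
    rcases B.face_cases c i with h | h | ⟨rfl, rfl⟩
    · rw [S.subst_fill_face B h, e1]
      exact (S.nextPre.subst_fill_face (B.map S.lamHom (𝟙 Y) S.lam_w) h).symm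
    · rw [S.subst_fill_out B h, e1, e1]
      exact (congrArg (Layer.fill o) (Box.map_subst S.lamHom (𝟙 Y) S.lam_w B c i h)).trans
        (S.nextPre.subst_fill_out (B.map S.lamHom (𝟙 Y) S.lam_w) (i := i) h).symm
    · rw [S.subst_fill_dir B, e1, e2]
      exact (S.nextPre.subst_fill_dir (B.map S.lamHom (𝟙 Y) S.lam_w)).symm
  | comp o q =>
    obtain ⟨B, rfl, hB⟩ := Comp.exists_rep {c} q
    simp only [Finset.mem_singleton] at hB
    rcases B.face_cases c i with h | h | ⟨rfl, rfl⟩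
    · rw [S.subst_comp_face B (Ne.symm hB) h, e2]
      refine Eq.trans ?_ (S.nextPre.subst_comp_face (B.map S.lamHom (𝟙 Y) S.lam_w)
        (Ne.symm hB) h).symm
      exact congrArg S.nextPre.lam (hom_sub S.lamHom (B.u c i h) B.a o)
    · rw [S.subst_comp_out B h, e2, e2]
      exact (congrArg (fun C => Layer.comp o (Comp.mk C))
        (Box.map_subst S.lamHom (𝟙 Y) S.lam_w B c i h)).trans
        (S.nextPre.subst_comp_out (B.map S.lamHom (𝟙 Y) S.lam_w) (i := i) h).symm
    · exact absurd rfl hB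

/-- The next stage. -/
def next : Stage f where
  toPreStage := S.nextPre
  lam_inj := Layer.map_injective S.lamHom S.lam_w S.lam_inj
  lam_proj := S.map_proj
  lam_sub := S.map_subst

end Stage

/-- A choice of Kan filling operators for `1`-open (`o = true`) and `0`-open (`o = false`) boxes,
satisfying the uniformity conditions. -/
structure KanFilling (f : X ⟶ Y) where
  fill : ∀ o, Box o f → X
  sub_fill : ∀ o (B : Box o f) b i (h : IsFace B.A B.a o b i), sub (fill o B) b i = B.u b i h
  map_fill : ∀ o (B : Box o f), f (fill o B) = B.y
  fill_smul : ∀ o (π : FinPerm 𝔸) (B : Box o f), fill o (π • B) = π • fill o B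
  fill_subst : ∀ o (B : Box o f) c i (hc : c ∉ B.A), fill o (B.subst c i hc) = sub (fill o B) c i

/-- `f` is a Kan fibration: it admits Kan filling operators. -/
def KanFibration (f : X ⟶ Y) : Prop := Nonempty (KanFilling f)

/-- The empty `01`-substitution set. -/
def emptyObj (𝔸 : Type u) : Sub01 𝔸 where
  carrier := PEmpty
  str :=
    { smul := fun _ x => x
      one_smul := fun x => x.elim
      mul_smul := fun _ _ x => x.elim
      exists_supp := fun x => x.elim
      sub := fun x _ _ => x
      perm_sub := fun _ x => x.elim
      fresh_sub := fun x => x.elim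
      sub_of_fresh := fun x => x.elim
      sub_comm := fun x => x.elim }

variable (f : X ⟶ Y)

/-- The stages `colim_{m < n} K_m f`, starting with the empty object; `(stage f (n + 1)).P` is
`K_n f`, the disjoint union formed from `colim_{m < n} K_m f`. -/
def stage : ℕ → Stage f
  | 0 =>
    { P := emptyObj 𝔸
      ρ := ⟨fun x => x.elim, fun _ x => x.elim, fun x => x.elim⟩
      lam := fun x => x.elim
      lam_smul := fun _ x => x.elim
      lam_inj := fun x => x.elim
      lam_proj := fun x => x.elim
      lam_sub := fun x => x.elim }
  | n + 1 => (stage n).next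

/-- The sequence of the stages. -/
def chain : ℕ ⥤ Sub01 𝔸 :=
  Functor.ofSequence (X := fun n => (stage f n).P) fun n => (stage f n).lamHom

theorem chain_succ (n : ℕ) :
    (chain f).map (homOfLE (Nat.le_add_right n 1)) = (stage f n).lamHom :=
  Functor.ofSequence_map_homOfLE_succ _ n

/-- Induction along the sequence for families of properties of transition maps. -/
theorem chain_le_ind {p : ∀ n m : ℕ, n ≤ m → Prop} (h0 : ∀ n, p n n le_rfl)
    (h1 : ∀ n m (h : n ≤ m), p n m h → p n (m + 1) (h.trans (Nat.le_add_right m 1)))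
    (n m : ℕ) (h : n ≤ m) : p n m h := by
  induction m, h using Nat.le_induction with
  | base => exact h0 n
  | succ m h ih => exact h1 n m h ih

/-- The transition maps between the stages. -/
def tr (n m : ℕ) (h : n ≤ m) : (stage f n).P ⟶ (stage f m).P := (chain f).map (homOfLE h)

theorem tr_succ (n m : ℕ) (h : n ≤ m) :
    tr f n (m + 1) (h.trans (Nat.le_add_right m 1)) = tr f n m h ≫ (stage f m).lamHom := by
  have h1 := (chain f).map_comp (homOfLE h) (homOfLE (Nat.le_add_right m 1))
  rw [chain_succ] at h1
  exact h1

theorem tr_self (n : ℕ) : tr f n n le_rfl = 𝟙 _ := (chain f).map_id n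

theorem tr_injective (n m : ℕ) (h : n ≤ m) : Function.Injective (tr f n m h) := by
  refine chain_le_ind (p := fun n m h => Function.Injective (tr f n m h))
    (fun n => ?_) (fun n m h ih => ?_) n m h
  · rw [tr_self]; exact fun _ _ h => h
  · rw [tr_succ f n m h]
    exact fun x y e => ih ((stage f m).lam_inj e)

theorem tr_ρ (n m : ℕ) (h : n ≤ m) : (stage f n).ρ = tr f n m h ≫ (stage f m).ρ := by
  refine chain_le_ind (p := fun n m h => (stage f n).ρ = tr f n m h ≫ (stage f m).ρ)
    (fun n => ?_) (fun n m h ih => ?_) n m h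
  · rw [tr_self]; rfl
  · rw [tr_succ f n m h, ih]
    exact congrArg (tr f n m h ≫ ·) (stage f m).lam_w

/-- The object `K f`. -/
def K : Sub01 𝔸 := Seq.colim (chain f) (tr_injective f)

/-- The inclusions of the stages in `K f`. -/
def stageHom (n : ℕ) : (stage f n).P ⟶ K f := Seq.ιHom (tr_injective f) n

/-- The map `ρ_f : K f ⟶ Y`. -/
def rho : K f ⟶ Y :=
  Seq.descHom (tr_injective f) (fun n => (stage f n).ρ) (tr_ρ f)

/-- The map `λ_f : X ⟶ K f`. -/
def lam : X ⟶ K f where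
  toFun x := stageHom f 1 (Layer.inl x)
  map_smul' π x := hom_smul (stageHom f 1) π (Layer.inl x)
  map_sub' x c i := hom_sub (stageHom f 1) (Layer.inl x) c i

theorem lam_rho : lam f ≫ rho f = f := rfl

theorem stageHom_rho (n : ℕ) : stageHom f n ≫ rho f = (stage f n).ρ := rfl

theorem stageHom_injective (n : ℕ) : Function.Injective (stageHom f n) :=
  Seq.ι_injective (tr_injective f) n

theorem stageHom_tr {n m : ℕ} (h : n ≤ m) (p : (stage f n).P) :
    stageHom f m (tr f n m h p) = stageHom f n p := Seq.ι_tr (G := chain f) h p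

theorem stageHom_lam (n : ℕ) (p : (stage f n).P) :
    stageHom f (n + 1) ((stage f n).lam p) = stageHom f n p := by
  have := stageHom_tr f (Nat.le_add_right n 1) p
  rwa [tr_succ f n n le_rfl, tr_self] at this

/-- The elements of the disjoint union formed at stage `n`, regarded as elements of `K f`. -/
def lay (n : ℕ) (t : Layer f (stage f n).ρ) : K f := stageHom f (n + 1) t

theorem lay_smul (n : ℕ) (π : FinPerm 𝔸) (t : Layer f (stage f n).ρ) :
    lay f n (π • t) = π • lay f n t := hom_smul (stageHom f (n + 1)) π t

theorem lay_subst (n : ℕ) (t : Layer f (stage f n).ρ) (c i) :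
    lay f n (Layer.subst (stage f n).lam c i t) = sub (lay f n t) c i :=
  hom_sub (stageHom f (n + 1)) t c i

theorem lay_lam (n : ℕ) (p : (stage f n).P) : lay f n ((stage f n).lam p) = stageHom f n p :=
  stageHom_lam f n p

theorem lay_next (n : ℕ) (t : Layer f (stage f n).ρ) :
    lay f (n + 1) (Layer.map (stage f n).lamHom (stage f n).lam_w t) = lay f n t :=
  stageHom_lam f (n + 1) t

theorem exists_stage (z : K f) : ∃ n p, stageHom f n p = z :=
  Seq.ι_ind (p := fun z => ∃ n p, stageHom f n p = z) (fun n p => ⟨n, p, rfl⟩) z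

theorem exists_stage_le {n : ℕ} {z : K f} (h : ∃ p, stageHom f n p = z) {m : ℕ} (hm : n ≤ m) :
    ∃ p, stageHom f m p = z := by
  obtain ⟨p, rfl⟩ := h
  exact ⟨_, stageHom_tr f hm p⟩

theorem stage_w (n : ℕ) : (stage f n).ρ ≫ 𝟙 Y = stageHom f n ≫ rho f := rfl

/-- A box in a stage, regarded as a box in `K f`. -/
abbrev boxOfStage {o : Bool} (n : ℕ) (B : Box o (stage f n).ρ) : Box o (rho f) :=
  B.map (stageHom f n) (𝟙 Y) (stage_w f n)

theorem exists_stage_box {o : Bool} (B : Box o (rho f)) : ∃ n C, boxOfStage f (o := o) n C = B := by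
  have h1 : ∀ b i (h : IsFace B.A B.a o b i), ∃ n p, stageHom f n p = B.u b i h :=
    fun b i h => exists_stage f _
  choose n hn using h1
  let n' : 𝔸 → Bool → ℕ := fun b i => if h : IsFace B.A B.a o b i then n b i h else 0
  let N : ℕ := B.A.sup fun b => max (n' b false) (n' b true)
  have hN : ∀ b i h, n b i h ≤ N := fun b i h => by
    have e : n' b i = n b i h := dif_pos h
    rw [← e]
    refine le_trans ?_ (Finset.le_sup (f := fun b => max (n' b false) (n' b true)) h.1)
    cases i
    · exact le_max_left _ _
    · exact le_max_right _ _
  have h2 : ∀ b i (h : IsFace B.A B.a o b i), ∃ p, stageHom f N p = B.u b i h :=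
    fun b i h => exists_stage_le f (hn b i h) (hN b i h)
  choose u hu using h2
  have hi := stageHom_injective f N
  refine ⟨N, ⟨B.A, B.a, B.mem, u, B.y, ?_, ?_, ?_⟩, ?_⟩
  · intro b i h
    refine Fresh.of_map (hom_smul (stageHom f N)) hi ?_
    rw [hu]; exact B.fresh b i h
  · intro b i h b' i' h' hb
    apply hi
    rw [hom_sub, hom_sub, hu, hu]
    exact B.adj b i h b' i' h' hb
  · intro b i h
    rw [← stageHom_rho, comp_apply, hu]
    exact B.lies b i h
  · exact Box.ext' rfl rfl (fun b i h _ => hu b i h) rfl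

/-- An open box over `ρ_f`, regarded as an element of `K f`. -/
def kfill (o : Bool) (B : Box o (rho f)) : K f :=
  lay f (exists_stage_box f B).choose
    (Layer.fill o (exists_stage_box f B).choose_spec.choose)

theorem stageHom_fill (n m : ℕ) (h : n ≤ m) : ∀ {o} (B : Box o (stage f n).ρ),
    lay f m (Layer.fill o (B.map (tr f n m h) (𝟙 Y) (tr_ρ f n m h))) =
      lay f n (Layer.fill o B) := by
  refine chain_le_ind (p := fun n m h => ∀ {o} (B : Box o (stage f n).ρ),
    lay f m (Layer.fill o (B.map (tr f n m h) (𝟙 Y) (tr_ρ f n m h))) =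
      lay f n (Layer.fill o B)) (fun n o B => ?_) (fun n m h ih o B => ?_) n m h
  · refine congrArg (fun C => lay f n (Layer.fill o C)) ?_
    exact Box.ext' rfl rfl (fun b i h h' => by
      change tr f n n le_rfl (B.u b i h) = _
      rw [tr_self]; rfl) rfl
  · refine Eq.trans ?_ ((lay_next f m _).trans (ih B))
    refine congrArg (fun C => lay f (m + 1) (Layer.fill o C)) ?_
    exact Box.ext' rfl rfl (fun b i hb h' => by
      change tr f n (m + 1) _ (B.u b i hb) = (stage f m).lamHom (tr f n m h (B.u b i hb))
      rw [tr_succ f n m h]; rfl) rfl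

theorem kfill_boxOfStage {o} (n : ℕ) (B : Box o (stage f n).ρ) :
    kfill f o (boxOfStage f n B) = lay f n (Layer.fill o B) := by
  have hs := (exists_stage_box f (boxOfStage f n B)).choose_spec.choose_spec
  unfold kfill
  generalize (exists_stage_box f (boxOfStage f n B)).choose_spec.choose = C at hs ⊢
  generalize (exists_stage_box f (boxOfStage f n B)).choose = m at C hs ⊢
  rw [← stageHom_fill f n _ (le_max_left n m) B, ← stageHom_fill f m _ (le_max_right n m) C]
  refine congrArg (fun C => lay f (max n m) (Layer.fill o C)) ?_
  refine Box.map_injective (stageHom f (max n m)) (𝟙 Y) (stage_w f _)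
    (stageHom_injective f _) Function.injective_id ?_
  have e : ∀ k (h : k ≤ max n m) (D : Box o (stage f k).ρ),
      (D.map (tr f k _ h) (𝟙 Y) (tr_ρ f k _ h)).map (stageHom f (max n m)) (𝟙 Y) (stage_w f _) =
        boxOfStage f k D := fun k h D =>
    Box.ext' rfl rfl (fun b i hb _ => stageHom_tr f h (D.u b i hb)) rfl
  rw [e, e, hs]

theorem sub_kfill {o} (B : Box o (rho f)) (b i) (h : IsFace B.A B.a o b i) :
    sub (kfill f o B) b i = B.u b i h := by
  obtain ⟨n, C, rfl⟩ := exists_stage_box f B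
  rw [kfill_boxOfStage, ← lay_subst, (stage f n).subst_fill_face C h, lay_lam]
  rfl

theorem rho_kfill {o} (B : Box o (rho f)) : rho f (kfill f o B) = B.y := by
  obtain ⟨n, C, rfl⟩ := exists_stage_box f B
  rw [kfill_boxOfStage]
  rfl

theorem kfill_smul {o} (π : FinPerm 𝔸) (B : Box o (rho f)) :
    kfill f o (π • B) = π • kfill f o B := by
  obtain ⟨n, C, rfl⟩ := exists_stage_box f B
  rw [boxOfStage, ← Box.map_smul', kfill_boxOfStage, kfill_boxOfStage, ← lay_smul]
  rfl

theorem kfill_subst {o} (B : Box o (rho f)) (c i) (hc : c ∉ B.A) :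
    kfill f o (B.subst c i hc) = sub (kfill f o B) c i := by
  obtain ⟨n, C, rfl⟩ := exists_stage_box f B
  have hc' : c ∉ C.A := hc
  rw [← Box.map_subst (stageHom f n) (𝟙 Y) (stage_w f n) C c i hc', kfill_boxOfStage,
    kfill_boxOfStage, ← lay_subst, (stage f n).subst_fill_out C hc']

/-- Open boxes over `ρ_f` are their own fillers in `K f`. -/
def kanRho : KanFilling (rho f) where
  fill := kfill f
  sub_fill _ := sub_kfill f
  map_fill _ := rho_kfill f
  fill_smul _ := kfill_smul f
  fill_subst _ := kfill_subst f

/-- Every element of `K f` is of the form `x`, `(u, y)` or `⟨a⟩(u, y) = (u, y)(a := o)`, where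
the elements `u(b, i)` have been obtained before. -/
theorem K_ind {p : K f → Prop} (h1 : ∀ x, p (lam f x))
    (h2 : ∀ o (B : Box o (rho f)), (∀ b i h, p (B.u b i h)) → p (kfill f o B))
    (h3 : ∀ o (B : Box o (rho f)), (∀ b i h, p (B.u b i h)) → p (sub (kfill f o B) B.a o))
    (z : K f) : p z := by
  have hx : ∀ n (x : X), lay f n (Layer.inl x) = lam f x := fun n x => by
    induction n with
    | zero => rfl
    | succ n ih => exact (lay_next f n (Layer.inl x)).trans ih
  obtain ⟨n, q, rfl⟩ := exists_stage f z
  induction n with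
  | zero => exact q.elim
  | succ n ih =>
    have key : ∀ t, p (lay f n t) := fun t => by
      cases t with
      | inl x => rw [hx]; exact h1 x
      | fill o B =>
        have := h2 o (boxOfStage f n B) fun b i h => ih (B.u b i h)
        rwa [kfill_boxOfStage] at this
      | comp o q =>
        induction q using Comp.ind with
        | h B =>
          have := h3 o (boxOfStage f n B) fun b i h => ih (B.u b i h)
          rw [kfill_boxOfStage, ← lay_subst] at this
          change p (lay f n (Layer.subst (stage f n).lam B.a o (Layer.fill o B))) at this
          rwa [(stage f n).subst_fill_dir B] at this
    exact key q

variable {f}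

/-- Two morphisms out of `K f` that agree on `X`, and agree on a box as soon as they agree on its
faces, are equal. -/
theorem K_hom_ext {φ ψ : K f ⟶ Z} (h1 : ∀ x, φ (lam f x) = ψ (lam f x))
    (h2 : ∀ o (B : Box o (rho f)), (∀ b i h, φ (B.u b i h) = ψ (B.u b i h)) →
      φ (kfill f o B) = ψ (kfill f o B)) : φ = ψ :=
  hom_ext <| K_ind f h1 h2 fun o B h => by rw [hom_sub, hom_sub, h2 o B h]

section Lift

variable {g : Z ⟶ W} (κ : KanFilling g) {h : X ⟶ Z} {k : Y ⟶ W} (w : f ≫ k = h ≫ g)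

/-- A partial extension, defined on a stage. -/
structure LiftData (κ : KanFilling g) (h : X ⟶ Z) (k : Y ⟶ W) (S : Stage f) where
  φ : S.P ⟶ Z
  φw : S.ρ ≫ k = φ ≫ g

namespace LiftData

variable {κ} {S : Stage f} (D : LiftData κ h k S)

/-- The extension to the disjoint union. -/
def ext : Layer f S.ρ → Z
  | .inl x => h x
  | .fill o B => κ.fill o (B.map D.φ k D.φw)
  | .comp o q => Comp.lift (fun B : Box o S.ρ => sub (κ.fill o (B.map D.φ k D.φw)) B.a o)
      (fun π B => by rw [Box.map_smul', κ.fill_smul, perm_sub]; rfl)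
      (fun B => fresh_sub _ _ _) q

theorem ext_smul (π : FinPerm 𝔸) (t : Layer f S.ρ) : D.ext (π • t) = π • D.ext t := by
  cases t with
  | inl x => exact hom_smul h π x
  | fill o B =>
    change κ.fill o ((π • B).map D.φ k D.φw) = π • κ.fill o (B.map D.φ k D.φw)
    rw [Box.map_smul', κ.fill_smul]
  | comp o q =>
    induction q using Comp.ind with
    | h B =>
      change sub (κ.fill o ((π • B).map D.φ k D.φw)) (π • B.a) o =
        π • sub (κ.fill o (B.map D.φ k D.φw)) B.a o
      rw [Box.map_smul', κ.fill_smul, perm_sub]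

theorem ext_w (w : f ≫ k = h ≫ g) (t : Layer f S.ρ) : k t.proj = g (D.ext t) := by
  cases t with
  | inl x => exact congr_hom w x
  | fill o B => exact (κ.map_fill o (B.map D.φ k D.φw)).symm
  | comp o q =>
    induction q using Comp.ind with
    | h B =>
      change k (sub B.y B.a o) = g (sub (κ.fill o (B.map D.φ k D.φw)) B.a o)
      rw [hom_sub, hom_sub, κ.map_fill]
      rfl

theorem ext_fill (o) (B : Box o S.ρ) :
    D.ext (Layer.fill o B) = κ.fill o (B.map D.φ k D.φw) := rfl

theorem ext_comp (o) (B : Box o S.ρ) :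
    D.ext (Layer.comp o (Comp.mk B)) = sub (κ.fill o (B.map D.φ k D.φw)) B.a o := rfl

theorem ext_subst (hD : ∀ p, D.ext (S.lam p) = D.φ p) (t : Layer f S.ρ) (c i) :
    D.ext (Layer.subst S.lam c i t) = sub (D.ext t) c i := by
  cases t with
  | inl x => exact hom_sub h x c i
  | fill o B =>
    rw [ext_fill]
    rcases B.face_cases c i with h' | h' | ⟨rfl, rfl⟩
    · rw [S.subst_fill_face B h', hD, κ.sub_fill o (B.map D.φ k D.φw) c i h']; rfl
    · rw [S.subst_fill_out B h', ext_fill, Box.map_subst]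
      exact κ.fill_subst o (B.map D.φ k D.φw) c i h'
    · rw [S.subst_fill_dir B, ext_comp]
  | comp o q =>
    obtain ⟨B, rfl, hB⟩ := Comp.exists_rep {c} q
    simp only [Finset.mem_singleton] at hB
    rw [ext_comp, sub_comm _ _ _ _ _ hB]
    rcases B.face_cases c i with h' | h' | ⟨rfl, rfl⟩
    · rw [S.subst_comp_face B (Ne.symm hB) h', hD, κ.sub_fill o (B.map D.φ k D.φw) c i h',
        hom_sub]; rfl
    · rw [S.subst_comp_out B h', ext_comp, Box.map_subst]
      exact congrArg (sub · B.a o) (κ.fill_subst o (B.map D.φ k D.φw) c i h')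
    · exact absurd rfl hB

end LiftData

/-- The induced partial extension on the next stage. -/
def LiftData.next {S : Stage f} (D : LiftData κ h k S) (hD : ∀ p, D.ext (S.lam p) = D.φ p) :
    LiftData κ h k S.next :=
  ⟨⟨D.ext, D.ext_smul, D.ext_subst hD⟩, hom_ext (D.ext_w w)⟩

theorem LiftData.next_ext {S : Stage f} (D : LiftData κ h k S)
    (hD : ∀ p, D.ext (S.lam p) = D.φ p) (t : Layer f S.ρ) :
    (D.next κ w hD).ext (S.next.lam t) = (D.next κ w hD).φ t := by
  have e : ∀ o (B : Box o S.ρ),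
      κ.fill o ((B.map S.lamHom (𝟙 Y) S.lam_w).map (D.next κ w hD).φ k (D.next κ w hD).φw) =
        κ.fill o (B.map D.φ k D.φw) := fun o B =>
    congrArg (κ.fill o) (Box.ext' rfl rfl (fun b i hb _ => hD (B.u b i hb)) rfl)
  cases t with
  | inl x => rfl
  | fill o B => exact e o B
  | comp o q =>
    induction q using Comp.ind with
    | h B => exact congrArg (sub · B.a o) (e o B)

/-- The extension to every stage, together with the compatibility used to go on. -/
def liftStage : ∀ n, {D : LiftData κ h k (stage f n) // ∀ p, D.ext ((stage f n).lam p) = D.φ p}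
  | 0 => ⟨⟨⟨fun x => x.elim, fun _ x => x.elim, fun x => x.elim⟩, hom_ext fun x => x.elim⟩,
      fun x => x.elim⟩
  | n + 1 => ⟨(liftStage n).1.next κ w (liftStage n).2, (liftStage n).1.next_ext κ w (liftStage n).2⟩

theorem liftStage_tr (n m : ℕ) (hnm : n ≤ m) :
    (liftStage κ w n).1.φ = tr f n m hnm ≫ (liftStage κ w m).1.φ := by
  refine chain_le_ind (p := fun n m hnm => (liftStage κ w n).1.φ =
    tr f n m hnm ≫ (liftStage κ w m).1.φ) (fun n => ?_) (fun n m hnm ih => ?_) n m hnm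
  · rw [tr_self]; rfl
  · rw [tr_succ f n m hnm, ih]
    exact hom_ext fun p => ((liftStage κ w m).2 (tr f n m hnm p)).symm

/-- The morphism `K f ⟶ Z` over `k` that extends `h` and sends the filler `(u, y)` to the chosen
filler of the image of the box `(u, y)`; it is defined by recursion on the stages. -/
def klift : K f ⟶ Z :=
  Seq.descHom (tr_injective f) (fun n => (liftStage κ w n).1.φ) (liftStage_tr κ w)

theorem klift_lam (x : X) : klift κ w (lam f x) = h x := rfl

theorem klift_lay (n : ℕ) (t : Layer f (stage f n).ρ) :
    klift κ w (lay f n t) = (liftStage κ w n).1.ext t := rfl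

theorem klift_w : rho f ≫ k = klift κ w ≫ g := by
  refine hom_ext fun z => ?_
  obtain ⟨n, p, rfl⟩ := exists_stage f z
  exact congr_hom (liftStage κ w n).1.φw p

theorem klift_kfill (o) (B : Box o (rho f)) :
    klift κ w (kfill f o B) = κ.fill o (B.map (klift κ w) k (klift_w κ w)) := by
  obtain ⟨n, C, rfl⟩ := exists_stage_box f B
  rw [kfill_boxOfStage, klift_lay]
  rfl

end Lift

/-! ### The functor `K` and the comonad `L` -/

/-- The morphism `K(h, k)`. -/
def Kmap {f : X ⟶ Y} {g : Z ⟶ W} (h : X ⟶ Z) (k : Y ⟶ W) (w : f ≫ k = h ≫ g) : K f ⟶ K g :=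
  klift (kanRho g) (h := h ≫ lam g) (k := k) w

theorem Kmap_lam {g : Z ⟶ W} (h : X ⟶ Z) (k : Y ⟶ W) (w : f ≫ k = h ≫ g) (x : X) :
    Kmap h k w (lam f x) = lam g (h x) := rfl

theorem Kmap_rho {g : Z ⟶ W} (h : X ⟶ Z) (k : Y ⟶ W) (w : f ≫ k = h ≫ g) :
    rho f ≫ k = Kmap h k w ≫ rho g := klift_w _ _

/-- `K(h, k)(u, y) = (K(h, k) ∘ u, k(y))`. -/
theorem Kmap_kfill {g : Z ⟶ W} (h : X ⟶ Z) (k : Y ⟶ W) (w : f ≫ k = h ≫ g) (o)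
    (B : Box o (rho f)) :
    Kmap h k w (kfill f o B) = kfill g o (B.map (Kmap h k w) k (Kmap_rho h k w)) :=
  klift_kfill _ _ o B

theorem Kmap_id (f : X ⟶ Y) (w : f ≫ 𝟙 Y = 𝟙 X ≫ f) : Kmap (𝟙 X) (𝟙 Y) w = 𝟙 (K f) :=
  K_hom_ext (fun _ => rfl) fun o B h => by
    rw [Kmap_kfill]
    exact congrArg (kfill f o) (Box.ext' rfl rfl (fun b i hb _ => h b i hb) rfl)

theorem Kmap_comp {g : Z ⟶ W} {e : P ⟶ Q} (h : X ⟶ Z) (k : Y ⟶ W) (w : f ≫ k = h ≫ g)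
    (h' : Z ⟶ P) (k' : W ⟶ Q) (w' : g ≫ k' = h' ≫ e) (w'' : f ≫ k ≫ k' = (h ≫ h') ≫ e) :
    Kmap (h ≫ h') (k ≫ k') w'' = Kmap h k w ≫ Kmap h' k' w' :=
  K_hom_ext (fun _ => rfl) fun o B hB => by
    rw [Kmap_kfill, comp_apply, Kmap_kfill, Kmap_kfill]
    exact congrArg (kfill e o) (Box.ext' rfl rfl (fun b i hb _ => hB b i hb) rfl)

/-- Kan filling operators on the composite of two maps with Kan filling operators. -/
def KanFilling.comp {f : X ⟶ Y} {g : Y ⟶ Z} (κ : KanFilling f) (κ' : KanFilling g) :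
    KanFilling (f ≫ g) :=
  have w : (f ≫ g) ≫ 𝟙 Z = f ≫ g := rfl
  let B' : ∀ o, Box o (f ≫ g) → Box o f := fun o B =>
    { A := B.A
      a := B.a
      mem := B.mem
      u := B.u
      y := κ'.fill o (B.map f (𝟙 Z) w)
      fresh := B.fresh
      adj := B.adj
      lies := fun b i h => (κ'.sub_fill o (B.map f (𝟙 Z) w) b i h).symm }
  { fill := fun o B => κ.fill o (B' o B)
    sub_fill := fun o B => κ.sub_fill o (B' o B)
    map_fill := fun o B => by
      rw [comp_apply, κ.map_fill]
      exact κ'.map_fill o (B.map f (𝟙 Z) w)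
    fill_smul := fun o π B => by
      rw [← κ.fill_smul]
      refine congrArg (κ.fill o) (Box.ext' rfl rfl (fun _ _ _ _ => rfl) ?_)
      change κ'.fill o ((π • B).map f (𝟙 Z) w) = π • κ'.fill o (B.map f (𝟙 Z) w)
      rw [Box.map_smul', κ'.fill_smul]
    fill_subst := fun o B c i hc => by
      rw [← κ.fill_subst o (B' o B) c i hc]
      refine congrArg (κ.fill o) (Box.ext' rfl rfl (fun _ _ _ _ => rfl) ?_)
      change κ'.fill o ((B.subst c i hc).map f (𝟙 Z) w) = sub (κ'.fill o (B.map f (𝟙 Z) w)) c i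
      rw [Box.map_subst]
      exact κ'.fill_subst o (B.map f (𝟙 Z) w) c i hc }

/-- The comultiplication `σ_f : K f ⟶ K λ_f`. -/
def sigma (f : X ⟶ Y) : K f ⟶ K (lam f) :=
  klift (f := f) ((kanRho (lam f)).comp (kanRho f)) (h := lam (lam f)) (k := 𝟙 Y) rfl

theorem sigma_lam (f : X ⟶ Y) (x : X) : sigma f (lam f x) = lam (lam f) x := rfl

theorem sigma_rho (f : X ⟶ Y) : sigma f ≫ rho (lam f) = 𝟙 (K f) :=
  K_hom_ext (fun _ => rfl) fun o B h => by
    have e : sigma f (kfill f o B) = _ := klift_kfill _ _ o B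
    rw [comp_apply, e]
    refine ((kanRho (lam f)).map_fill o _).trans ?_
    exact congrArg (kfill f o) (Box.ext' rfl rfl (fun b i hb _ => h b i hb) rfl)

/-- The box `(σ_f ∘ u, (u, y))` over `λ_f`. -/
def sigmaBox {o} (B : Box o (rho f)) : Box o (rho (lam f)) where
  A := B.A
  a := B.a
  mem := B.mem
  u b i h := sigma f (B.u b i h)
  y := kfill f o B
  fresh b i h := (B.fresh b i h).map (hom_smul (sigma f))
  adj b i h b' i' h' hb := by rw [← hom_sub, ← hom_sub, B.adj b i h b' i' h' hb]
  lies b i h := by rw [sub_kfill f B b i h, ← comp_apply, sigma_rho, id_apply]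

/-- `σ_f(u, y) = (σ_f ∘ u, (u, y))`. -/
theorem sigma_kfill {o} (B : Box o (rho f)) :
    sigma f (kfill f o B) = kfill (lam f) o (sigmaBox B) := by
  refine (klift_kfill _ _ o B).trans ?_
  refine congrArg (kfill (lam f) o) (Box.ext' rfl rfl (fun _ _ _ _ => rfl) ?_)
  refine congrArg (kfill f o) (Box.ext' rfl rfl (fun b i hb _ => ?_) rfl)
  exact congr_hom (sigma_rho f) (B.u b i hb)

theorem sigma_natural {g : Z ⟶ W} (h : X ⟶ Z) (k : Y ⟶ W) (w : f ≫ k = h ≫ g)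
    (w' : lam f ≫ Kmap h k w = h ≫ lam g) :
    Kmap h k w ≫ sigma g = sigma f ≫ Kmap h (Kmap h k w) w' :=
  K_hom_ext (fun _ => rfl) fun o B hB => by
    rw [comp_apply, comp_apply, Kmap_kfill, sigma_kfill, sigma_kfill, Kmap_kfill]
    exact congrArg (kfill (lam g) o) (Box.ext' rfl rfl (fun b i hb _ => hB b i hb)
      (Kmap_kfill h k w o B).symm)

theorem sigma_counit (w : lam f ≫ rho f = 𝟙 X ≫ f) :
    sigma f ≫ Kmap (𝟙 X) (rho f) w = 𝟙 (K f) :=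
  K_hom_ext (fun _ => rfl) fun o B hB => by
    rw [comp_apply, sigma_kfill, Kmap_kfill]
    exact congrArg (kfill f o) (Box.ext' rfl rfl (fun b i hb _ => hB b i hb) (rho_kfill f B))

theorem sigma_coassoc (w : lam f ≫ sigma f = 𝟙 X ≫ lam (lam f)) :
    sigma f ≫ Kmap (𝟙 X) (sigma f) w = sigma f ≫ sigma (lam f) :=
  K_hom_ext (fun _ => rfl) fun o B hB => by
    rw [comp_apply, comp_apply, sigma_kfill, Kmap_kfill, sigma_kfill]
    exact congrArg (kfill (lam (lam f)) o) (Box.ext' rfl rfl (fun b i hb _ => hB b i hb)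
      (sigma_kfill B))

/-- The comonad `L` on the category of arrows, with `L f = λ_f`. -/
def L : Comonad (Arrow (Sub01 𝔸)) where
  obj f := Arrow.mk (lam f.hom)
  map {f g} s := Arrow.homMk s.left (Kmap s.left s.right s.w.symm) rfl
  map_id f := by
    ext1
    · rfl
    · exact Kmap_id f.hom _
  map_comp s t := by
    ext1
    · rfl
    · exact Kmap_comp _ _ _ _ _ _ _
  ε := { app := fun f => Arrow.homMk (𝟙 _) (rho f.hom) rfl
         naturality := fun f g s => by
          ext1
          · rfl
          · exact (Kmap_rho s.left s.right s.w.symm).symm }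
  δ := { app := fun f => Arrow.homMk (𝟙 _) (sigma f.hom) rfl
         naturality := fun f g s => by
          ext1
          · rfl
          · exact sigma_natural s.left s.right s.w.symm rfl }
  coassoc f := by
    ext1
    · rfl
    · exact sigma_coassoc _
  left_counit f := by
    ext1
    · rfl
    · exact sigma_rho f.hom
  right_counit f := by
    ext1
    · rfl
    · exact sigma_counit _

/-- The `L`-maps: morphisms admitting a coalgebra structure for the comonad `L`. -/
def LMap : MorphismProperty (Sub01 𝔸) := fun _ _ i =>
  ∃ c : (L (𝔸 := 𝔸)).Coalgebra, c.A = Arrow.mk i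

/-- The class `L̄`: the closure of the `L`-maps under retracts. -/
def LBar : MorphismProperty (Sub01 𝔸) := LMap.retracts

/-- `c` is a coalgebra structure on `i` for `L` regarded as a copointed endofunctor: only the
counit law is required. -/
def IsCopointedCoalgebra (i : X ⟶ Y) (c : Arrow.mk i ⟶ L.obj (Arrow.mk i)) : Prop :=
  c ≫ L.ε.app (Arrow.mk i) = 𝟙 (Arrow.mk i)

/-! ### Path objects -/

/-- The fibre product `X ×_Y X`. -/
def fibreProd (f : X ⟶ Y) : Sub01 𝔸 where
  carrier := {p : X × X // f p.1 = f p.2}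
  str :=
    { smul := fun π p => ⟨(π • p.1.1, π • p.1.2), by simp only [hom_smul, p.2]⟩
      one_smul := fun p => Subtype.ext (Prod.ext (one_smul _ _) (one_smul _ _))
      mul_smul := fun _ _ p => Subtype.ext (Prod.ext (mul_smul _ _ _) (mul_smul _ _ _))
      exists_supp := fun p => by
        obtain ⟨A, hA⟩ := Nominal.exists_supp (𝔸 := 𝔸) p.1.1
        obtain ⟨B, hB⟩ := Nominal.exists_supp (𝔸 := 𝔸) p.1.2
        refine ⟨A ∪ B, fun π hπ => Subtype.ext (Prod.ext (hA π fun a ha => ?_)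
          (hB π fun a ha => ?_))⟩
        · exact hπ (by simp only [Finset.coe_union]; exact Or.inl ha)
        · exact hπ (by simp only [Finset.coe_union]; exact Or.inr ha)
      sub := fun p c i => ⟨(sub p.1.1 c i, sub p.1.2 c i), by simp only [hom_sub, p.2]⟩
      perm_sub := fun π p c i => Subtype.ext (Prod.ext (perm_sub _ _ _ _) (perm_sub _ _ _ _))
      fresh_sub := fun p c i => by
        obtain ⟨A, hA, ha⟩ := fresh_sub p.1.1 c i
        obtain ⟨B, hB, hb⟩ := fresh_sub p.1.2 c i
        refine ⟨A ∪ B, fun π hπ => Subtype.ext (Prod.ext (hA π fun a ha => ?_)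
          (hB π fun a ha => ?_)), by simp [ha, hb]⟩
        · exact hπ (by simp only [Finset.coe_union]; exact Or.inl ha)
        · exact hπ (by simp only [Finset.coe_union]; exact Or.inr ha)
      sub_of_fresh := fun p c i h => by
        obtain ⟨A, hA, ha⟩ := h
        have h1 : Fresh c p.1.1 := ⟨A, fun π hπ => congrArg (fun q => q.1.1) (hA π hπ), ha⟩
        have h2 : Fresh c p.1.2 := ⟨A, fun π hπ => congrArg (fun q => q.1.2) (hA π hπ), ha⟩
        exact Subtype.ext (Prod.ext (sub_of_fresh _ _ _ h1) (sub_of_fresh _ _ _ h2))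
      sub_comm := fun p a b i j h =>
        Subtype.ext (Prod.ext (sub_comm _ _ _ _ _ h) (sub_comm _ _ _ _ _ h)) }

/-- The first component of an element of `X ×_Y X`. -/
def fst (f : X ⟶ Y) : fibreProd f ⟶ X := ⟨fun p => p.1.1, fun _ _ => rfl, fun _ _ _ => rfl⟩

/-- The second component of an element of `X ×_Y X`. -/
def snd (f : X ⟶ Y) : fibreProd f ⟶ X := ⟨fun p => p.1.2, fun _ _ => rfl, fun _ _ _ => rfl⟩

/-- The diagonal `Δ : X ⟶ X ×_Y X`. -/
def diag (f : X ⟶ Y) : X ⟶ fibreProd f :=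
  ⟨fun x => ⟨(x, x), rfl⟩, fun _ _ => rfl, fun _ _ _ => rfl⟩

/-- The pre-normal forms in direction `a`, as elements of `K Δ`. -/
inductive PreNF (f : X ⟶ Y) (a : 𝔸) : K (diag f) → Prop
  | base (x : X) (h : Fresh a x) : PreNF f a (lam (diag f) x)
  | box (B : Box true (rho (diag f))) (hB : B.a = a) (h1 : Fresh a (fst f B.y))
      (h0 : ∀ h, B.u a false h = lam (diag f) (fst f B.y))
      (hu : ∀ b i h, b ≠ a → PreNF f a (B.u b i h)) : PreNF f a (kfill (diag f) true B)

/-- The normal forms: elements `z(a := 1)` with `z` a pre-normal form in direction `a`. -/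
def IsNF (f : X ⟶ Y) (w : K (diag f)) : Prop := ∃ a z, PreNF f a z ∧ sub z a true = w

theorem PreNF.smul {f : X ⟶ Y} {a : 𝔸} {z : K (diag f)} (h : PreNF f a z) (π : FinPerm 𝔸) :
    PreNF f (π • a) (π • z) := by
  induction h with
  | base x h => rw [← hom_smul]; exact .base _ (h.smul π)
  | box B hB h1 h0 hu ih =>
    subst hB
    rw [← kfill_smul]
    refine .box (π • B) rfl ?_ (fun h => ?_) (fun b i h hb => ?_)
    · rw [Box.smul_y, hom_smul]; exact h1.smul π
    · have hf : IsFace B.A B.a true B.a false := ⟨B.mem, by simp⟩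
      rw [Box.smul_u' π B B.a false hf, h0, Box.smul_y, hom_smul, hom_smul]
    · have := ih (π⁻¹ • b) i ((Box.isFace_smul π).1 h) (by rwa [ne_eq, inv_smul_eq_iff])
      exact this

theorem PreNF.sub {f : X ⟶ Y} {a : 𝔸} {z : K (diag f)} (h : PreNF f a z) {c : 𝔸} (hc : c ≠ a)
    (i : Bool) : PreNF f a (Sub01Set.sub z c i) := by
  induction h with
  | base x h => rw [← hom_sub]; exact .base _ (fresh_sub_of_fresh h hc.symm i)
  | box B hB h1 h0 hu ih =>
    rcases B.face_cases c i with h | h | ⟨rfl, rfl⟩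
    · rw [sub_kfill (diag f) B c i h]; exact hu c i h hc
    · rw [← kfill_subst (diag f) B c i h]
      refine .box _ hB ?_ (fun h' => ?_) (fun b j h' hb => ih b j h' hb)
      · change Fresh a (fst f (Sub01Set.sub B.y c i))
        rw [hom_sub]; exact fresh_sub_of_fresh h1 hc.symm i
      · change Sub01Set.sub (B.u a false h') c i = lam (diag f) (fst f (Sub01Set.sub B.y c i))
        rw [hom_sub, hom_sub]
        exact congrArg (Sub01Set.sub · c i) (h0 h')
    · exact absurd hB hc

theorem IsNF.smul {f : X ⟶ Y} {w : K (diag f)} (h : IsNF f w) (π : FinPerm 𝔸) :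
    IsNF f (π • w) := by
  obtain ⟨a, z, hz, rfl⟩ := h
  exact ⟨π • a, π • z, hz.smul π, (perm_sub π z a true).symm⟩

theorem IsNF.sub {f : X ⟶ Y} {w : K (diag f)} (h : IsNF f w) (c : 𝔸) (i : Bool) :
    IsNF f (Sub01Set.sub w c i) := by
  obtain ⟨a, z, hz, rfl⟩ := h
  obtain ⟨d, hd, hdz⟩ := exists_fresh {a, c} z
  simp only [Finset.mem_insert, Finset.mem_singleton, not_or] at hd
  have h1 := hz.smul (swp a d)
  rw [swp_left] at h1
  refine ⟨d, _, h1.sub (Ne.symm hd.2) i, ?_⟩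
  have h2 : Sub01Set.sub (swp a d • z) d true = Sub01Set.sub z a true := by
    have e := perm_sub (swp a d) z a true
    rw [swp_left] at e
    rw [← e, swp_smul_of_fresh (fresh_sub z a true) (fresh_sub_of_fresh hdz hd.1 true)]
  rw [sub_comm _ _ _ _ _ (Ne.symm hd.2), h2]

/-- The labelled path object `P_Y X`: the set of normal forms. -/
def pathObj (f : X ⟶ Y) : Sub01 𝔸 where
  carrier := {w : K (diag f) // IsNF f w}
  str :=
    { smul := fun π w => ⟨π • w.1, w.2.smul π⟩
      one_smul := fun w => Subtype.ext (one_smul _ _)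
      mul_smul := fun _ _ w => Subtype.ext (mul_smul _ _ _)
      exists_supp := fun w => (Nominal.exists_supp (𝔸 := 𝔸) w.1).imp fun A hA π hπ =>
        Subtype.ext (hA π hπ)
      sub := fun w c i => ⟨sub w.1 c i, w.2.sub c i⟩
      perm_sub := fun π w c i => Subtype.ext (perm_sub _ _ _ _)
      fresh_sub := fun w c i => (fresh_sub w.1 c i).imp fun A hA =>
        ⟨fun π hπ => Subtype.ext (hA.1 π hπ), hA.2⟩
      sub_of_fresh := fun w c i h => by
        obtain ⟨A, hA, ha⟩ := h
        exact Subtype.ext (sub_of_fresh _ _ _ ⟨A, fun π hπ => congrArg Subtype.val (hA π hπ), ha⟩)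
      sub_comm := fun w a b i j h => Subtype.ext (sub_comm _ _ _ _ _ h) }

/-- The inclusion of `P_Y X` in `K Δ`. -/
def pathIncl (f : X ⟶ Y) : pathObj f ⟶ K (diag f) := ⟨fun w => w.1, fun _ _ => rfl, fun _ _ _ => rfl⟩

theorem isNF_lam (f : X ⟶ Y) (x : X) : IsNF f (lam (diag f) x) := by
  obtain ⟨a, -, ha⟩ := exists_fresh (∅ : Finset 𝔸) x
  exact ⟨a, _, .base x ha, sub_of_fresh _ _ _ (ha.map (hom_smul _))⟩

/-- The inclusion (reflexivity map) `r : X ⟶ P_Y X`. -/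
def pathRefl (f : X ⟶ Y) : X ⟶ pathObj f where
  toFun x := ⟨lam (diag f) x, isNF_lam f x⟩
  map_smul' π x := Subtype.ext (hom_smul (lam (diag f)) π x)
  map_sub' x c i := Subtype.ext (hom_sub (lam (diag f)) x c i)

/-- The restriction of `ρ_Δ` to `P_Y X`. -/
def pathProj (f : X ⟶ Y) : pathObj f ⟶ fibreProd f := pathIncl f ≫ rho (diag f)

/-- The map `p_f : P_Y X ⟶ Y`. -/
def pathBase (f : X ⟶ Y) : pathObj f ⟶ Y := pathProj f ≫ fst f ≫ f

/-- `E`, with `r` and `p`, is a path object on `f`: a factorisation of the diagonal as a map in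
`L̄` followed by a fibration. -/
structure IsPathObject (f : X ⟶ Y) {E : Sub01 𝔸} (r : X ⟶ E) (p : E ⟶ fibreProd f) : Prop where
  left : LBar r
  right : KanFibration p
  fac : r ≫ p = diag f

/-- The map between fibre products induced by a commutative square. -/
def fibreProdMap {f : X ⟶ Y} {g : Z ⟶ W} (h : Z ⟶ X) (k : W ⟶ Y) (w : h ≫ f = g ≫ k) :
    fibreProd g ⟶ fibreProd f where
  toFun p := ⟨(h p.1.1, h p.1.2), by
    rw [← comp_apply, ← comp_apply, w, comp_apply, comp_apply, p.2]⟩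
  map_smul' π p := Subtype.ext (Prod.ext (hom_smul h _ _) (hom_smul h _ _))
  map_sub' p c i := Subtype.ext (Prod.ext (hom_sub h _ _ _) (hom_sub h _ _ _))

/-- The map `K Δ_g ⟶ K Δ_f` induced by a commutative square from `g` to `f`. -/
def KdiagMap {f : X ⟶ Y} {g : Z ⟶ W} (h : Z ⟶ X) (k : W ⟶ Y) (w : h ≫ f = g ≫ k) :
    K (diag g) ⟶ K (diag f) :=
  Kmap (f := diag g) (g := diag f) h (fibreProdMap h k w) rfl

end Constructions

end ZeroOneSub

open ZeroOneSub

namespace ZeroOneSub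

noncomputable section

open scoped Classical Pointwise
open ZeroOneSub.Sub01Set (sub perm_sub fresh_sub sub_of_fresh sub_comm)
open ZeroOneSub.Sub01

variable {𝔸 : Type u}

section

/-! ### Permutations and substitutions as operations on all `01`-substitution sets -/

/-! The object `K Δ` is free. A formal filler is never a constant, formal fillers of different boxes
differ, and `(u, y)(a := 1)` is an abstraction, which determines `(u, y)` once the bound name `a` is
known. Hence a path `w` is `z(d := 1)` for exactly one pre-normal form `z` in each direction `d`
fresh for `w` (`PreNF.eq_of_sub_eq`, `pnf`). Paths can therefore be handled through pre-normal forms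
in one common fresh direction, and a swapping argument (`eq_of_fresh_choice`) shows that the result
does not depend on that direction.

A box in pre-normal form over `(x, s)` in direction `d` consists of smaller pre-normal forms as
faces and of a label `s`. This is an element of `X` with `f x = f s` and `s(d := 0) = x` that
restricts on the sides to the targets of the faces. Conversely, such data can be assembled (`Asm`).
Completing a family of pre-normal forms thus amounts to finding labels, and this is a filling
problem for `f`: the targets of the given faces and the known endpoints in direction `d` form an
open box in `X` (`Frame.box`), and its Kan filler is the label. This is used twice.

For an open `(A, a)`-box over `X ×_Y X` both endpoints are known, so the box in `X` is open in
direction `a`. The missing face is assembled from the label and the given faces after substituting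
`(a := o)`, and the same label then closes the whole. This gives `kanFibration_pathProj`.

For a closed box over the source map `P_Y X ⟶ X` the endpoint at `d := 1` is not prescribed, so the
box in `X` is `1`-open in direction `d`. Hence the source map has uniform fillers even for closed
boxes (`Closed.fill`).

The second kind of filler makes `r` a coalgebra. A pre-normal form `z` in direction `a` is
contracted to its source by an element `t` of `K r` that is constant at `a := 0` and lies over `z(a
:= 1)` at `a := 1`. To build it, contract the faces first. Their projections, the constant path at
`(a, 0)` and `z(a := 1)` at `(a, 1)` form a closed box over the source map; `t` is the formal filler
of the contracted faces over the filler of this closed box. The coalgebra map sends `z(a := 1)` to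
`t(a := 1)`. Contraction is defined as a relation (`Contr`): its uniqueness and its stability under
permutations and substitutions are what make the contracted faces fit together. The counit law then
exhibits `r` as a retract of the cofree coalgebra `λ_r`.

For stability under pullback no filling is needed. All endpoints and labels in `z` lie over
substitution instances of the single element `f (src f z)`, so in a pullback they lift uniquely once
this element has been lifted, and with them the pre-normal form lifts uniquely. -/

/-- An operation acting on every `01`-substitution set and commuting with every morphism: a finite
permutation or a substitution `(c := i)`. -/
inductive Op (𝔸 : Type u) : Type u
  | perm (π : FinPerm 𝔸) : Op 𝔸
  | sb (c : 𝔸) (i : Bool) : Op 𝔸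

namespace Op

/-- The effect of an operation on names. -/
def nm : Op 𝔸 → FinPerm 𝔸
  | perm π => π
  | sb _ _ => 1

/-- The names on which the operation acts by renaming. -/
def Ok : Op 𝔸 → 𝔸 → Prop
  | perm _, _ => True
  | sb c _, a => a ≠ c

/-- The action of an operation on a `01`-substitution set. -/
def act {X : Type u} [Sub01Set 𝔸 X] : Op 𝔸 → X → X
  | perm π, x => π • x
  | sb c i, x => sub x c i

variable {X : Type u} [Sub01Set 𝔸 X] (θ : Op 𝔸)

theorem act_sub (x : X) {a : 𝔸} (h : θ.Ok a) (i : Bool) :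
    θ.act (sub x a i) = sub (θ.act x) (θ.nm • a) i := by
  cases θ with
  | perm π => exact perm_sub π x a i
  | sb c j =>
    have h : a ≠ c := h
    simp only [act, nm, one_smul]
    exact sub_comm _ _ _ _ _ h

theorem fresh_act {x : X} {a : 𝔸} (h : θ.Ok a) (hx : Fresh a x) :
    Fresh (θ.nm • a) (θ.act x) := by
  cases θ with
  | perm π => exact hx.smul π
  | sb c j =>
    simp only [act, nm, one_smul]
    exact fresh_sub_of_fresh hx h j

theorem hom_act {X Y : Sub01 𝔸} (f : X ⟶ Y) (x : X) : f (θ.act x) = θ.act (f x) := by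
  cases θ with
  | perm π => exact hom_smul f π x
  | sb c j => exact hom_sub f x c j

theorem mem_smul {A : Finset 𝔸} {b : 𝔸} (hb : b ∈ θ.nm • A) : ∃ c ∈ A, b = θ.nm • c := by
  obtain ⟨c, hc, rfl⟩ := Finset.mem_smul_finset.1 hb
  exact ⟨c, hc, rfl⟩

theorem forall_mem_smul {A : Finset 𝔸} {p : 𝔸 → Prop} (h : ∀ b ∈ A, p (θ.nm • b)) :
    ∀ b ∈ θ.nm • A, p b := fun b hb => by
  obtain ⟨c, hc, rfl⟩ := θ.mem_smul hb
  exact h c hc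

end Op

/-! ### Operations on open boxes -/

namespace Box

variable {X Y : Sub01 𝔸} {f : X ⟶ Y} {o : Bool}

/-- The action of an operation on a box. -/
def act (θ : Op 𝔸) (B : Box o f) (hB : ∀ b ∈ B.A, θ.Ok b) : Box o f where
  A := θ.nm • B.A
  a := θ.nm • B.a
  mem := by simpa using B.mem
  u b i h := θ.act (B.u (θ.nm⁻¹ • b) i ((isFace_smul θ.nm).1 h))
  y := θ.act B.y
  fresh b i h := by
    have := θ.fresh_act (hB _ ((isFace_smul θ.nm).1 h).1)
      (B.fresh (θ.nm⁻¹ • b) i ((isFace_smul θ.nm).1 h))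
    rwa [smul_inv_smul] at this
  adj b i h b' i' h' hb := by
    have := congrArg θ.act (B.adj _ i ((isFace_smul θ.nm).1 h) _ i' ((isFace_smul θ.nm).1 h')
      (by simpa using hb))
    rwa [θ.act_sub _ (hB _ ((isFace_smul θ.nm).1 h).1),
      θ.act_sub _ (hB _ ((isFace_smul θ.nm).1 h').1), smul_inv_smul, smul_inv_smul] at this
  lies b i h := by
    rw [θ.hom_act, B.lies, θ.act_sub _ (hB _ ((isFace_smul θ.nm).1 h).1), smul_inv_smul]

theorem isFace_smul' {A : Finset 𝔸} {a b : 𝔸} {i : Bool} (π : FinPerm 𝔸) :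
    IsFace (π • A) (π • a) o (π • b) i ↔ IsFace A a o b i := by
  rw [isFace_smul, inv_smul_smul]

theorem act_u (θ : Op 𝔸) (B : Box o f) (hB : ∀ b ∈ B.A, θ.Ok b) (b i h h') :
    (B.act θ hB).u (θ.nm • b) i h' = θ.act (B.u b i h) :=
  congrArg θ.act (B.u_congr' (by simp) _ _ _)

/-- Recognises a transformed box by its values at the renamed names, so that the inverse renaming in
the definition of `act` need not be handled again. -/
theorem act_eq (θ : Op 𝔸) (B : Box o f) (hB : ∀ b ∈ B.A, θ.Ok b) {C : Box o f}
    (hA : C.A = θ.nm • B.A) (ha : C.a = θ.nm • B.a)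
    (hu : ∀ b i h h', C.u (θ.nm • b) i h' = θ.act (B.u b i h)) (hy : C.y = θ.act B.y) :
    C = B.act θ hB :=
  ext' hA ha (fun b i h h' => by
    have e : b = θ.nm • θ.nm⁻¹ • b := by simp
    rw [C.u_congr' e i h (e ▸ h)]
    exact hu _ i ((isFace_smul θ.nm).1 h') _) hy

theorem act_sb (c : 𝔸) (i : Bool) (B : Box o f) (hB) (hc : c ∉ B.A) :
    B.act (.sb c i) hB = B.subst c i hc :=
  (act_eq (.sb c i) B hB (C := B.subst c i hc) (by simp [subst, Op.nm])
    (by simp [subst, Op.nm]) (fun b j h h' => by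
      have e : (Op.sb c i).nm • b = b := one_smul _ b
      exact (subst B c i hc).u_congr' e j _ h) rfl).symm

theorem notMem_of_ok {c : 𝔸} {i : Bool} {B : Box o f} (hB : ∀ b ∈ B.A, (Op.sb c i).Ok b) :
    c ∉ B.A := fun h => hB c h rfl

variable [Infinite 𝔸]

theorem fresh_act {θ : Op 𝔸} {B : Box o f} (hB : ∀ b ∈ B.A, θ.Ok b) {d : 𝔸} (hd : θ.Ok d)
    (h : Fresh d B) : Fresh (θ.nm • d) (B.act θ hB) :=
  fresh_of (by simpa [act] using notMem_of_fresh h)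
    (fun _ _ _ => θ.fresh_act hd (fresh_u h _ _ _)) (θ.fresh_act hd (fresh_y h))

end Box

variable [Infinite 𝔸]

/-- The two uniformity conditions in one: for `(c := i)`, the requirement that `θ` be admissible on
all of `A` says that `c ∉ A`. -/
theorem KanFilling.fill_act {X Y : Sub01 𝔸} {f : X ⟶ Y} (κ : KanFilling f) {o : Bool} (θ : Op 𝔸)
    (B : Box o f) (hB : ∀ b ∈ B.A, θ.Ok b) :
    κ.fill o (B.act θ hB) = θ.act (κ.fill o B) := by
  cases θ with
  | perm π => exact κ.fill_smul o π B
  | sb c i =>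
    have hc := Box.notMem_of_ok hB
    rw [Box.act_sb c i B hB hc]
    exact κ.fill_subst o B c i hc

theorem KanFilling.fill_eq_act {X Y : Sub01 𝔸} {f : X ⟶ Y} (κ : KanFilling f) {o : Bool} (θ : Op 𝔸)
    {B C : Box o f} (hB : ∀ b ∈ B.A, θ.Ok b)
    (hA : C.A = θ.nm • B.A) (ha : C.a = θ.nm • B.a)
    (hu : ∀ b i h h', C.u (θ.nm • b) i h' = θ.act (B.u b i h)) (hy : C.y = θ.act B.y) :
    κ.fill o C = θ.act (κ.fill o B) := by
  rw [Box.act_eq θ B hB hA ha hu hy, κ.fill_act]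

/-- A choice of Kan filling operators from one that commutes with all operations. -/
def KanFilling.ofAct {X Y : Sub01 𝔸} {f : X ⟶ Y} (fill : ∀ o, Box o f → X)
    (sub_fill : ∀ o (B : Box o f) b i (h : IsFace B.A B.a o b i), sub (fill o B) b i = B.u b i h)
    (map_fill : ∀ o (B : Box o f), f (fill o B) = B.y)
    (fill_act : ∀ o (θ : Op 𝔸) (B : Box o f) (hB : ∀ b ∈ B.A, θ.Ok b),
      fill o (B.act θ hB) = θ.act (fill o B)) : KanFilling f where
  fill := fill
  sub_fill := sub_fill
  map_fill := map_fill
  fill_smul o π B := fill_act o (.perm π) B fun _ _ => trivial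
  fill_subst o B c i hc := by
    have hB : ∀ b ∈ B.A, (Op.sb c i).Ok b := fun b hb e => hc (e ▸ hb)
    rw [← Box.act_sb c i B hB hc]
    exact fill_act o (.sb c i) B hB

/-! ### Elements of `K f` as normal forms -/

section Free

variable {X Y : Sub01 𝔸} {f : X ⟶ Y}

theorem lay_injective (n : ℕ) : Function.Injective (lay f n) := stageHom_injective f (n + 1)

theorem lay_inl (n : ℕ) (x : X) : lay f n (Layer.inl x) = lam f x := by
  induction n with
  | zero => rfl
  | succ n ih => exact (lay_next f n (Layer.inl x)).trans ih

theorem lam_injective : Function.Injective (lam f) := fun x x' h => by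
  rw [← lay_inl 0, ← lay_inl 0] at h
  exact Layer.inl.inj (lay_injective 0 h)

/-- All late stages are needed rather than one, because two boxes can be compared only after both
have been moved to a common stage. -/
theorem exists_stage_box_ge {o : Bool} (B : Box o (rho f)) :
    ∃ n, ∀ m, n ≤ m → ∃ C, boxOfStage f (o := o) m C = B := by
  obtain ⟨n, C, rfl⟩ := exists_stage_box f B
  exact ⟨n, fun m hm => ⟨C.map (tr f n m hm) (𝟙 Y) (tr_ρ f n m hm),
    Box.ext' rfl rfl (fun b i hb _ => stageHom_tr f hm (C.u b i hb)) rfl⟩⟩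

theorem lam_ne_kfill (x : X) {o} (B : Box o (rho f)) : lam f x ≠ kfill f o B := by
  obtain ⟨n, C, rfl⟩ := exists_stage_box f B
  rw [kfill_boxOfStage, ← lay_inl n]
  exact fun h => nomatch lay_injective n h

theorem sub_kfill_dir {o} (n : ℕ) (C : Box o (stage f n).ρ) :
    sub (kfill f o (boxOfStage f n C)) C.a o = lay f n (Layer.comp o (Comp.mk C)) := by
  rw [kfill_boxOfStage, ← lay_subst, (stage f n).subst_fill_dir C]

theorem lam_ne_sub_kfill (x : X) {o} (B : Box o (rho f)) : lam f x ≠ sub (kfill f o B) B.a o := by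
  obtain ⟨n, C, rfl⟩ := exists_stage_box f B
  change lam f x ≠ sub (kfill f o (boxOfStage f n C)) C.a o
  rw [sub_kfill_dir, ← lay_inl n]
  exact fun h => nomatch lay_injective n h

/-- At a common stage both fillers are values of the same constructor of `Layer`, and every stage
embeds into `K f`. -/
theorem kfill_injective (o : Bool) : Function.Injective (kfill f o) := fun B B' h => by
  obtain ⟨n, hn⟩ := exists_stage_box_ge B
  obtain ⟨m, hm⟩ := exists_stage_box_ge B'
  obtain ⟨C, rfl⟩ := hn _ (le_max_left n m)
  obtain ⟨C', rfl⟩ := hm _ (le_max_right n m)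
  rw [kfill_boxOfStage, kfill_boxOfStage] at h
  have := lay_injective _ h
  cases this
  rfl

/-- Substituting at the missing face produces the abstraction `⟨a⟩(u, y)`, and an abstraction with a
known bound name determines its body. -/
theorem eq_of_sub_kfill_eq {o} {B B' : Box o (rho f)}
    (h : sub (kfill f o B) B.a o = sub (kfill f o B') B'.a o) (ha : B.a = B'.a) : B = B' := by
  obtain ⟨n, hn⟩ := exists_stage_box_ge B
  obtain ⟨m, hm⟩ := exists_stage_box_ge B'
  obtain ⟨C, rfl⟩ := hn _ (le_max_left n m)
  obtain ⟨C', rfl⟩ := hm _ (le_max_right n m)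
  have h : sub (kfill f o (boxOfStage f _ C)) C.a o =
    sub (kfill f o (boxOfStage f _ C')) C'.a o := h
  rw [sub_kfill_dir, sub_kfill_dir] at h
  have := lay_injective _ h
  simp only [Layer.comp.injEq, heq_eq_eq, true_and] at this
  rw [Comp.eq_of_mk_eq this ha]

/-- Abstracting a name hides no other name. This is read off at a stage and transported along the
equivariant map to boxes over `rho f`. -/
theorem fresh_box_of_fresh_sub_kfill {o} {B : Box o (rho f)} {c : 𝔸}
    (h : Fresh c (sub (kfill f o B) B.a o)) (hc : c ≠ B.a) : Fresh c B := by
  obtain ⟨n, C, rfl⟩ := exists_stage_box f B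
  have h : Fresh c (sub (kfill f o (boxOfStage f _ C)) C.a o) := h
  rw [sub_kfill_dir] at h
  have h1 := h.of_map (fun π t => lay_smul f n π t) (lay_injective n)
  have h2 := (stage f n).fresh_comp.1 h1
  have h3 := Comp.fresh_of_fresh_mk h2 hc
  exact h3.map fun π D => Box.map_smul' _ _ _ D π

theorem fresh_kfill {o} {B : Box o (rho f)} {c : 𝔸} (h : Fresh c B) : Fresh c (kfill f o B) :=
  h.map (kfill_smul f)

end Free

end

section

/-! ### Pre-normal forms -/

variable [Infinite 𝔸] {X Y : Sub01 𝔸} {f : X ⟶ Y}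

theorem PreNF.act {a : 𝔸} {z : K (diag f)} (h : PreNF f a z) (θ : Op 𝔸) (ha : θ.Ok a) :
    PreNF f (θ.nm • a) (θ.act z) := by
  cases θ with
  | perm π => exact h.smul π
  | sb c i =>
    simp only [Op.act, Op.nm, one_smul]
    exact h.sub (Ne.symm ha) i

/-- The first endpoint of an element of `K Δ`. -/
def src (f : X ⟶ Y) : K (diag f) ⟶ X := rho (diag f) ≫ fst f

/-- The second endpoint of an element of `K Δ`. -/
def tgt (f : X ⟶ Y) : K (diag f) ⟶ X := rho (diag f) ≫ snd f

theorem src_lam (x : X) : src f (lam (diag f) x) = x := rfl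

theorem tgt_lam (x : X) : tgt f (lam (diag f) x) = x := rfl

theorem src_tgt (z : K (diag f)) : f (src f z) = f (tgt f z) := (rho (diag f) z).2

theorem rho_ext {z : K (diag f)} {p : fibreProd f} (h1 : src f z = fst f p)
    (h2 : tgt f z = snd f p) : rho (diag f) z = p := Subtype.ext (Prod.ext h1 h2)

theorem src_kfill {o} (B : Box o (rho (diag f))) : src f (kfill (diag f) o B) = fst f B.y :=
  congrArg (fst f) (rho_kfill _ B)

theorem tgt_kfill {o} (B : Box o (rho (diag f))) : tgt f (kfill (diag f) o B) = snd f B.y :=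
  congrArg (snd f) (rho_kfill _ B)

theorem isFace_false {A : Finset 𝔸} {a : 𝔸} (h : a ∈ A) : IsFace A a true a false :=
  ⟨h, by simp⟩

theorem isFace_of_ne {A : Finset 𝔸} {a b : 𝔸} {o i : Bool} (h : b ∈ A) (hb : b ≠ a) :
    IsFace A a o b i := ⟨h, fun e => hb e.1⟩

/-! ### Endpoints of pre-normal forms, and their recovery from normal forms -/

namespace PreNF

variable {a : 𝔸} {z z' : K (diag f)}

theorem fresh_src (h : PreNF f a z) : Fresh a (src f z) := by
  cases h with
  | base x h => exact h
  | box B hB h1 h0 hu => rw [src_kfill]; exact h1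

theorem sub_false (h : PreNF f a z) : Sub01Set.sub z a false = lam (diag f) (src f z) := by
  cases h with
  | base x h => rw [← hom_sub, sub_of_fresh _ _ _ h, src_lam]
  | box B hB h1 h0 hu =>
    subst hB
    rw [sub_kfill _ B _ _ (isFace_false B.mem), h0, src_kfill]

theorem src_sub_self (h : PreNF f a z) (i : Bool) : src f (Sub01Set.sub z a i) = src f z := by
  rw [hom_sub, sub_of_fresh _ _ _ h.fresh_src]

theorem tgt_sub_false (h : PreNF f a z) : Sub01Set.sub (tgt f z) a false = src f z := by
  rw [← hom_sub, h.sub_false, tgt_lam]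

/-- Passing to the normal form forgets at most the direction `a`: for a box, the normal form is an
abstraction over `a` of that box. -/
theorem fresh_of_sub (h : PreNF f a z) {c : 𝔸} (hc : c ≠ a) (hz : Fresh c (Sub01Set.sub z a true)) :
    Fresh c z := by
  cases h with
  | base x h => rwa [sub_of_fresh _ _ _ (h.map (hom_smul _))] at hz
  | box B hB h1 h0 hu =>
    subst hB
    exact fresh_kfill (fresh_box_of_fresh_sub_kfill hz hc)

/-- By freeness a constant is never an abstraction, and two abstractions with the same bound name
have the same body. Later identities between pre-normal forms of paths are checked after
substituting `1` for the direction and then deduced from this. -/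
theorem eq_of_sub_eq (h : PreNF f a z) (h' : PreNF f a z')
    (e : Sub01Set.sub z a true = Sub01Set.sub z' a true) : z = z' := by
  have base : ∀ x : X, Fresh a x → Sub01Set.sub (lam (diag f) x) a true = lam (diag f) x :=
    fun x hx => sub_of_fresh _ _ _ (hx.map (hom_smul _))
  cases h with
  | base x h => cases h' with
    | base x' h' => rwa [base x h, base x' h'] at e
    | box B hB h1 h0 hu =>
      subst hB
      rw [base x h] at e
      exact absurd e (lam_ne_sub_kfill x B)
  | box B hB h1 h0 hu =>
    subst hB
    cases h' with
    | base x' h' =>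
      rw [base x' h'] at e
      exact absurd e.symm (lam_ne_sub_kfill x' B)
    | box B' hB' h1' h0' hu' =>
      rw [eq_of_sub_kfill_eq (by rw [hB']; exact e) hB'.symm]

end PreNF

/-- In a fresh direction, renaming the direction does not change the normal form. -/
theorem sub_swp_of_fresh {X : Type u} [Sub01Set 𝔸 X] {a d : 𝔸} {z : X} {i : Bool}
    (h : Fresh d (sub z a i)) : sub (swp a d • z) d i = sub z a i := by
  have e := perm_sub (swp a d) z a i
  rw [swp_left] at e
  rw [← e, swp_smul_of_fresh (fresh_sub z a i) h]

theorem IsNF.exists_preNF {w : K (diag f)} (h : IsNF f w) {d : 𝔸} (hd : Fresh d w) :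
    ∃ z, PreNF f d z ∧ Sub01Set.sub z d true = w := by
  obtain ⟨a, z, hz, rfl⟩ := h
  have h1 := hz.smul (swp a d)
  rw [swp_left] at h1
  exact ⟨_, h1, sub_swp_of_fresh hd⟩

/-- The pre-normal form in the fresh direction `d` of a normal form. -/
def pnf (w : pathObj f) (d : 𝔸) : K (diag f) :=
  if h : Fresh d w.1 then (w.2.exists_preNF h).choose else w.1

theorem fresh_val {w : pathObj f} {d : 𝔸} (h : Fresh d w) : Fresh d w.1 :=
  h.map (hom_smul (pathIncl f))

theorem fresh_of_val {w : pathObj f} {d : 𝔸} (h : Fresh d w.1) : Fresh d w :=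
  h.of_map (hom_smul (pathIncl f)) Subtype.val_injective

/-! ### The pre-normal form of a path in a fresh direction -/

section Pnf

variable {w : pathObj f} {d : 𝔸} (h : Fresh d w)
include h

theorem pnf_spec : PreNF f d (pnf w d) ∧ sub (pnf w d) d true = w.1 := by
  unfold pnf
  rw [dif_pos (fresh_val h)]
  exact (w.2.exists_preNF (fresh_val h)).choose_spec

theorem preNF_pnf : PreNF f d (pnf w d) := (pnf_spec h).1

theorem sub_pnf : sub (pnf w d) d true = w.1 := (pnf_spec h).2

theorem pnf_eq {z : K (diag f)} (hz : PreNF f d z) (e : sub z d true = w.1) : pnf w d = z :=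
  (preNF_pnf h).eq_of_sub_eq hz (by rw [sub_pnf h, e])

theorem fresh_pnf {c : 𝔸} (hc : Fresh c w) (hcd : c ≠ d) : Fresh c (pnf w d) :=
  (preNF_pnf h).fresh_of_sub hcd (by rw [sub_pnf h]; exact fresh_val hc)

/-- By uniqueness: the transformed pre-normal form is pre-normal in the renamed direction and
induces the transformed path. -/
theorem pnf_act (θ : Op 𝔸) (hd : θ.Ok d) : pnf (θ.act w) (θ.nm • d) = θ.act (pnf w d) := by
  refine pnf_eq (θ.fresh_act hd h) ((preNF_pnf h).act θ hd) ?_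
  rw [← θ.act_sub _ hd, sub_pnf h]
  exact (θ.hom_act (pathIncl f) w).symm

theorem pnf_sub {c : 𝔸} (hc : c ≠ d) (i : Bool) : pnf (sub w c i) d = sub (pnf w d) c i := by
  have := pnf_act h (.sb c i) hc.symm
  simpa only [Op.act, Op.nm, one_smul] using this

end Pnf

/-- The first endpoint of a path. -/
def pathSrc (f : X ⟶ Y) : pathObj f ⟶ X := pathProj f ≫ fst f

/-- The second endpoint of a path. -/
def pathTgt (f : X ⟶ Y) : pathObj f ⟶ X := pathProj f ≫ snd f

theorem src_pnf {w : pathObj f} {d : 𝔸} (h : Fresh d w) : src f (pnf w d) = pathSrc f w := by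
  rw [← (preNF_pnf h).src_sub_self true, sub_pnf h]; rfl

theorem tgt_pnf_true {w : pathObj f} {d : 𝔸} (h : Fresh d w) :
    sub (tgt f (pnf w d)) d true = pathTgt f w := by
  rw [← hom_sub, sub_pnf h]; rfl

end

section

variable [Infinite 𝔸] {X Y : Sub01 𝔸} {f : X ⟶ Y}

/-! ### Pre-normal forms assembled from a closed family of faces -/

/-- The data of a pre-normal form in direction `d` over `(x, s)` with faces `z b i` for `b ∈ A`. -/
structure Asm (f : X ⟶ Y) where
  d : 𝔸
  A : Finset 𝔸
  hd : d ∉ A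
  z : 𝔸 → Bool → K (diag f)
  x : X
  s : X
  pre : ∀ b ∈ A, ∀ i, PreNF f d (z b i)
  fresh : ∀ b ∈ A, ∀ i, Fresh b (z b i)
  adj : ∀ b ∈ A, ∀ i, ∀ b' ∈ A, ∀ i', b ≠ b' → sub (z b i) b' i' = sub (z b' i') b i
  fx : Fresh d x
  s0 : sub s d false = x
  fs : f x = f s
  lsrc : ∀ b ∈ A, ∀ i, src f (z b i) = sub x b i
  ltgt : ∀ b ∈ A, ∀ i, tgt f (z b i) = sub s b i

namespace Asm

variable (T : Asm f)

theorem face_cases {A : Finset 𝔸} {d b : 𝔸} {i : Bool} (h : IsFace (insert d A) d true b i) :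
    (b = d ∧ i = false) ∨ (b ≠ d ∧ b ∈ A) := by
  obtain ⟨h1, h2⟩ := h
  by_cases hb : b = d
  · exact .inl ⟨hb, by simpa [hb] using h2⟩
  · exact .inr ⟨hb, (Finset.mem_insert.1 h1).resolve_left hb⟩

/-- The open box with the given faces. -/
def box : Box true (rho (diag f)) where
  A := insert T.d T.A
  a := T.d
  mem := Finset.mem_insert_self _ _
  u b i _ := if b = T.d then lam (diag f) T.x else T.z b i
  y := ⟨(T.x, T.s), T.fs⟩
  fresh b i h := by
    rcases face_cases h with ⟨rfl, rfl⟩ | ⟨hb, hA⟩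
    · rw [if_pos rfl]; exact T.fx.map (hom_smul _)
    · rw [if_neg hb]; exact T.fresh b hA i
  adj b i h b' i' h' hbb := by
    -- The constant face at `(d, 0)` fits the other faces because a pre-normal form at `d := 0` is
    -- constant at its source.
    have key : ∀ b ∈ T.A, ∀ i, sub (lam (diag f) T.x) b i = sub (T.z b i) T.d false :=
      fun b hb i => by rw [(T.pre b hb i).sub_false, T.lsrc b hb i, hom_sub]
    rcases face_cases h with ⟨rfl, rfl⟩ | ⟨hb, hA⟩
    · rcases face_cases h' with ⟨rfl, rfl⟩ | ⟨hb', hA'⟩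
      · exact absurd rfl hbb
      · rw [if_pos rfl, if_neg hb']; exact key b' hA' i'
    · rcases face_cases h' with ⟨rfl, rfl⟩ | ⟨hb', hA'⟩
      · rw [if_pos rfl, if_neg hb]; exact (key b hA i).symm
      · rw [if_neg hb, if_neg hb']; exact T.adj b hA i b' hA' i' hbb
  lies b i h := by
    rcases face_cases h with ⟨rfl, rfl⟩ | ⟨hb, hA⟩
    · rw [if_pos rfl]
      -- At `d := 0` the pair `(x, s)` becomes `(x, x)`: `d` is fresh for `x`, and the label starts
      -- at `x`.
      exact rho_ext (f := f) (sub_of_fresh _ _ _ T.fx).symm T.s0.symm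
    · rw [if_neg hb]
      exact rho_ext (f := f) (T.lsrc b hA i) (T.ltgt b hA i)

/-- The assembled pre-normal form. -/
def nf : K (diag f) := kfill (diag f) true T.box

theorem preNF_nf : PreNF f T.d T.nf := by
  refine .box T.box rfl T.fx (fun h => if_pos rfl) fun b i h hb => ?_
  rcases face_cases h with ⟨rfl, rfl⟩ | ⟨hb, hA⟩
  · exact absurd rfl hb
  · change PreNF f T.d (if b = T.d then lam (diag f) T.x else T.z b i)
    rw [if_neg hb]; exact T.pre b hA i

theorem ne_d {b : 𝔸} (hb : b ∈ T.A) : b ≠ T.d := fun e => T.hd (e ▸ hb)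

theorem sub_nf {b : 𝔸} (hb : b ∈ T.A) (i : Bool) : sub T.nf b i = T.z b i := by
  have h : IsFace T.box.A T.box.a true b i :=
    isFace_of_ne (Finset.mem_insert_of_mem hb) (T.ne_d hb)
  exact (sub_kfill _ T.box b i h).trans (if_neg (T.ne_d hb))

theorem src_nf : src f T.nf = T.x := src_kfill T.box

theorem tgt_nf : tgt f T.nf = T.s := tgt_kfill T.box

/-- Serves for the missing face of an open box, with `c` the direction in which that face is
missing. -/
theorem fresh_nf {c : 𝔸} (hcd : c ≠ T.d) (hc : c ∉ T.A) (hz : ∀ b ∈ T.A, ∀ i, Fresh c (T.z b i))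
    (hx : Fresh c T.x) (hs : Fresh c T.s) : Fresh c T.nf := by
  refine fresh_kfill (Box.fresh_of ?_ (fun b i h => ?_) ?_)
  · simp [box, hcd, hc]
  · rcases face_cases h with ⟨rfl, rfl⟩ | ⟨hb, hA⟩
    · change Fresh c (if T.d = T.d then lam (diag f) T.x else T.z T.d false)
      rw [if_pos rfl]; exact hx.map (hom_smul _)
    · change Fresh c (if b = T.d then lam (diag f) T.x else T.z b i)
      rw [if_neg hb]; exact hz b hA i
  · obtain ⟨S, hS, hcS⟩ := hx
    obtain ⟨S', hS', hcS'⟩ := hs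
    refine ⟨S ∪ S', fun π hπ => Subtype.ext (Prod.ext (hS π fun a ha => ?_)
      (hS' π fun a ha => ?_)), by simp [hcS, hcS']⟩
    · exact hπ (by simp only [Finset.coe_union]; exact Or.inl ha)
    · exact hπ (by simp only [Finset.coe_union]; exact Or.inr ha)

/-- `T'` is the result of applying the operation `θ` to `T`. -/
structure Act (θ : Op 𝔸) (T T' : Asm f) : Prop where
  okd : θ.Ok T.d
  okA : ∀ b ∈ T.A, θ.Ok b
  d : T'.d = θ.nm • T.d
  A : T'.A = θ.nm • T.A
  z : ∀ b ∈ T.A, ∀ i, T'.z (θ.nm • b) i = θ.act (T.z b i)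
  x : T'.x = θ.act T.x
  s : T'.s = θ.act T.s

theorem smul_insert (π : FinPerm 𝔸) (d : 𝔸) (A : Finset 𝔸) :
    π • insert d A = insert (π • d) (π • A) := Finset.smul_finset_insert _ _ _

/-- The assembled form is a formal filler, and formal fillers in `K Δ` are uniform; it remains to
compare the two boxes. -/
theorem nf_act {θ : Op 𝔸} {T T' : Asm f} (h : Act θ T T') : T'.nf = θ.act T.nf := by
  have hB : ∀ b ∈ T.box.A, θ.Ok b := fun b hb => by
    rcases Finset.mem_insert.1 hb with rfl | hb
    · exact h.okd
    · exact h.okA b hb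
  refine (kanRho (diag f)).fill_eq_act θ (B := T.box) (C := T'.box) hB ?_ h.d ?_ ?_
  · change insert T'.d T'.A = θ.nm • insert T.d T.A
    rw [smul_insert, h.d, h.A]
  · intro b i hf hf'
    change (if θ.nm • b = T'.d then lam (diag f) T'.x else T'.z (θ.nm • b) i) =
      θ.act (if b = T.d then lam (diag f) T.x else T.z b i)
    rcases face_cases hf with ⟨rfl, rfl⟩ | ⟨hb, hA⟩
    · rw [if_pos h.d.symm, if_pos rfl, h.x, θ.hom_act]
    · rw [if_neg (by rwa [h.d, smul_left_cancel_iff]), if_neg hb, h.z b hA]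
  · exact Subtype.ext (Prod.ext (h.x.trans (θ.hom_act (fst f) T.box.y).symm)
      (h.s.trans (θ.hom_act (snd f) T.box.y).symm))

/-- The normal form obtained from the assembled pre-normal form. -/
def path : pathObj f := ⟨sub T.nf T.d true, _, _, T.preNF_nf, rfl⟩

theorem fresh_path : Fresh T.d T.path := fresh_of_val (fresh_sub _ _ _)

theorem pathSrc_path : pathSrc f T.path = T.x := by
  change src f (sub T.nf T.d true) = T.x
  rw [T.preNF_nf.src_sub_self, src_nf]

theorem pathTgt_path : pathTgt f T.path = sub T.s T.d true := by
  change tgt f (sub T.nf T.d true) = _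
  rw [hom_sub, tgt_nf]

theorem path_act {θ : Op 𝔸} {T T' : Asm f} (h : Act θ T T') : T'.path = θ.act T.path := by
  refine Subtype.ext ?_
  have e : (θ.act T.path).1 = θ.act T.path.1 := θ.hom_act (pathIncl f) T.path
  rw [e]
  change sub T'.nf T'.d true = θ.act (sub T.nf T.d true)
  rw [θ.act_sub _ h.okd, nf_act h, h.d]

theorem sub_path {b : 𝔸} (hb : b ∈ T.A) (i : Bool) {w : pathObj f}
    (hw : w.1 = sub (T.z b i) T.d true) : sub T.path b i = w := by
  refine Subtype.ext ?_
  change sub (sub T.nf T.d true) b i = w.1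
  rw [sub_comm _ _ _ _ _ (T.ne_d hb).symm, T.sub_nf hb, hw]

end Asm

/-! ### Labels of partial families of pre-normal forms -/

/-- A family of pre-normal forms in direction `d`, indexed by the faces of an `o`-open box or by all
faces (for `a = d` and `o = true`), together with endpoints. -/
structure Frame (f : X ⟶ Y) (o : Bool) where
  d : 𝔸
  a : 𝔸
  A : Finset 𝔸
  hd : d ∉ A
  ha : a ∈ insert d A
  hdo : d = a → o = true
  z : 𝔸 → Bool → K (diag f)
  x₁ : X
  x₂ : X
  hx : f x₁ = f x₂
  fx₁ : Fresh d x₁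
  fx₂ : Fresh d x₂
  pre : ∀ b i, IsFace A a o b i → PreNF f d (z b i)
  fresh : ∀ b i, IsFace A a o b i → Fresh b (z b i)
  adj : ∀ b i, IsFace A a o b i → ∀ b' i', IsFace A a o b' i' → b ≠ b' →
    sub (z b i) b' i' = sub (z b' i') b i
  lsrc : ∀ b i, IsFace A a o b i → src f (z b i) = sub x₁ b i
  ltgt : ∀ b i, IsFace A a o b i → d ≠ a → sub (tgt f (z b i)) d true = sub x₂ b i

namespace Frame

variable {o : Bool} (F : Frame f o)

/-- The endpoints. -/
def pt (i : Bool) : X := if i then F.x₂ else F.x₁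

theorem face_cases {b : 𝔸} {i : Bool} (h : IsFace (insert F.d F.A) F.a o b i) :
    (b = F.d ∧ (i = true → F.d ≠ F.a)) ∨ (b ≠ F.d ∧ IsFace F.A F.a o b i) := by
  obtain ⟨h1, h2⟩ := h
  by_cases hb : b = F.d
  -- If `d = a` then `o` is `1`, so `(d, 1)` is the missing face itself.
  · exact .inl ⟨hb, fun hi e => h2 ⟨hb.trans e, hi.trans (F.hdo e).symm⟩⟩
  · exact .inr ⟨hb, (Finset.mem_insert.1 h1).resolve_left hb, h2⟩

/-- At `d := 0` the target of a pre-normal form equals its source, which lies at `x₁`. At `d := 1`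
the prescribed endpoint is used, and this is available only when `(d, 1)` is not the missing face.
-/
theorem adj_pt {i : Bool} (hi : i = true → F.d ≠ F.a) {b' : 𝔸} {i' : Bool}
    (h : IsFace F.A F.a o b' i') : sub (F.pt i) b' i' = sub (tgt f (F.z b' i')) F.d i := by
  cases i with
  | false => exact ((F.pre _ _ h).tgt_sub_false.trans (F.lsrc _ _ h)).symm
  | true => exact (F.ltgt _ _ h (hi rfl)).symm

/-- The open box in `X` whose filler is the label. -/
def box : Box o f where
  A := insert F.d F.A
  a := F.a
  mem := F.ha
  u b i _ := if b = F.d then F.pt i else tgt f (F.z b i)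
  y := f F.x₁
  fresh b i h := by
    rcases F.face_cases h with ⟨rfl, -⟩ | ⟨hb, hA⟩
    · rw [if_pos rfl]
      cases i
      · exact F.fx₁
      · exact F.fx₂
    · rw [if_neg hb]; exact (F.fresh b i hA).map (hom_smul _)
  adj b i h b' i' h' hbb := by
    rcases F.face_cases h with ⟨rfl, hi⟩ | ⟨hb, hA⟩
    · rcases F.face_cases h' with ⟨rfl, -⟩ | ⟨hb', hA'⟩
      · exact absurd rfl hbb
      · rw [if_pos rfl, if_neg hb']; exact F.adj_pt hi hA'
    · rcases F.face_cases h' with ⟨rfl, hi⟩ | ⟨hb', hA'⟩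
      · rw [if_pos rfl, if_neg hb]; exact (F.adj_pt hi hA).symm
      · rw [if_neg hb, if_neg hb', ← hom_sub, ← hom_sub, F.adj b i hA b' i' hA' hbb]
  lies b i h := by
    rcases F.face_cases h with ⟨rfl, -⟩ | ⟨hb, hA⟩
    · rw [if_pos rfl, ← hom_sub, sub_of_fresh _ _ _ F.fx₁]
      cases i
      · rfl
      · exact F.hx.symm
    -- Paths stay in the fibres of `f`, so a target has the same image as the source, whose position
    -- over `x₁` is known.
    · rw [if_neg hb, ← src_tgt, F.lsrc b i hA, hom_sub]

variable (κ : KanFilling f)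

/-- The label of a frame. -/
def label : X := κ.fill o F.box

theorem map_label : f F.x₁ = f (F.label κ) := (κ.map_fill o F.box).symm

theorem sub_label_pt {i : Bool} (hi : i = true → F.d ≠ F.a) :
    sub (F.label κ) F.d i = F.pt i := by
  have h : IsFace F.box.A F.box.a o F.d i := by
    refine ⟨Finset.mem_insert_self _ _, fun e => ?_⟩
    have e1 : F.d = F.a := e.1
    exact hi (e.2.trans (F.hdo e1)) e1
  exact (κ.sub_fill o F.box F.d i h).trans (if_pos rfl)

theorem sub_label_false : sub (F.label κ) F.d false = F.x₁ := F.sub_label_pt κ (by simp)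

theorem ne_d {b : 𝔸} (hb : b ∈ F.A) : b ≠ F.d := fun e => F.hd (e ▸ hb)

theorem sub_label {b : 𝔸} {i : Bool} (hb : IsFace F.A F.a o b i) :
    sub (F.label κ) b i = tgt f (F.z b i) :=
  (κ.sub_fill o F.box b i ⟨Finset.mem_insert_of_mem hb.1, hb.2⟩).trans (if_neg (F.ne_d hb.1))

/-- `F'` is the result of applying the operation `θ` to `F`. -/
structure Act (θ : Op 𝔸) (F F' : Frame f o) : Prop where
  okd : θ.Ok F.d
  okA : ∀ b ∈ F.A, θ.Ok b
  d : F'.d = θ.nm • F.d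
  a : F'.a = θ.nm • F.a
  A : F'.A = θ.nm • F.A
  z : ∀ b i, IsFace F.A F.a o b i → F'.z (θ.nm • b) i = θ.act (F.z b i)
  x₁ : F'.x₁ = θ.act F.x₁
  x₂ : F'.x₂ = θ.act F.x₂

variable {κ} in
-- Here the uniformity of the Kan filling of `f` enters: the open box in `X` attached to the
-- transformed frame is the transformed open box.
theorem label_act {θ : Op 𝔸} {F F' : Frame f o} (h : Act θ F F') :
    F'.label κ = θ.act (F.label κ) := by
  have hB : ∀ b ∈ F.box.A, θ.Ok b := fun b hb => by
    rcases Finset.mem_insert.1 hb with rfl | hb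
    · exact h.okd
    · exact h.okA b hb
  refine κ.fill_eq_act θ (B := F.box) (C := F'.box) hB ?_ h.a ?_ ?_
  · change insert F'.d F'.A = θ.nm • insert F.d F.A
    rw [Asm.smul_insert, h.d, h.A]
  · intro b i hf hf'
    change (if θ.nm • b = F'.d then F'.pt i else tgt f (F'.z (θ.nm • b) i)) =
      θ.act (if b = F.d then F.pt i else tgt f (F.z b i))
    rcases F.face_cases hf with ⟨rfl, -⟩ | ⟨hb, hA⟩
    · rw [if_pos h.d.symm, if_pos rfl]
      cases i
      · exact h.x₁
      · exact h.x₂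
    · rw [if_neg (by rwa [h.d, smul_left_cancel_iff]), if_neg hb, h.z b i hA, θ.hom_act]
  · change f F'.x₁ = θ.act (f F.x₁)
    rw [h.x₁, θ.hom_act]

/-- A closed frame, completed by its label. -/
def closed (F : Frame f true) (h : F.a = F.d) : Asm f :=
  have hf : ∀ b ∈ F.A, ∀ i, IsFace F.A F.a true b i := fun _ hb _ =>
    isFace_of_ne hb (h ▸ F.ne_d hb)
  { d := F.d
    A := F.A
    hd := F.hd
    z := F.z
    x := F.x₁
    s := F.label κ
    pre := fun b hb i => F.pre b i (hf b hb i)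
    fresh := fun b hb i => F.fresh b i (hf b hb i)
    adj := fun b hb i b' hb' i' => F.adj b i (hf b hb i) b' i' (hf b' hb' i')
    fx := F.fx₁
    s0 := F.sub_label_false κ
    fs := F.map_label κ
    lsrc := fun b hb i => F.lsrc b i (hf b hb i)
    ltgt := fun b hb i => (F.sub_label κ (hf b hb i)).symm }

variable {κ} in
theorem closed_act {θ : Op 𝔸} {F F' : Frame f true} (h : Act θ F F') (hF : F.a = F.d)
    (hF' : F'.a = F'.d) : Asm.Act θ (F.closed κ hF) (F'.closed κ hF') :=
  ⟨h.okd, h.okA, h.d, h.A, fun b hb i => h.z b i (isFace_of_ne hb (hF ▸ F.ne_d hb)), h.x₁,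
    label_act h⟩

/-! ### The missing face of an open frame and the resulting closed family -/

section Open

variable (h : F.a ∈ F.A)
include h

theorem isFace_erase {b : 𝔸} (hb : b ∈ F.A.erase F.a) (i : Bool) : IsFace F.A F.a o b i :=
  isFace_of_ne (Finset.mem_of_mem_erase hb) (Finset.ne_of_mem_erase hb)

/-- The missing face of an open frame. -/
def missing : Asm f where
  d := F.d
  A := F.A.erase F.a
  hd := fun e => F.hd (Finset.mem_of_mem_erase e)
  z b i := sub (F.z b i) F.a o
  x := sub F.x₁ F.a o
  s := sub (F.label κ) F.a o
  pre b hb i := (F.pre b i (F.isFace_erase h hb i)).sub (F.ne_d h) o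
  fresh b hb i := fresh_sub_of_fresh (F.fresh b i (F.isFace_erase h hb i))
    (Finset.ne_of_mem_erase hb) o
  adj b hb i b' hb' i' hbb := by
    rw [sub_comm _ _ _ _ _ (Finset.ne_of_mem_erase hb').symm,
      F.adj b i (F.isFace_erase h hb i) b' i' (F.isFace_erase h hb' i') hbb,
      sub_comm _ _ _ _ _ (Finset.ne_of_mem_erase hb)]
  fx := fresh_sub_of_fresh F.fx₁ (F.ne_d h).symm o
  s0 := by rw [sub_comm _ _ _ _ _ (F.ne_d h), sub_label_false]
  fs := by rw [hom_sub, hom_sub, ← map_label]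
  lsrc b hb i := by
    rw [hom_sub, F.lsrc b i (F.isFace_erase h hb i),
      sub_comm _ _ _ _ _ (Finset.ne_of_mem_erase hb)]
  ltgt b hb i := by
    rw [hom_sub, ← F.sub_label κ (F.isFace_erase h hb i),
      sub_comm _ _ _ _ _ (Finset.ne_of_mem_erase hb)]

/-- All ingredients of the missing face have had `(a := o)` substituted, and `a` has been removed
from its set of names. -/
theorem fresh_missing : Fresh F.a (F.missing κ h).nf :=
  Asm.fresh_nf _ (F.ne_d h) (Finset.notMem_erase _ _) (fun _ _ _ => fresh_sub _ _ _)
    (fresh_sub _ _ _) (fresh_sub _ _ _)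

/-- The faces of an open frame together with the missing face. -/
def allFaces (b : 𝔸) (i : Bool) : K (diag f) :=
  if b = F.a ∧ i = o then (F.missing κ h).nf else F.z b i

/-- Splits each condition on the completed family into one about the missing face and one about the
given faces. Compatibility of two faces uses it twice. -/
theorem allFaces_cases {p : 𝔸 → Bool → K (diag f) → Prop} (h0 : p F.a o (F.missing κ h).nf)
    (h1 : ∀ b i, IsFace F.A F.a o b i → p b i (F.z b i)) (b : 𝔸) (hb : b ∈ F.A) (i : Bool) :
    p b i (F.allFaces κ h b i) := by
  unfold allFaces
  by_cases e : b = F.a ∧ i = o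
  · rw [if_pos e]; obtain ⟨rfl, rfl⟩ := e; exact h0
  · rw [if_neg e]; exact h1 b i ⟨hb, e⟩

theorem sub_missing {b : 𝔸} {i : Bool} (hb : IsFace F.A F.a o b i) (hba : b ≠ F.a) :
    sub (F.missing κ h).nf b i = sub (F.z b i) F.a o :=
  (F.missing κ h).sub_nf (Finset.mem_erase.2 ⟨hba, hb.1⟩) i

/-- An open frame, completed by its label and its missing face. -/
def filled : Asm f where
  d := F.d
  A := F.A
  hd := F.hd
  z := F.allFaces κ h
  x := F.x₁
  s := F.label κ
  pre := F.allFaces_cases κ h (p := fun _ _ z => PreNF f F.d z) (F.missing κ h).preNF_nf F.pre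
  fresh := F.allFaces_cases κ h (p := fun b _ z => Fresh b z) (F.fresh_missing κ h) F.fresh
  adj := F.allFaces_cases κ h (p := fun b i z => ∀ b' ∈ F.A, ∀ i', b ≠ b' →
      sub z b' i' = sub (F.allFaces κ h b' i') b i)
    (F.allFaces_cases κ h (p := fun b' i' z' => F.a ≠ b' →
        sub (F.missing κ h).nf b' i' = sub z' F.a o) (fun e => absurd rfl e)
      fun _ _ hb' e => F.sub_missing κ h hb' e.symm)
    fun b i hb => F.allFaces_cases κ h (p := fun b' i' z' => b ≠ b' →
        sub (F.z b i) b' i' = sub z' b i) (fun e => (F.sub_missing κ h hb e).symm)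
      fun b' i' hb' => F.adj b i hb b' i' hb'
  fx := F.fx₁
  s0 := F.sub_label_false κ
  fs := F.map_label κ
  lsrc := F.allFaces_cases κ h (p := fun b i z => src f z = sub F.x₁ b i)
    (F.missing κ h).src_nf F.lsrc
  ltgt := F.allFaces_cases κ h (p := fun b i z => tgt f z = sub (F.label κ) b i)
    (F.missing κ h).tgt_nf fun _ _ hb => (F.sub_label κ hb).symm

theorem filled_z {b : 𝔸} {i : Bool} (hb : IsFace F.A F.a o b i) :
    (F.filled κ h).z b i = F.z b i := if_neg hb.2

end Open

variable {κ} in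
theorem missing_act {θ : Op 𝔸} {F F' : Frame f o} (h : Act θ F F') (hF : F.a ∈ F.A)
    (hF' : F'.a ∈ F'.A) : Asm.Act θ (F.missing κ hF) (F'.missing κ hF') where
  okd := h.okd
  okA b hb := h.okA b (Finset.mem_of_mem_erase hb)
  d := h.d
  A := by
    change F'.A.erase F'.a = θ.nm • F.A.erase F.a
    ext b
    rw [h.A, h.a, ← Finset.inv_smul_mem_iff, Finset.mem_erase, Finset.mem_erase,
      Finset.inv_smul_mem_iff, ne_eq, ne_eq, inv_smul_eq_iff]
  z b hb i := by
    change sub (F'.z _ i) F'.a o = θ.act (sub (F.z b i) F.a o)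
    rw [θ.act_sub _ (h.okA _ hF), h.a, h.z b i (F.isFace_erase hF hb i)]
  x := by
    change sub F'.x₁ F'.a o = θ.act (sub F.x₁ F.a o)
    rw [θ.act_sub _ (h.okA _ hF), h.a, h.x₁]
  s := by
    change sub (F'.label κ) F'.a o = θ.act (sub (F.label κ) F.a o)
    rw [θ.act_sub _ (h.okA _ hF), h.a, label_act h]

variable {κ} in
theorem filled_act {θ : Op 𝔸} {F F' : Frame f o} (h : Act θ F F') (hF : F.a ∈ F.A)
    (hF' : F'.a ∈ F'.A) : Asm.Act θ (F.filled κ hF) (F'.filled κ hF') where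
  okd := h.okd
  okA := h.okA
  d := h.d
  A := h.A
  z := by
    have h0 : F'.allFaces κ hF' F'.a o = (F'.missing κ hF').nf := if_pos ⟨rfl, rfl⟩
    refine F.allFaces_cases κ hF (p := fun b i z => F'.allFaces κ hF' (θ.nm • b) i = θ.act z)
      ?_ fun b i hb => ?_
    · rw [← h.a, h0, Asm.nf_act (missing_act h hF hF')]
    · rw [← h.z b i hb]
      -- The renaming is injective, so a given face is not carried to the missing one.
      refine if_neg fun e => hb.2 ⟨?_, e.2⟩
      rw [h.a, smul_left_cancel_iff] at e
      exact e.1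
  x := h.x₁
  s := label_act h

end Frame

end

section

variable [Infinite 𝔸] {X Y : Sub01 𝔸} {f : X ⟶ Y}

/-- A function of a fresh name `d`, equivariant and with values for which `d` is fresh, does not
depend on `d`. -/
theorem eq_of_fresh_choice {T : Type u} [Nominal 𝔸 T] {Dir : 𝔸 → Prop} (F : ∀ d, Dir d → T)
    (hf : ∀ d h, Fresh d (F d h)) (hs : ∀ d e h h', F e h' = swp d e • F d h)
    (hex : ∀ S : Finset 𝔸, ∃ d, d ∉ S ∧ Dir d) {d e : 𝔸} (h : Dir d) (h' : Dir e) :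
    F d h = F e h' := by
  obtain ⟨S, hS⟩ := Nominal.exists_supp (𝔸 := 𝔸) (F d h)
  obtain ⟨S', hS'⟩ := Nominal.exists_supp (𝔸 := 𝔸) (F e h')
  obtain ⟨c, hc, hcD⟩ := hex (S ∪ S')
  simp only [Finset.mem_union, not_or] at hc
  -- The name `c` is fresh for both values. The swap `(d c)` fixes the value at `d` and carries it
  -- to the value at `c`; in the same way the value at `e` equals the value at `c`.
  rw [← swp_smul_of_fresh (hf d h) ⟨S, hS, hc.1⟩, ← swp_smul_of_fresh (hf e h') ⟨S', hS', hc.2⟩,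
    ← hs d c h hcD, ← hs e c h' hcD]

theorem exists_fresh_family {T : Type u} [Nominal 𝔸 T] (A S : Finset 𝔸) (u : 𝔸 → Bool → T) :
    ∃ d, d ∉ S ∧ ∀ b ∈ A, ∀ i, Fresh d (u b i) := by
  choose s hs using fun b i => Nominal.exists_supp (𝔸 := 𝔸) (u b i)
  obtain ⟨d, hd⟩ := Infinite.exists_notMem_finset (S ∪ A.biUnion fun b => s b false ∪ s b true)
  simp only [Finset.mem_union, Finset.mem_biUnion, not_or, not_exists, not_and] at hd
  refine ⟨d, hd.1, fun b hb i => ⟨s b i, hs b i, ?_⟩⟩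
  cases i
  · exact (hd.2 b hb).1
  · exact (hd.2 b hb).2

/-! ### Fillers of closed boxes over the source map `P_Y X ⟶ X` -/

/-- A closed box over the source map `P_Y X ⟶ X`. -/
structure Closed (f : X ⟶ Y) where
  A : Finset 𝔸
  u : 𝔸 → Bool → pathObj f
  x : X
  fresh : ∀ b ∈ A, ∀ i, Fresh b (u b i)
  adj : ∀ b ∈ A, ∀ i, ∀ b' ∈ A, ∀ i', b ≠ b' → sub (u b i) b' i' = sub (u b' i') b i
  lies : ∀ b ∈ A, ∀ i, pathSrc f (u b i) = sub x b i

namespace Closed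

variable (T : Closed f)

/-- The names that are fresh for a closed box. -/
structure Dir (d : 𝔸) : Prop where
  hA : d ∉ T.A
  hu : ∀ b ∈ T.A, ∀ i, Fresh d (T.u b i)
  hx : Fresh d T.x

theorem exists_dir (S : Finset 𝔸) : ∃ d, d ∉ S ∧ T.Dir d := by
  obtain ⟨S', hS'⟩ := Nominal.exists_supp (𝔸 := 𝔸) T.x
  obtain ⟨d, hd, hu⟩ := exists_fresh_family T.A (S ∪ S' ∪ T.A) T.u
  simp only [Finset.mem_union, not_or] at hd
  exact ⟨d, hd.1.1, hd.2, hu, S', hS', hd.1.2⟩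

variable {T} in
theorem Dir.ne {d : 𝔸} (h : T.Dir d) {b : 𝔸} (hb : b ∈ T.A) : b ≠ d := fun e => h.hA (e ▸ hb)

/-- The associated frame in a fresh direction. -/
def frame (d : 𝔸) (h : T.Dir d) : Frame f true where
  d := d
  a := d
  A := T.A
  hd := h.hA
  ha := Finset.mem_insert_self _ _
  hdo _ := rfl
  z b i := pnf (T.u b i) d
  x₁ := T.x
  x₂ := T.x
  hx := rfl
  fx₁ := h.hx
  fx₂ := h.hx
  pre b i hb := preNF_pnf (h.hu b hb.1 i)
  fresh b i hb := fresh_pnf (h.hu b hb.1 i) (T.fresh b hb.1 i) (h.ne hb.1)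
  adj b i hb b' i' hb' hbb := by
    rw [← pnf_sub (h.hu b hb.1 i) (h.ne hb'.1), ← pnf_sub (h.hu b' hb'.1 i') (h.ne hb.1),
      T.adj b hb.1 i b' hb'.1 i' hbb]
  lsrc b i hb := by rw [src_pnf (h.hu b hb.1 i), T.lies b hb.1 i]
  ltgt _ _ _ e := absurd rfl e

variable (κ : KanFilling f)

/-- The filler computed in the fresh direction `d`. -/
def fillAt (d : 𝔸) (h : T.Dir d) : pathObj f := ((T.frame d h).closed κ rfl).path

/-- `T'` is the result of applying the operation `θ` to `T`. -/
structure Act (θ : Op 𝔸) (T T' : Closed f) : Prop where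
  okA : ∀ b ∈ T.A, θ.Ok b
  A : T'.A = θ.nm • T.A
  u : ∀ b ∈ T.A, ∀ i, T'.u (θ.nm • b) i = θ.act (T.u b i)
  x : T'.x = θ.act T.x

variable {T} {κ}

theorem Act.dir {θ : Op 𝔸} {T' : Closed f} (h : Act θ T T') {d : 𝔸} (hd : T.Dir d) (ok : θ.Ok d) :
    T'.Dir (θ.nm • d) where
  hA := by rw [h.A, Finset.smul_mem_smul_finset_iff]; exact hd.hA
  hu := by
    rw [h.A]
    exact θ.forall_mem_smul fun b hb i => by rw [h.u b hb]; exact θ.fresh_act ok (hd.hu b hb i)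
  hx := by rw [h.x]; exact θ.fresh_act ok hd.hx

theorem fillAt_act {θ : Op 𝔸} {T' : Closed f} (h : Act θ T T') {d d' : 𝔸} (hd : T.Dir d)
    (ok : θ.Ok d) (e : d' = θ.nm • d) (hd' : T'.Dir d') :
    T'.fillAt κ d' hd' = θ.act (T.fillAt κ d hd) :=
  Asm.path_act (Frame.closed_act ⟨ok, h.okA, e, e, h.A, fun b i hb => by
    change pnf (T'.u _ i) d' = θ.act (pnf (T.u b i) d)
    rw [h.u b hb.1, e, pnf_act (hd.hu b hb.1 i) θ ok], h.x, h.x⟩ rfl rfl)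

/-- A swap of two names fresh for the closed box leaves its data on `A` unchanged; this is the input
for independence of the direction. -/
theorem act_swp {d e : 𝔸} (h : T.Dir d) (h' : T.Dir e) : Act (.perm (swp d e)) T T where
  okA _ _ := trivial
  A := by
    have e1 : ∀ b ∈ T.A, swp d e • b = b := fun b hb => swp_of_ne (h.ne hb) (h'.ne hb)
    ext b
    change b ∈ T.A ↔ b ∈ swp d e • T.A
    rw [Finset.mem_smul_finset]
    exact ⟨fun hb => ⟨b, hb, e1 b hb⟩, fun ⟨c, hc, hcb⟩ => hcb ▸ (e1 c hc).symm ▸ hc⟩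
  u b hb i := by
    change T.u (swp d e • b) i = swp d e • T.u b i
    rw [swp_of_ne (h.ne hb) (h'.ne hb), swp_smul_of_fresh (h.hu b hb i) (h'.hu b hb i)]
  x := (swp_smul_of_fresh h.hx h'.hx).symm

variable (T κ) in
/-- The filler of a closed box. -/
def fill : pathObj f := T.fillAt κ _ (T.exists_dir ∅).choose_spec.2

theorem fill_eq {d : 𝔸} (h : T.Dir d) : T.fill κ = T.fillAt κ d h :=
  eq_of_fresh_choice (fun d h => T.fillAt κ d h) (fun d h => ((T.frame d h).closed κ rfl).fresh_path)
    (fun d e h h' => fillAt_act (act_swp h h') (θ := .perm (swp d e)) h trivial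
      (swp_left d e).symm h') T.exists_dir _ h

variable (T κ) in
-- The freedom to avoid `c` is needed for `(c := i)` to act on the direction as a renaming.
theorem exists_fill_eq (c : 𝔸) : ∃ d h, d ≠ c ∧ T.fill κ = T.fillAt κ d h := by
  obtain ⟨d, hd, h⟩ := T.exists_dir {c}
  exact ⟨d, h, by simpa using hd, fill_eq h⟩

theorem sub_fill {b : 𝔸} (hb : b ∈ T.A) (i : Bool) : sub (T.fill κ) b i = T.u b i := by
  obtain ⟨d, h, -, e⟩ := T.exists_fill_eq κ b
  rw [e]
  exact Asm.sub_path _ hb i (sub_pnf (h.hu b hb i)).symm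

theorem pathSrc_fill : pathSrc f (T.fill κ) = T.x := by
  obtain ⟨d, hd, h⟩ := T.exists_dir ∅
  rw [fill_eq h]
  exact Asm.pathSrc_path _

theorem fill_act {θ : Op 𝔸} {T' : Closed f} (h : Act θ T T') : T'.fill κ = θ.act (T.fill κ) := by
  obtain ⟨d, hd, e, ok⟩ : ∃ d, ∃ hd : T.Dir d, T.fill κ = T.fillAt κ d hd ∧ θ.Ok d := by
    cases θ with
    | perm π =>
      obtain ⟨d, -, h⟩ := T.exists_dir ∅
      exact ⟨d, h, fill_eq h, trivial⟩
    | sb c i =>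
      obtain ⟨d, h, hc, e⟩ := T.exists_fill_eq κ c
      exact ⟨d, h, e, hc⟩
  rw [e, fill_eq (h.dir hd ok), fillAt_act h hd ok rfl]

end Closed

/-! ### Kan filling operators on `P_Y X ⟶ X ×_Y X` -/

namespace PathBox

variable {o : Bool} (B : Box o (pathProj f))

theorem pathSrc_u {b i} (h : IsFace B.A B.a o b i) :
    pathSrc f (B.u b i h) = sub (fst f B.y) b i := congrArg (fst f) (B.lies b i h)

theorem pathTgt_u {b i} (h : IsFace B.A B.a o b i) :
    pathTgt f (B.u b i h) = sub (snd f B.y) b i := congrArg (snd f) (B.lies b i h)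

/-- The pre-normal forms of the faces. -/
def faces (d : 𝔸) (b : 𝔸) (i : Bool) : K (diag f) :=
  if h : IsFace B.A B.a o b i then pnf (B.u b i h) d else lam (diag f) (fst f B.y)

theorem faces_eq (d : 𝔸) {b : 𝔸} {i : Bool} (h : IsFace B.A B.a o b i) :
    faces B d b i = pnf (B.u b i h) d := dif_pos h

section Frame

variable {B} {d : 𝔸} (h : Fresh d B)
include h

theorem ne {b : 𝔸} (hb : b ∈ B.A) : b ≠ d := fun e => Box.notMem_of_fresh h (e ▸ hb)

/-- The associated frame in a fresh direction. -/
def frame : Frame f o where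
  d := d
  a := B.a
  A := B.A
  hd := Box.notMem_of_fresh h
  ha := Finset.mem_insert_of_mem B.mem
  hdo e := absurd e.symm (ne h B.mem)
  z := faces B d
  x₁ := fst f B.y
  x₂ := snd f B.y
  hx := B.y.2
  fx₁ := (Box.fresh_y h).map (hom_smul (fst f))
  fx₂ := (Box.fresh_y h).map (hom_smul (snd f))
  pre b i hb := by rw [faces_eq B d hb]; exact preNF_pnf (Box.fresh_u h b i hb)
  fresh b i hb := by
    rw [faces_eq B d hb]
    exact fresh_pnf (Box.fresh_u h b i hb) (B.fresh b i hb) (ne h hb.1)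
  adj b i hb b' i' hb' hbb := by
    rw [faces_eq B d hb, faces_eq B d hb', ← pnf_sub (Box.fresh_u h b i hb) (ne h hb'.1),
      ← pnf_sub (Box.fresh_u h b' i' hb') (ne h hb.1), B.adj b i hb b' i' hb' hbb]
  lsrc b i hb := by
    rw [faces_eq B d hb, src_pnf (Box.fresh_u h b i hb), pathSrc_u]
  ltgt b i hb _ := by
    rw [faces_eq B d hb, tgt_pnf_true (Box.fresh_u h b i hb), pathTgt_u]

variable (κ : KanFilling f)

/-- The filler computed in the fresh direction `d`. -/
def fillAt : pathObj f := ((frame h).filled κ B.mem).path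

theorem frame_act (θ : Op 𝔸) (hB : ∀ b ∈ B.A, θ.Ok b) (ok : θ.Ok d) {B' : Box o (pathProj f)}
    (e : B' = B.act θ hB) {d' : 𝔸} (ed : d' = θ.nm • d) (h' : Fresh d' B') :
    Frame.Act θ (frame h) (frame h') := by
  subst e ed
  refine ⟨ok, hB, rfl, rfl, rfl, fun b i hb => ?_, θ.hom_act (fst f) B.y, θ.hom_act (snd f) B.y⟩
  have hb' : IsFace (B.act θ hB).A (B.act θ hB).a o (θ.nm • b) i := (Box.isFace_smul' _).2 hb
  change faces (B.act θ hB) (θ.nm • d) (θ.nm • b) i = θ.act (faces B d b i)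
  rw [faces_eq _ _ hb', faces_eq B d hb, Box.act_u θ B hB b i hb, pnf_act (Box.fresh_u h b i hb) θ ok]

theorem fillAt_act (θ : Op 𝔸) (hB : ∀ b ∈ B.A, θ.Ok b) (ok : θ.Ok d) {B' : Box o (pathProj f)}
    (e : B' = B.act θ hB) {d' : 𝔸} (ed : d' = θ.nm • d) (h' : Fresh d' B') :
    fillAt h' κ = θ.act (fillAt h κ) :=
  Asm.path_act (Frame.filled_act (frame_act h θ hB ok e ed h') B.mem B'.mem)

theorem pathProj_fillAt : pathProj f (fillAt h κ) = B.y := by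
  refine Subtype.ext (Prod.ext (Asm.pathSrc_path _) ?_)
  refine (Asm.pathTgt_path _).trans ?_
  -- The open direction of `B` lies in `B.A` while `d` does not, so `(d, 1)` is a prescribed face of
  -- the box in `X` and the label ends at the second endpoint.
  exact (frame h).sub_label_pt κ (i := true) fun _ e => ne h B.mem e.symm

theorem sub_fillAt {b i} (hb : IsFace B.A B.a o b i) : sub (fillAt h κ) b i = B.u b i hb := by
  refine Asm.sub_path _ hb.1 i ?_
  rw [Frame.filled_z (frame h) κ B.mem hb]
  exact ((congrArg (sub · d true) (faces_eq B d hb)).trans (sub_pnf (Box.fresh_u h b i hb))).symm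

end Frame

variable (κ : KanFilling f)

theorem exists_dir (S : Finset 𝔸) : ∃ d, d ∉ S ∧ Fresh d B := exists_fresh S B

/-- The filler of an open box. -/
def fill : pathObj f := fillAt (exists_dir B ∅).choose_spec.2 κ

theorem fill_eq {d : 𝔸} (h : Fresh d B) : fill B κ = fillAt h κ :=
  eq_of_fresh_choice (fun _ h => fillAt (B := B) h κ) (fun _ _ => Asm.fresh_path _)
    (fun d e h h' => fillAt_act h κ (.perm (swp d e)) (fun _ _ => trivial) trivial
      (swp_smul_of_fresh h h').symm (swp_left d e).symm h') (exists_dir B) _ h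

end PathBox

/-- Each law is checked in a single fresh direction. For uniformity under `(c := i)` this direction
is chosen different from `c`. -/
theorem kanFibration_pathProj (hf : KanFibration f) : KanFibration (pathProj f) := by
  obtain ⟨κ⟩ := hf
  refine ⟨KanFilling.ofAct (fun o B => PathBox.fill B κ) (fun o B b i h => ?_) (fun o B => ?_)
    fun o θ B hB => ?_⟩
  · obtain ⟨d, -, hd⟩ := PathBox.exists_dir B ∅
    rw [PathBox.fill_eq B κ hd, PathBox.sub_fillAt hd κ h]
  · obtain ⟨d, -, hd⟩ := PathBox.exists_dir B ∅
    rw [PathBox.fill_eq B κ hd, PathBox.pathProj_fillAt hd κ]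
  · obtain ⟨d, hd, ok⟩ : ∃ d, Fresh d B ∧ θ.Ok d := by
      cases θ with
      | perm π =>
        obtain ⟨d, -, h⟩ := PathBox.exists_dir B ∅
        exact ⟨d, h, trivial⟩
      | sb c i =>
        obtain ⟨d, hc, h⟩ := PathBox.exists_dir B {c}
        exact ⟨d, h, show d ≠ c by simpa using hc⟩
    rw [PathBox.fill_eq B κ hd, PathBox.fill_eq _ κ (Box.fresh_act hB ok hd),
      PathBox.fillAt_act hd κ θ hB ok rfl rfl]

end

section

variable [Infinite 𝔸] {X Y : Sub01 𝔸} {f : X ⟶ Y}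

/-! ### The coalgebra structure on `r` -/

namespace Closed

/-- The action of an operation on a closed box. -/
def act (θ : Op 𝔸) (T : Closed f) (hT : ∀ b ∈ T.A, θ.Ok b) : Closed f where
  A := θ.nm • T.A
  u b i := θ.act (T.u (θ.nm⁻¹ • b) i)
  x := θ.act T.x
  fresh := θ.forall_mem_smul fun b hb i => by
    rw [inv_smul_smul]; exact θ.fresh_act (hT b hb) (T.fresh b hb i)
  adj := θ.forall_mem_smul fun b hb i => θ.forall_mem_smul fun b' hb' i' hbb => by
    rw [inv_smul_smul, inv_smul_smul, ← θ.act_sub _ (hT b hb), ← θ.act_sub _ (hT b' hb'),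
      T.adj b hb i b' hb' i' (fun e => hbb (by rw [e]))]
  lies := θ.forall_mem_smul fun b hb i => by
    rw [inv_smul_smul, θ.hom_act, T.lies b hb, θ.act_sub _ (hT b hb)]

theorem act_u (θ : Op 𝔸) (T : Closed f) (hT : ∀ b ∈ T.A, θ.Ok b) (b : 𝔸) (i : Bool) :
    (T.act θ hT).u (θ.nm • b) i = θ.act (T.u b i) :=
  congrArg (fun c => θ.act (T.u c i)) (inv_smul_smul _ b)

theorem fill_act_eq (κ : KanFilling f) (θ : Op 𝔸) (T : Closed f) (hT : ∀ b ∈ T.A, θ.Ok b) :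
    (T.act θ hT).fill κ = θ.act (T.fill κ) :=
  fill_act ⟨hT, rfl, fun b _ i => T.act_u θ hT b i, rfl⟩

/-- The values `u b i` with `b ∉ A` are irrelevant, so closed boxes with the same content need not
be equal as structures. They are related by the identity permutation, and uniformity of the filler
applies to it. -/
theorem fill_congr (κ : KanFilling f) {T T' : Closed f} (hA : T'.A = T.A) (hx : T'.x = T.x)
    (hu : ∀ b ∈ T.A, ∀ i, T'.u b i = T.u b i) : T'.fill κ = T.fill κ := by
  have := fill_act (κ := κ) (θ := .perm 1) (T := T) (T' := T')
    ⟨fun _ _ => trivial, by rw [hA]; exact (one_smul _ _).symm,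
      fun b hb i => by simpa [Op.nm, Op.act] using hu b hb i, by rw [hx]; exact (one_smul _ _).symm⟩
  rw [this]
  exact one_smul _ _

end Closed

/-- A closed box `T` and an open box `C` over `P_Y X` used to contract the pre-normal form given by
the box `B` in direction `a`: the closed box consists of the constant path, of the normal form
determined by `B`, and of the projections of the faces of `C`. -/
structure Contracts (a : 𝔸) (B : Box true (rho (diag f))) (C : Box true (rho (pathRefl f)))
    (T : Closed f) : Prop where
  Ba : B.a = a
  B1 : Fresh a (fst f B.y)
  B0 : ∀ h, B.u a false h = lam (diag f) (fst f B.y)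
  CA : C.A = B.A
  Ca : C.a = a
  C0 : ∀ h, C.u a false h = lam (pathRefl f) (fst f B.y)
  TA : T.A = B.A
  Tx : T.x = fst f B.y
  T0 : T.u a false = pathRefl f (fst f B.y)
  T1 : (T.u a true).1 = sub (kfill (diag f) true B) a true
  Tu : ∀ b i h, b ≠ a → T.u b i = rho (pathRefl f) (C.u b i h)

/-- The contractions of pre-normal forms in direction `a`. -/
inductive Contr (κ : KanFilling f) (a : 𝔸) : K (diag f) → K (pathRefl f) → Prop
  | base (x : X) (h : Fresh a x) : Contr κ a (lam (diag f) x) (lam (pathRefl f) x)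
  | box (B : Box true (rho (diag f))) (C : Box true (rho (pathRefl f))) (T : Closed f)
      (h : Contracts a B C T) (hy : C.y = T.fill κ)
      (hu : ∀ b i hB hC, b ≠ a → Contr κ a (B.u b i hB) (C.u b i hC)) :
      Contr κ a (kfill (diag f) true B) (kfill (pathRefl f) true C)

theorem eq_false_of_isFace {A : Finset 𝔸} {a : 𝔸} {i : Bool} (h : IsFace A a true a i) :
    i = false := by simpa using h.2

namespace Contracts

variable {a : 𝔸} {B : Box true (rho (diag f))} {C : Box true (rho (pathRefl f))} {T : Closed f}

theorem isFace (h : Contracts a B C T) {b : 𝔸} {i : Bool} (hB : IsFace B.A B.a true b i) :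
    IsFace C.A C.a true b i := by
  rw [h.CA, h.Ca, ← h.Ba]; exact hB

theorem act (h : Contracts a B C T) {θ : Op 𝔸} (hB : ∀ b ∈ B.A, θ.Ok b) (hC : ∀ b ∈ C.A, θ.Ok b)
    (hT : ∀ b ∈ T.A, θ.Ok b) :
    Contracts (θ.nm • a) (B.act θ hB) (C.act θ hC) (T.act θ hT) := by
  have e : fst f (B.act θ hB).y = θ.act (fst f B.y) := θ.hom_act (fst f) B.y
  have ha : a ∈ B.A := h.Ba ▸ B.mem
  have hfB : IsFace B.A B.a true a false := h.Ba ▸ isFace_false B.mem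
  have eB : kfill (diag f) true (B.act θ hB) = θ.act (kfill (diag f) true B) :=
    (kanRho (diag f)).fill_act θ B hB
  refine ⟨congrArg (θ.nm • ·) h.Ba, ?_, fun h' => ?_, congrArg (θ.nm • ·) h.CA,
    congrArg (θ.nm • ·) h.Ca, fun h' => ?_, congrArg (θ.nm • ·) h.TA, ?_, ?_, ?_, ?_⟩
  · rw [e]; exact θ.fresh_act (hB a ha) h.B1
  · rw [Box.act_u θ B hB a false hfB, h.B0, e, θ.hom_act]
  · rw [Box.act_u θ C hC a false (h.isFace hfB), h.C0, e, θ.hom_act]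
  · rw [e]; exact congrArg θ.act h.Tx
  · rw [Closed.act_u, h.T0, e, θ.hom_act]
  · rw [Closed.act_u, eB, ← θ.act_sub _ (hB a ha), ← h.T1]
    exact θ.hom_act (pathIncl f) _
  · intro b i h' hb
    have := h.Tu (θ.nm⁻¹ • b) i ((Box.isFace_smul θ.nm).1 h') (by rwa [ne_eq, inv_smul_eq_iff])
    exact (congrArg θ.act this).trans (θ.hom_act _ _).symm

end Contracts

/-! ### Uniqueness, uniformity and endpoints of contractions -/

namespace Contr

variable {κ : KanFilling f} {a : 𝔸} {z : K (diag f)} {t : K (pathRefl f)}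

theorem preNF (h : Contr κ a z t) : PreNF f a z := by
  induction h with
  | base x h => exact .base x h
  | box B C T h hy hu ih =>
    exact .box B h.Ba h.B1 h.B0 fun b i hB hb => ih b i hB (h.isFace hB) hb

/-- Freeness of `K Δ` recovers `B` from `z`. The faces of `C` are then unique by induction; together
with `B` they determine the closed box on its names, hence its filler, which is the element over
which `C` lies. -/
theorem unique (h : Contr κ a z t) {t' : K (pathRefl f)} (h' : Contr κ a z t') : t = t' := by
  induction h generalizing t' with
  | base x h =>
    generalize hz : lam (diag f) x = z at h'
    cases h' with
    | base x' h' => rw [lam_injective hz]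
    | box B C T h hy hu => exact absurd hz (lam_ne_kfill x B)
  | box B C T h hy hu ih =>
    generalize hz : kfill (diag f) true B = z at h'
    cases h' with
    | base x' h' => exact absurd hz.symm (lam_ne_kfill x' B)
    | box B' C' T' h' hy' hu' =>
      obtain rfl := kfill_injective _ hz
      have hC : ∀ b i hb hb', C.u b i hb = C'.u b i hb' := fun b i hb hb' => by
        by_cases hba : b = a
        · subst hba
          obtain rfl : i = false := eq_false_of_isFace (h.Ca ▸ hb)
          rw [h.C0, h'.C0]
        · have hB : IsFace B.A B.a true b i := by
            rw [h.CA, h.Ca, ← h.Ba] at hb; exact hb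
          exact ih b i hB hb hba (hu' b i hB hb' hba)
      congr 1
      refine Box.ext' (h.CA.trans h'.CA.symm) (h.Ca.trans h'.Ca.symm) hC ?_
      rw [hy, hy']
      refine (Closed.fill_congr κ (h'.TA.trans h.TA.symm) (h'.Tx.trans h.Tx.symm)
        fun b hb i => ?_).symm
      by_cases hba : b = a
      · subst hba
        cases i
        · rw [h.T0, h'.T0]
        · exact Subtype.ext (h'.T1.trans h.T1.symm)
      · have hB : IsFace B.A B.a true b i := isFace_of_ne (h.TA ▸ hb) (h.Ba ▸ hba)
        rw [h.Tu b i (h.isFace hB) hba, h'.Tu b i (h'.isFace hB) hba,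
          hC b i (h.isFace hB) (h'.isFace hB)]

/-- Either `θ` transforms the box as a whole, or it is a substitution for one of the names `b` of
the box. In the second case `b ≠ a`, and both fillers restrict to their faces at `(b, i)`, which are
already related. -/
theorem act (h : Contr κ a z t) (θ : Op 𝔸) (ha : θ.Ok a) :
    Contr κ (θ.nm • a) (θ.act z) (θ.act t) := by
  induction h with
  | base x h => rw [← θ.hom_act, ← θ.hom_act]; exact .base _ (θ.fresh_act ha h)
  | box B C T h hy hu ih =>
    by_cases hB : ∀ b ∈ B.A, θ.Ok b
    · have hC : ∀ b ∈ C.A, θ.Ok b := h.CA ▸ hB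
      have hT : ∀ b ∈ T.A, θ.Ok b := h.TA ▸ hB
      have eB : kfill (diag f) true (B.act θ hB) = θ.act (kfill (diag f) true B) :=
        (kanRho (diag f)).fill_act θ B hB
      have eC : kfill (pathRefl f) true (C.act θ hC) = θ.act (kfill (pathRefl f) true C) :=
        (kanRho (pathRefl f)).fill_act θ C hC
      rw [← eB, ← eC]
      refine .box _ _ (T.act θ hT) (h.act hB hC hT) ?_ fun b i hb hc hba => ?_
      · rw [Closed.fill_act_eq, ← hy]; rfl
      · exact ih (θ.nm⁻¹ • b) i ((Box.isFace_smul θ.nm).1 hb) ((Box.isFace_smul θ.nm).1 hc)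
          (by rwa [ne_eq, inv_smul_eq_iff])
    · push Not at hB
      obtain ⟨b, hb, hbθ⟩ := hB
      cases θ with
      | perm π => exact absurd trivial hbθ
      | sb c i =>
        obtain rfl : b = c := not_not.1 hbθ
        have hba : b ≠ a := fun e => ha e.symm
        have hf : IsFace B.A B.a true b i := isFace_of_ne hb (h.Ba ▸ hba)
        simp only [Op.act, Op.nm, one_smul]
        rw [sub_kfill _ B b i hf, sub_kfill _ C b i (h.isFace hf)]
        exact hu b i hf (h.isFace hf) hba

theorem sub (h : Contr κ a z t) {c : 𝔸} (hc : c ≠ a) (i : Bool) :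
    Contr κ a (Sub01Set.sub z c i) (Sub01Set.sub t c i) := by
  have := h.act (.sb c i) hc.symm
  simpa only [Op.act, Op.nm, one_smul] using this

/-- A permutation fixing `a` and `z` carries `t` to a contraction of the same `z`, so by uniqueness
it fixes `t`. Thus `t` is supported by a support of `z` together with `a`. -/
theorem fresh (h : Contr κ a z t) {c : 𝔸} (hc : Fresh c z) (hca : c ≠ a) : Fresh c t := by
  obtain ⟨S, hS, hcS⟩ := hc
  refine ⟨insert a S, fun π hπ => ?_, by simp [hcS, hca]⟩
  have h1 := h.act (.perm π) trivial
  have ea : π • a = a := hπ (by simp)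
  have ez : π • z = z := hS π fun b hb => hπ (by
    rw [Finset.coe_insert]; exact Set.mem_insert_of_mem _ hb)
  simp only [Op.act, Op.nm, ea, ez] at h1
  exact h1.unique h

theorem sub_false (h : Contr κ a z t) :
    Sub01Set.sub t a false = lam (pathRefl f) (src f z) := by
  cases h with
  | base x h => rw [← hom_sub, sub_of_fresh _ _ _ h, src_lam]
  | box B C T h hy hu =>
    have hf : IsFace C.A C.a true a false := h.isFace (h.Ba ▸ isFace_false B.mem)
    rw [sub_kfill _ C _ _ hf, h.C0, src_kfill]

theorem mem_A {B : Box true (rho (diag f))} {C : Box true (rho (pathRefl f))} {T : Closed f}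
    (h : Contracts a B C T) : a ∈ T.A := by
  rw [h.TA, ← h.Ba]; exact B.mem

/-- For a box, `t` lies over the filler of a closed box whose face at `(a, 1)` is the normal form
itself. This becomes the counit law. -/
theorem rho_sub_true (h : Contr κ a z t) :
    (rho (pathRefl f) (Sub01Set.sub t a true)).1 = Sub01Set.sub z a true := by
  cases h with
  | base x h => rw [← hom_sub, ← hom_sub, sub_of_fresh _ _ _ h]; rfl
  | box B C T h hy hu =>
    rw [hom_sub, rho_kfill, hy, Closed.sub_fill (mem_A h), h.T1]

theorem pathSrc_rho (h : Contr κ a z t) : pathSrc f (rho (pathRefl f) t) = src f z := by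
  cases h with
  | base x h => rfl
  | box B C T h hy hu => rw [rho_kfill, hy, Closed.pathSrc_fill, h.Tx, src_kfill]

end Contr

/-- The faces of the two boxes contracting a given box. -/
structure ContrFaces (κ : KanFilling f) (B : Box true (rho (diag f)))
    (t : 𝔸 → Bool → K (pathRefl f)) : Prop where
  nf : PreNF f B.a (kfill (diag f) true B)
  fresh : Fresh B.a (fst f B.y)
  t0 : ∀ i, t B.a i = lam (pathRefl f) (fst f B.y)
  contr : ∀ b i h, b ≠ B.a → Contr κ B.a (B.u b i h) (t b i)

/-! ### Existence of contractions: the contracted faces form boxes -/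

namespace ContrFaces

variable {κ : KanFilling f} {B : Box true (rho (diag f))} {t : 𝔸 → Bool → K (pathRefl f)}
  (h : ContrFaces κ B t)
include h

theorem fresh_t {b i} (hb : IsFace B.A B.a true b i) : Fresh b (t b i) := by
  by_cases hba : b = B.a
  · rw [hba, h.t0]; exact h.fresh.map (hom_smul _)
  · exact (h.contr b i hb hba).fresh (B.fresh b i hb) hba

omit h in
theorem src_u {b i} (hb : IsFace B.A B.a true b i) : src f (B.u b i hb) = sub (fst f B.y) b i :=
  congrArg (fst f) (B.lies b i hb)

theorem sub_t_dir {b i} (hb : IsFace B.A B.a true b i) (hba : b ≠ B.a) :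
    sub (t b i) B.a false = sub (lam (pathRefl f) (fst f B.y)) b i := by
  rw [(h.contr b i hb hba).sub_false, src_u hb, hom_sub]

theorem adj_t {b i} (hb : IsFace B.A B.a true b i) {b' i'} (hb' : IsFace B.A B.a true b' i')
    (hbb : b ≠ b') : sub (t b i) b' i' = sub (t b' i') b i := by
  by_cases hba : b = B.a
  · subst hba
    obtain rfl := eq_false_of_isFace hb
    rw [h.t0, h.sub_t_dir hb' hbb.symm]
  · by_cases hba' : b' = B.a
    · subst hba'
      obtain rfl := eq_false_of_isFace hb'
      rw [h.t0, h.sub_t_dir hb hba]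
    -- Both sides are contractions of one element, because the faces of `B` are compatible.
    · refine ((h.contr b i hb hba).sub hba' i').unique ?_
      rw [B.adj b i hb b' i' hb' hbb]
      exact (h.contr b' i' hb' hba').sub hba i

/-- The normal form determined by the box. -/
def top : pathObj f := ⟨sub (kfill (diag f) true B) B.a true, _, _, h.nf, rfl⟩

/-- The faces of the closed box. -/
def closedFace (b : 𝔸) (i : Bool) : pathObj f :=
  if b = B.a ∧ i = true then h.top else rho (pathRefl f) (t b i)

theorem closedFace_of_isFace {b i} (hb : IsFace B.A B.a true b i) :
    h.closedFace b i = rho (pathRefl f) (t b i) := if_neg hb.2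

theorem closedFace_top : h.closedFace B.a true = h.top := if_pos ⟨rfl, rfl⟩

theorem closedFace_cases {p : 𝔸 → Bool → pathObj f → Prop} (h0 : p B.a true h.top)
    (h1 : ∀ b i, IsFace B.A B.a true b i → p b i (rho (pathRefl f) (t b i))) (b : 𝔸)
    (hb : b ∈ B.A) (i : Bool) : p b i (h.closedFace b i) := by
  unfold closedFace
  by_cases e : b = B.a ∧ i = true
  · rw [if_pos e]; obtain ⟨rfl, rfl⟩ := e; exact h0
  · rw [if_neg e]; exact h1 b i ⟨hb, e⟩

theorem sub_top {b i} (hb : IsFace B.A B.a true b i) (hba : b ≠ B.a) :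
    sub h.top b i = sub (rho (pathRefl f) (t b i)) B.a true := by
  refine Subtype.ext ?_
  rw [← hom_sub, (h.contr b i hb hba).rho_sub_true]
  change sub (sub (kfill (diag f) true B) B.a true) b i = _
  rw [sub_comm _ _ _ _ _ hba.symm, sub_kfill _ B b i hb]

/-- The closed box. -/
def closed : Closed f where
  A := B.A
  u := h.closedFace
  x := fst f B.y
  fresh := h.closedFace_cases (p := fun b _ w => Fresh b w) (fresh_of_val (fresh_sub _ _ _))
    fun _ _ hb => (h.fresh_t hb).map (hom_smul _)
  adj := h.closedFace_cases (p := fun b i w => ∀ b' ∈ B.A, ∀ i', b ≠ b' →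
      sub w b' i' = sub (h.closedFace b' i') b i)
    (h.closedFace_cases (p := fun b' i' w' => B.a ≠ b' → sub h.top b' i' = sub w' B.a true)
      (fun e => absurd rfl e) fun _ _ hb' e => h.sub_top hb' e.symm)
    fun b i hb => h.closedFace_cases (p := fun b' i' w' => b ≠ b' →
        sub (rho (pathRefl f) (t b i)) b' i' = sub w' b i) (fun e => (h.sub_top hb e).symm)
      fun b' i' hb' hbb => by rw [← hom_sub, ← hom_sub, h.adj_t hb hb' hbb]
  lies := h.closedFace_cases (p := fun b i w => pathSrc f w = sub (fst f B.y) b i)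
    (by
      change src f (sub (kfill (diag f) true B) B.a true) = _
      rw [hom_sub, src_kfill])
    fun b i hb => by
      by_cases hba : b = B.a
      · rw [hba, h.t0, sub_of_fresh _ _ _ h.fresh]; rfl
      · rw [(h.contr b i hb hba).pathSrc_rho, src_u hb]

/-- The open box. -/
def openBox : Box true (rho (pathRefl f)) where
  A := B.A
  a := B.a
  mem := B.mem
  u b i _ := t b i
  y := h.closed.fill κ
  fresh _ _ hb := h.fresh_t hb
  adj _ _ hb _ _ hb' hbb := h.adj_t hb hb' hbb
  lies b i hb := by rw [Closed.sub_fill hb.1]; exact (h.closedFace_of_isFace hb).symm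

theorem contracts (h0 : ∀ h, B.u B.a false h = lam (diag f) (fst f B.y)) :
    Contracts B.a B h.openBox h.closed where
  Ba := rfl
  B1 := h.fresh
  B0 := h0
  CA := rfl
  Ca := rfl
  C0 _ := h.t0 _
  TA := rfl
  Tx := rfl
  T0 := by
    refine (h.closedFace_of_isFace (isFace_false B.mem)).trans ?_
    rw [h.t0]; rfl
  T1 := congrArg Subtype.val h.closedFace_top
  Tu _ _ hb _ := h.closedFace_of_isFace hb

end ContrFaces

theorem PreNF.exists_contr (κ : KanFilling f) {a : 𝔸} {z : K (diag f)} (h : PreNF f a z) :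
    ∃ t, Contr κ a z t := by
  induction h with
  | base x h => exact ⟨_, .base x h⟩
  | box B hB h1 h0 hu ih =>
    subst hB
    choose t ht using ih
    -- In direction `B.a` the default is the constant at the source, for both values of `i`. Only
    -- `(B.a, 0)` is a face of the open box; at `(B.a, 1)` the closed box takes the normal form
    -- instead.
    have key : ContrFaces κ B fun b i =>
        if h : IsFace B.A B.a true b i ∧ b ≠ B.a then t b i h.1 h.2
          else lam (pathRefl f) (fst f B.y) :=
      { nf := .box B rfl h1 h0 hu
        fresh := h1
        t0 := fun i => dif_neg fun e => e.2 rfl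
        contr := fun b i hb hba => by rw [dif_pos ⟨hb, hba⟩]; exact ht b i hb hba }
    exact ⟨_, .box B key.openBox key.closed (key.contracts h0) rfl
      fun b i hb _ hba => key.contr b i hb hba⟩

/-- The graph of the coalgebra structure. -/
def IsCoalg (κ : KanFilling f) (w : pathObj f) (s : K (pathRefl f)) : Prop :=
  ∃ a z t, Contr κ a z t ∧ sub z a true = w.1 ∧ sub t a true = s

/-! ### From contractions of pre-normal forms to a map on paths -/

namespace IsCoalg

variable {κ : KanFilling f} {w : pathObj f} {s s' : K (pathRefl f)}

theorem exists_dir (h : IsCoalg κ w s) {d : 𝔸} (hw : Fresh d w) (hs : Fresh d s) :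
    ∃ z t, Contr κ d z t ∧ sub z d true = w.1 ∧ sub t d true = s := by
  obtain ⟨a, z, t, h, hz, rfl⟩ := h
  have h1 := h.act (.perm (swp a d)) trivial
  refine ⟨swp a d • z, swp a d • t, ?_, ?_, sub_swp_of_fresh hs⟩
  · simpa only [Op.nm, Op.act, swp_left] using h1
  · rw [sub_swp_of_fresh (hz ▸ fresh_val hw), hz]

/-- Both witnesses are renamed to a common fresh direction, in which the pre-normal form of `w` and
its contraction are unique. -/
theorem unique (h : IsCoalg κ w s) (h' : IsCoalg κ w s') : s = s' := by
  obtain ⟨S, hS⟩ := Nominal.exists_supp (𝔸 := 𝔸) w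
  obtain ⟨d, hd, hs, hs'⟩ := exists_fresh₂ S s s'
  obtain ⟨z, t, h1, h2, rfl⟩ := h.exists_dir ⟨S, hS, hd⟩ hs
  obtain ⟨z', t', h1', h2', rfl⟩ := h'.exists_dir ⟨S, hS, hd⟩ hs'
  obtain rfl := h1.preNF.eq_of_sub_eq h1'.preNF (h2.trans h2'.symm)
  rw [h1.unique h1']

theorem act (h : IsCoalg κ w s) (θ : Op 𝔸) : IsCoalg κ (θ.act w) (θ.act s) := by
  obtain ⟨S, hS⟩ : ∃ S : Finset 𝔸, ∀ d ∉ S, θ.Ok d := by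
    cases θ with
    | perm π => exact ⟨∅, fun _ _ => trivial⟩
    | sb c i => exact ⟨{c}, fun d hd e => hd (by simp [e])⟩
  obtain ⟨d, hd, hw, hs⟩ := exists_fresh₂ S w s
  obtain ⟨z, t, h1, h2, rfl⟩ := h.exists_dir hw hs
  refine ⟨_, _, _, h1.act θ (hS d hd), ?_, (θ.act_sub t (hS d hd) true).symm⟩
  rw [← θ.act_sub z (hS d hd), h2]
  exact (θ.hom_act (pathIncl f) w).symm

theorem rho_eq (h : IsCoalg κ w s) : rho (pathRefl f) s = w := by
  obtain ⟨a, z, t, h, hz, rfl⟩ := h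
  exact Subtype.ext (h.rho_sub_true.trans hz)

theorem refl (κ : KanFilling f) (x : X) : IsCoalg κ (pathRefl f x) (lam (pathRefl f) x) := by
  obtain ⟨a, -, ha⟩ := exists_fresh (∅ : Finset 𝔸) x
  exact ⟨a, _, _, .base x ha, sub_of_fresh _ _ _ (ha.map (hom_smul _)),
    sub_of_fresh _ _ _ (ha.map (hom_smul _))⟩

theorem exists_isCoalg (κ : KanFilling f) (w : pathObj f) : ∃ s, IsCoalg κ w s := by
  obtain ⟨a, z, hz, e⟩ := w.2
  obtain ⟨t, ht⟩ := hz.exists_contr κ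
  exact ⟨_, a, z, t, ht, e, rfl⟩

end IsCoalg

/-- The coalgebra structure on `r` over the copointed endofunctor `L`. -/
def pathCoalg (κ : KanFilling f) : pathObj f ⟶ K (pathRefl f) where
  toFun w := (IsCoalg.exists_isCoalg κ w).choose
  map_smul' π w := (IsCoalg.exists_isCoalg κ _).choose_spec.unique
    ((IsCoalg.exists_isCoalg κ w).choose_spec.act (.perm π))
  map_sub' w c i := (IsCoalg.exists_isCoalg κ _).choose_spec.unique
    ((IsCoalg.exists_isCoalg κ w).choose_spec.act (.sb c i))

theorem isCoalg_pathCoalg (κ : KanFilling f) (w : pathObj f) : IsCoalg κ w (pathCoalg κ w) :=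
  (IsCoalg.exists_isCoalg κ w).choose_spec

theorem exists_copointedCoalgebra (hf : KanFibration f) :
    ∃ c : Arrow.mk (pathRefl f) ⟶ L.obj (Arrow.mk (pathRefl f)),
      IsCopointedCoalgebra (pathRefl f) c := by
  obtain ⟨κ⟩ := hf
  refine ⟨Arrow.homMk (𝟙 X) (pathCoalg κ) ?_, ?_⟩
  · exact hom_ext fun x => (IsCoalg.refl κ x).unique (isCoalg_pathCoalg κ _)
  · ext1
    · rfl
    · exact hom_ext fun w => (isCoalg_pathCoalg κ w).rho_eq

/-- The counit law makes `i` a retract of `λ_i`, which underlies a cofree coalgebra for the comonad.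
Coassociativity of `c` plays no role. -/
theorem lBar_of_isCopointedCoalgebra {X Y : Sub01 𝔸} {i : X ⟶ Y}
    {c : Arrow.mk i ⟶ L.obj (Arrow.mk i)} (h : IsCopointedCoalgebra i c) : LBar i :=
  ⟨_, _, lam i, ⟨c, L.ε.app (Arrow.mk i), h⟩, ⟨(Comonad.cofree L).obj (Arrow.mk i), rfl⟩⟩

end

section

/-! ### Pullbacks in `01Sub` -/

section Pullback

variable {X Y U V : Sub01 𝔸}

/-- The pullback of `f` and `k`. -/
def pullbackObj (f : X ⟶ Y) (k : V ⟶ Y) : Sub01 𝔸 where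
  carrier := {p : X × V // f p.1 = k p.2}
  str :=
    { smul := fun π p => ⟨(π • p.1.1, π • p.1.2), by simp only [hom_smul, p.2]⟩
      one_smul := fun p => Subtype.ext (Prod.ext (one_smul _ _) (one_smul _ _))
      mul_smul := fun _ _ p => Subtype.ext (Prod.ext (mul_smul _ _ _) (mul_smul _ _ _))
      exists_supp := fun p => by
        obtain ⟨A, hA⟩ := Nominal.exists_supp (𝔸 := 𝔸) p.1.1
        obtain ⟨B, hB⟩ := Nominal.exists_supp (𝔸 := 𝔸) p.1.2
        refine ⟨A ∪ B, fun π hπ => Subtype.ext (Prod.ext (hA π fun a ha => ?_)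
          (hB π fun a ha => ?_))⟩
        · exact hπ (by simp only [Finset.coe_union]; exact Or.inl ha)
        · exact hπ (by simp only [Finset.coe_union]; exact Or.inr ha)
      sub := fun p c i => ⟨(sub p.1.1 c i, sub p.1.2 c i), by simp only [hom_sub, p.2]⟩
      perm_sub := fun π p c i => Subtype.ext (Prod.ext (perm_sub _ _ _ _) (perm_sub _ _ _ _))
      fresh_sub := fun p c i => by
        obtain ⟨A, hA, ha⟩ := fresh_sub p.1.1 c i
        obtain ⟨B, hB, hb⟩ := fresh_sub p.1.2 c i
        refine ⟨A ∪ B, fun π hπ => Subtype.ext (Prod.ext (hA π fun a ha => ?_)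
          (hB π fun a ha => ?_)), by simp [ha, hb]⟩
        · exact hπ (by simp only [Finset.coe_union]; exact Or.inl ha)
        · exact hπ (by simp only [Finset.coe_union]; exact Or.inr ha)
      sub_of_fresh := fun p c i h => by
        obtain ⟨A, hA, ha⟩ := h
        have h1 : Fresh c p.1.1 := ⟨A, fun π hπ => congrArg (fun q => q.1.1) (hA π hπ), ha⟩
        have h2 : Fresh c p.1.2 := ⟨A, fun π hπ => congrArg (fun q => q.1.2) (hA π hπ), ha⟩
        exact Subtype.ext (Prod.ext (sub_of_fresh _ _ _ h1) (sub_of_fresh _ _ _ h2))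
      sub_comm := fun p a b i j h =>
        Subtype.ext (Prod.ext (sub_comm _ _ _ _ _ h) (sub_comm _ _ _ _ _ h)) }

/-- A commutative square in `01Sub` whose comparison map is bijective is a pullback. -/
theorem isPullback_of_existsUnique {h : U ⟶ X} {g : U ⟶ V} {f : X ⟶ Y} {k : V ⟶ Y}
    (w : h ≫ f = g ≫ k) (hu : ∀ x v, f x = k v → ∃! u, h u = x ∧ g u = v) :
    IsPullback h g f k := by
  choose m hm₁ hm₂ using fun x v e => (hu x v e).exists
  have hinj : ∀ u u', h u = h u' → g u = g u' → u = u' := fun u u' e₁ e₂ =>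
    (hu _ _ (congr_hom w u')).unique ⟨e₁, e₂⟩ ⟨rfl, rfl⟩
  refine ⟨⟨w⟩, ⟨Limits.PullbackCone.IsLimit.mk w
    (fun s => ⟨fun p => m (s.fst p) (s.snd p) (congr_hom s.condition p), fun π p => ?_,
      fun p c i => ?_⟩)
    (fun s => hom_ext fun p => hm₁ _ _ _) (fun s => hom_ext fun p => hm₂ _ _ _)
    fun s l h1 h2 => hom_ext fun p => ?_⟩⟩
  · apply hinj
    · rw [hm₁, hom_smul h, hm₁, hom_smul]
    · rw [hm₂, hom_smul g, hm₂, hom_smul]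
  · apply hinj
    · rw [hm₁, hom_sub h, hm₁, hom_sub]
    · rw [hm₂, hom_sub g, hm₂, hom_sub]
  · apply hinj
    · exact (congr_hom h1 p).trans (hm₁ _ _ _).symm
    · exact (congr_hom h2 p).trans (hm₂ _ _ _).symm

/-- Pullbacks in `01Sub` are computed on underlying sets. -/
theorem IsPullback.existsUnique {h : U ⟶ X} {g : U ⟶ V} {f : X ⟶ Y} {k : V ⟶ Y}
    (H : IsPullback h g f k) (x : X) (v : V) (e : f x = k v) : ∃! u, h u = x ∧ g u = v := by
  let p₁ : pullbackObj f k ⟶ X := ⟨fun p => p.1.1, fun _ _ => rfl, fun _ _ _ => rfl⟩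
  let p₂ : pullbackObj f k ⟶ V := ⟨fun p => p.1.2, fun _ _ => rfl, fun _ _ _ => rfl⟩
  have w : p₁ ≫ f = p₂ ≫ k := hom_ext fun p => p.2
  have h1 : H.lift p₁ p₂ w ≫ h = p₁ := H.lift_fst _ _ _
  have h2 : H.lift p₁ p₂ w ≫ g = p₂ := H.lift_snd _ _ _
  -- The comparison map to the set of matching pairs. The universal property of `U` gives it a left
  -- inverse, whence uniqueness.
  let q : U ⟶ pullbackObj f k :=
    ⟨fun u => ⟨(h u, g u), congr_hom H.w u⟩,
      fun π u => Subtype.ext (Prod.ext (hom_smul h π u) (hom_smul g π u)),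
      fun u c i => Subtype.ext (Prod.ext (hom_sub h u c i) (hom_sub g u c i))⟩
  have h3 : q ≫ H.lift p₁ p₂ w = 𝟙 U := by
    apply H.hom_ext
    · rw [Category.assoc, h1]; rfl
    · rw [Category.assoc, h2]; rfl
  refine ⟨H.lift p₁ p₂ w ⟨(x, v), e⟩, ⟨congr_hom h1 _, congr_hom h2 _⟩, fun u hu => ?_⟩
  have h4 : H.lift p₁ p₂ w (q u) = u := congr_hom h3 u
  rw [← h4]
  exact congrArg _ (Subtype.ext (Prod.ext hu.1 hu.2))

end Pullback

/-! ### Stability of the path object under pullback -/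

section Stability

variable [Infinite 𝔸] {X Y U V : Sub01 𝔸} {f : X ⟶ Y} {g : U ⟶ V} {h : U ⟶ X} {k : V ⟶ Y}
  (w : h ≫ f = g ≫ k)

theorem KdiagMap_lam (u : U) : KdiagMap h k w (lam (diag g) u) = lam (diag f) (h u) := rfl

theorem KdiagMap_kfill {o} (B : Box o (rho (diag g))) :
    KdiagMap h k w (kfill (diag g) o B) =
      kfill (diag f) o (B.map (KdiagMap h k w) (fibreProdMap h k w) (Kmap_rho _ _ _)) :=
  Kmap_kfill _ _ _ o B

theorem rho_KdiagMap (z : K (diag g)) :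
    rho (diag f) (KdiagMap h k w z) = fibreProdMap h k w (rho (diag g) z) :=
  (congr_hom (Kmap_rho _ _ _) z).symm

theorem src_KdiagMap (z : K (diag g)) : src f (KdiagMap h k w z) = h (src g z) :=
  congrArg (fst f) (rho_KdiagMap w z)

theorem preNF_KdiagMap {a : 𝔸} {z : K (diag g)} (hz : PreNF g a z) :
    PreNF f a (KdiagMap h k w z) := by
  induction hz with
  | base u hu => exact .base _ (hu.map (hom_smul h))
  | box B hB h1 h0 hu ih =>
    rw [KdiagMap_kfill]
    refine .box _ hB (h1.map (hom_smul h)) (fun hf => ?_) fun b i hb hba => ih b i hb hba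
    exact congrArg (KdiagMap h k w) (h0 hf)

/-- The map between path objects induced by a commutative square. -/
def pathMap : pathObj g ⟶ pathObj f where
  toFun p := ⟨KdiagMap h k w p.1, by
    obtain ⟨a, z, hz, e⟩ := p.2
    exact ⟨a, _, preNF_KdiagMap w hz, by rw [← e, hom_sub]⟩⟩
  map_smul' π p := Subtype.ext (hom_smul (KdiagMap h k w) π p.1)
  map_sub' p c i := Subtype.ext (hom_sub (KdiagMap h k w) p.1 c i)

theorem pathMap_base : pathMap w ≫ pathBase f = pathBase g ≫ k := hom_ext fun p => by
  change f (src f (KdiagMap h k w p.1)) = k (g (src g p.1))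
  rw [src_KdiagMap]
  exact congr_hom w _

variable {w} in
-- Both endpoints of a pre-normal form have the same image in `V`, so joint injectivity of `h` and
-- `g` recovers them from their images in `X` and the image of the source in `V`. Induction then
-- recovers the faces.
theorem eq_of_KdiagMap_eq
    (hinj : ∀ u u' : U, h u = h u' → g u = g u' → u = u') {a : 𝔸} {z : K (diag g)}
    (hz : PreNF g a z) {z' : K (diag g)} (hz' : PreNF g a z')
    (e : KdiagMap h k w z = KdiagMap h k w z') (eb : g (src g z) = g (src g z')) : z = z' := by
  induction hz generalizing z' with
  | base u hu => cases hz' with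
    | base u' hu' => rw [hinj u u' (lam_injective e) eb]
    | box B hB h1 h0 hu =>
      rw [KdiagMap_kfill] at e
      exact absurd e (lam_ne_kfill _ _)
  | box B hB h1 h0 hu ih => cases hz' with
    | base u' hu' =>
      rw [KdiagMap_kfill] at e
      exact absurd e.symm (lam_ne_kfill _ _)
    | box B' hB' h1' h0' hu' =>
      rw [KdiagMap_kfill, KdiagMap_kfill] at e
      have e := kfill_injective _ e
      rw [src_kfill, src_kfill] at eb
      have ey : fibreProdMap h k w B.y = fibreProdMap h k w B'.y :=
        congrArg (fun D : Box true (rho (diag f)) => D.y) e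
      have e1 : fst g B.y = fst g B'.y := hinj _ _ (congrArg (fst f) ey) eb
      have e2 : snd g B.y = snd g B'.y :=
        hinj _ _ (congrArg (snd f) ey) (B.y.2.symm.trans (eb.trans B'.y.2))
      have eA : B.A = B'.A := congrArg (fun D : Box true (rho (diag f)) => D.A) e
      congr 1
      refine Box.ext' eA (hB.trans hB'.symm) (fun b i hb hb' => ?_) (Subtype.ext (Prod.ext e1 e2))
      by_cases hba : b = a
      · subst hba
        obtain rfl : i = false := eq_false_of_isFace (hB ▸ hb)
        rw [h0, h0', e1]
      · refine ih b i hb hba (hu' b i hb' hba) (Box.u_congr e b i hb hb') ?_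
        have s1 : src g (B.u b i hb) = sub (fst g B.y) b i := congrArg (fst g) (B.lies b i hb)
        have s2 : src g (B'.u b i hb') = sub (fst g B'.y) b i := congrArg (fst g) (B'.lies b i hb')
        rw [s1, s2, e1]

variable {w} in
-- The endpoints are lifted over `v` and the face at `(b, i)` over `v(b := i)`. Uniqueness of lifts
-- shows that the lifted faces form a box again. Freshness of `a` for `v` makes the lifted source
-- fresh for `a` and puts the face at `(a, 0)` over `v` itself.
theorem exists_preNF_KdiagMap_eq (H : ∀ x v, f x = k v → ∃! u, h u = x ∧ g u = v) {a : 𝔸}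
    {z : K (diag f)} (hz : PreNF f a z) {v : V} (hv : f (src f z) = k v) (ha : Fresh a v) :
    ∃ z', PreNF g a z' ∧ KdiagMap h k w z' = z ∧ g (src g z') = v := by
  -- A permutation that fixes both components of an element of a pullback fixes the element, so
  -- supports of the two components together support it.
  have hfresh : ∀ {c : 𝔸} {u : U}, Fresh c (h u) → Fresh c (g u) → Fresh c u := by
    intro c u h1 h2
    obtain ⟨S, hS, hc⟩ := h1
    obtain ⟨S', hS', hc'⟩ := h2
    refine ⟨S ∪ S', fun π hπ => (H (h u) (g u) (congr_hom w u)).unique ?_ ⟨rfl, rfl⟩,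
      by simp [hc, hc']⟩
    rw [hom_smul, hom_smul]
    exact ⟨hS π fun a ha => hπ (by simp only [Finset.coe_union]; exact Or.inl ha),
      hS' π fun a ha => hπ (by simp only [Finset.coe_union]; exact Or.inr ha)⟩
  have hinj : ∀ u u' : U, h u = h u' → g u = g u' → u = u' := fun u u' e1 e2 =>
    (H (h u') (g u') (congr_hom w u')).unique ⟨e1, e2⟩ ⟨rfl, rfl⟩
  induction hz generalizing v with
  | base x hx =>
    obtain ⟨u, ⟨hu1, hu2⟩, -⟩ := H x v hv
    exact ⟨_, .base u (hfresh (hu1 ▸ hx) (hu2 ▸ ha)), by rw [KdiagMap_lam, hu1], hu2⟩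
  | box B hB h1 h0 hu ih =>
    subst hB
    rw [src_kfill] at hv
    obtain ⟨u₁, ⟨hu₁, hv₁⟩, -⟩ := H _ v hv
    obtain ⟨u₂, ⟨hu₂, hv₂⟩, -⟩ := H (snd f B.y) v (B.y.2.symm.trans hv)
    have hu₁a : Fresh B.a u₁ := hfresh (hu₁ ▸ h1) (hv₁ ▸ ha)
    -- The last clause pins the lift of the face at `(a, 0)` to the constant that the definition of
    -- a pre-normal form requires.
    have lift : ∀ b i (hb : IsFace B.A B.a true b i), ∃ z', PreNF g B.a z' ∧
        KdiagMap h k w z' = B.u b i hb ∧ g (src g z') = sub v b i ∧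
        (b = B.a → z' = lam (diag g) u₁) := fun b i hb => by
      by_cases hba : b = B.a
      · refine ⟨lam (diag g) u₁, .base _ hu₁a, ?_, ?_, fun _ => rfl⟩
        · subst hba
          obtain rfl := eq_false_of_isFace hb
          rw [h0, KdiagMap_lam, hu₁]
        · rw [src_lam, hv₁, sub_of_fresh _ _ _ (hba ▸ ha)]
      · have e : src f (B.u b i hb) = sub (fst f B.y) b i := congrArg (fst f) (B.lies b i hb)
        obtain ⟨z', h1, h2, h3⟩ := ih b i hb hba (v := sub v b i)
          (by rw [e, hom_sub, hv, hom_sub]) (fresh_sub_of_fresh ha (Ne.symm hba) i)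
        exact ⟨z', h1, h2, h3, fun e => absurd e hba⟩
    choose z' hz' hmap hsrc hz'a using lift
    let q : fibreProd g := ⟨(u₁, u₂), hv₁.trans hv₂.symm⟩
    have hrho : ∀ b i hb, rho (diag g) (z' b i hb) =
        sub q b i := fun b i hb => by
      have e := (rho_KdiagMap w (z' b i hb)).symm
      rw [hmap, B.lies] at e
      have e1 : h (src g (z' b i hb)) = sub (fst f B.y) b i := congrArg (fst f) e
      have e2 : h (tgt g (z' b i hb)) = sub (snd f B.y) b i := congrArg (snd f) e
      refine rho_ext (hinj _ _ ?_ ?_) (hinj _ _ ?_ ?_)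
      · rw [e1, ← hu₁, ← hom_sub]; rfl
      · rw [hsrc, ← hv₁, ← hom_sub]; rfl
      · rw [e2, ← hu₂, ← hom_sub]; rfl
      · rw [← src_tgt, hsrc, ← hv₂, ← hom_sub]; rfl
    have hsrc' : ∀ b i hb, src g (z' b i hb) = sub u₁ b i := fun b i hb =>
      congrArg (fst g) (hrho b i hb)
    have hsub : ∀ b i hb, sub (z' b i hb) B.a false = sub (lam (diag g) u₁) b i := fun b i hb => by
      rw [(hz' b i hb).sub_false, hsrc', hom_sub]
    let C : Box true (rho (diag g)) :=
      { A := B.A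
        a := B.a
        mem := B.mem
        u := z'
        y := q
        fresh := fun b i hb => by
          by_cases hba : b = B.a
          · rw [hz'a b i hb hba, hba]
            exact hu₁a.map (hom_smul _)
          -- Substituting for `b` gives a second lift of the same face with the same image in `V`;
          -- by uniqueness it equals the first, so `b` is fresh for it.
          · have e : sub (z' b i hb) b false = z' b i hb := by
              refine eq_of_KdiagMap_eq (w := w) hinj ((hz' b i hb).sub hba false) (hz' b i hb) ?_ ?_
              · rw [hom_sub, hmap, sub_of_fresh _ _ _ (B.fresh b i hb)]
              · rw [hom_sub, hom_sub, hsrc, sub_of_fresh _ _ _ (fresh_sub _ _ _)]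
            rw [← e]
            exact fresh_sub _ _ _
        adj := fun b i hb b' i' hb' hbb => by
          by_cases hba : b = B.a
          · subst hba
            obtain rfl := eq_false_of_isFace hb
            rw [hz'a _ _ hb rfl, hsub]
          · by_cases hba' : b' = B.a
            · subst hba'
              obtain rfl := eq_false_of_isFace hb'
              rw [hz'a _ _ hb' rfl, hsub]
            -- Both sides lift the same element of `K (diag f)` and have the same image in `V`.
            · refine eq_of_KdiagMap_eq (w := w) hinj ((hz' b i hb).sub hba' i')
                ((hz' b' i' hb').sub hba i) ?_ ?_
              · rw [hom_sub, hom_sub, hmap, hmap, B.adj b i hb b' i' hb' hbb]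
              · rw [hom_sub, hom_sub, hom_sub, hom_sub, hsrc, hsrc, sub_comm _ _ _ _ _ hbb]
        lies := hrho }
    refine ⟨kfill (diag g) true C, .box C rfl hu₁a (fun hb => hz'a _ _ hb rfl)
      fun b i hb _ => hz' b i hb, ?_, ?_⟩
    · rw [KdiagMap_kfill]
      exact congrArg _ (Box.ext' rfl rfl (fun b i hb _ => hmap b i hb)
        (Subtype.ext (Prod.ext hu₁ hu₂)))
    · rw [src_kfill]; exact hv₁

theorem isPullback_pathMap (H : IsPullback h g f k) :
    IsPullback (pathMap w) (pathBase g) (pathBase f) k := by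
  have H := IsPullback.existsUnique H
  have hinj : ∀ u u' : U, h u = h u' → g u = g u' → u = u' := fun u u' e1 e2 =>
    (H (h u') (g u') (congr_hom w u')).unique ⟨e1, e2⟩ ⟨rfl, rfl⟩
  have hbase : ∀ {X Y : Sub01 𝔸} {f : X ⟶ Y} (p : pathObj f) {d : 𝔸} (_ : Fresh d p),
      f (src f (pnf p d)) = pathBase f p := fun p d hd => by rw [src_pnf hd]; rfl
  refine isPullback_of_existsUnique (pathMap_base w) fun q v e => ?_
  obtain ⟨d, -, hdq, hdv⟩ := exists_fresh₂ (∅ : Finset 𝔸) q v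
  obtain ⟨z, hz, hzq, hzv⟩ := exists_preNF_KdiagMap_eq (w := w) H (preNF_pnf hdq)
    ((hbase q hdq).trans e) hdv
  refine ⟨⟨sub z d true, d, z, hz, rfl⟩, ⟨Subtype.ext ?_, ?_⟩, fun p hp => ?_⟩
  · change KdiagMap h k w (sub z d true) = q.1
    rw [hom_sub, hzq, sub_pnf hdq]
  · change g (src g (sub z d true)) = v
    rw [hz.src_sub_self, hzv]
  -- Another lift `p` is compared with the constructed one in a direction `c` fresh for both, where
  -- each comes from a single pre-normal form and these have equal images.
  · obtain ⟨c, -, hcp, hcz⟩ := exists_fresh₂ (∅ : Finset 𝔸) p (sub z d true)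
    refine Subtype.ext ?_
    change p.1 = sub z d true
    have hz' := hz.smul (swp d c)
    rw [swp_left] at hz'
    have es : sub (swp d c • z) c true = sub z d true := sub_swp_of_fresh hcz
    rw [← sub_pnf hcp, ← es]
    congr 1
    refine eq_of_KdiagMap_eq (w := w) hinj (preNF_pnf hcp) hz' ?_ ?_
    · refine (preNF_KdiagMap w (preNF_pnf hcp)).eq_of_sub_eq (preNF_KdiagMap w hz') ?_
      rw [← hom_sub, ← hom_sub, sub_pnf hcp, es, hom_sub, hzq, sub_pnf hdq]
      exact congrArg Subtype.val hp.1
    · rw [hbase p hcp, ← hz'.src_sub_self true, es, hz.src_sub_self, hzv, hp.2]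

end Stability

end

end

end ZeroOneSub

theorem mainTheorem8 {𝔸 : Type u} [Infinite 𝔸] {X Y : Sub01 𝔸} (f : X ⟶ Y)
    (hf : KanFibration f) :
    -- `r : X ⟶ P_Y X` has a coalgebra structure over the copointed endofunctor `L`
    (∃ c : Arrow.mk (pathRefl f) ⟶ L.obj (Arrow.mk (pathRefl f)),
      IsCopointedCoalgebra (pathRefl f) c) ∧
    -- `r` belongs to `L̄`
    LBar (pathRefl f) ∧
    -- `P_Y X` is a path object on `f`
    IsPathObject f (pathRefl f) (pathProj f) ∧
    -- `P_Y X` is functorial and stable under pullback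
    ∀ {U V : Sub01 𝔸} (g : U ⟶ V) (h : U ⟶ X) (k : V ⟶ Y) (w : h ≫ f = g ≫ k),
      ∃ φ : pathObj g ⟶ pathObj f,
        φ ≫ pathIncl f = pathIncl g ≫ KdiagMap h k w ∧
        φ ≫ pathBase f = pathBase g ≫ k ∧
        (IsPullback h g f k → IsPullback φ (pathBase g) (pathBase f) k) := by
  have hr := exists_copointedCoalgebra hf
  have hl : LBar (pathRefl f) := lBar_of_isCopointedCoalgebra hr.choose_spec
  exact ⟨hr, hl, ⟨hl, kanFibration_pathProj hf, rfl⟩, fun g h k w =>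
    ⟨pathMap w, rfl, pathMap_base w, isPullback_pathMap w⟩⟩
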